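/- Let $n\ge 1$ and let $\widetilde M$ be a compact (Hausdorff) smooth manifold of dimension $n+1$ with a projective structure $[\nabla]$ (a class of projectively equivalent torsion-free connections). Let $\mathcal E(w)$ be the bundle of projective densities of weight $w$, $\mathcal T$ the standard projective tractor bundle with its normal tractor connection $\nabla$, $X^A\in\Gamma(\mathcal T(1))$ the canonical tractor, and $Z_A^a:\mathcal T\to T\widetilde M(-1)$ the canonical projection. Let $H^{AB}$ be a smooth, symmetric, non-degenerate section of $\mathcal T\otimes\mathcal T$ with two minus signs and $n$ plus signs, $\nabla_aH^{AB}=0$, with inverse $\Phi_{AB}$, and let $I^A$ be a smooth nowhere vanishing section of $\mathcal T$ with $\nabla_aI^A=0$ and $\Phi_{AB}I^AI^B=0$. Put $$n^a=Z^a_AI^A\in\Gamma(T\widetilde M(-1)),\qquad \sigma=\Phi_{AB}I^AX^B\in\Gamma(\mathcal E(1)),\qquad \lambda=\Phi_{AB}X^AX^B\in\Gamma(\mathcal E(2)),$$ let $\mathcal Z(n)$ be the zero set of $n^a$, $M=\widetilde M\setminus\mathcal Z(n)$, and $$\mathcal O=\{\sigma\ne0\},\quad \Sigma^-=\{\sigma=0,\lambda<0\},\quad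 \Sigma^+=\{\sigma=0,\lambda>0\},\quad \Sigma^0=\{\sigma=\lambda=0\}\setminus\mathcal Z(n).$$ Let $\nu$ be any smooth nowhere vanishing density of weight $1$ on $\widetilde M$. Then: 1. The smooth vector field $N^a=\nu n^a$ has a global smooth flow on $\widetilde M$; $M$ is the disjoint union $M=\mathcal O\sqcup\Sigma^-\sqcup\Sigma^0\sqcup\Sigma^+$, and every time-$t$ map of the flow maps each of $\mathcal O,\Sigma^-,\Sigma^0,\Sigma^+,\mathcal Z(n)$ onto itself. 2. $\mathcal O$ and $M$ are open, and the quotient $\mathcal Q_{\mathcal O}$ of $\mathcal O$ by the flow, with the quotient topology, is a smooth (Hausdorff, second countable) manifold of dimension $n$, for a smooth structure for which the projection $\mathcal O\to\mathcal Q_{\mathcal O}$ is a smooth submersion. 3. Suppose that the quotient $\mathcal Q$ of $M$ by the flow, with the quotient topology, is also a smooth (Hausdorff, second countable) manifold of dimension $n$ for which the projection $\pi:M\to\mathcal Q$ is a smooth submersion. Then, with $\mathcal H^{\pm}=\pi(\Sigma^{\pm})$ and $\mathcal H^0=\pi(\Sigma^0)$, $$\mathcal Q=\pi(\mathcal O)\sqcup\mathcal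 H^-\sqcup\mathcal H^0\sqcup\mathcal H^+$$ is a disjoint union; $\pi(\mathcal O)$ is open and the natural map $\mathcal Q_{\mathcal O}\to\mathcal Q$ is an injective local diffeomorphism with image $\pi(\mathcal O)$, so that $\mathcal Q_{\mathcal O}\cong\pi(\mathcal O)$; and $\mathcal H^-$, $\mathcal H^+$ and $\mathcal H=\mathcal H^-\sqcup\mathcal H^0\sqcup\mathcal H^+$ are embedded submanifolds of $\mathcal Q$ of codimension $1$, and $\mathcal H^0$ one of codimension $2$ (each possibly empty). -/

import Mathlib

open Set Topology Manifold ContDiff TopologicalSpace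

noncomputable section

/-! ### Torsion-free connections and projective structures -/

/-- Euclidean space of dimension `k`, the model space of all manifolds below. -/
abbrev Euc (k : ℕ) : Type := EuclideanSpace ℝ (Fin k)

/-- A smooth torsion-free affine connection on a manifold `M` of dimension `n + 1`. -/
structure TorsionFreeConnection (n : ℕ) (M : Type*) [TopologicalSpace M]
    [ChartedSpace (Euc (n + 1)) M] [IsManifold (𝓡 (n + 1)) ∞ M] where
  /-- The covariant derivative: `cov Y x v` is `(∇_v Y)(x)`. -/
  cov : CovariantDerivative (𝓡 (n + 1)) (Euc (n + 1))
    (TangentSpace (𝓡 (n + 1)) : M → Type _)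
  smooth : CovariantDerivative.ContMDiffCovariantDerivative cov ∞
  torsion_free : cov.torsion = 0

section Geometry

variable {n : ℕ} {M : Type*} [TopologicalSpace M] [ChartedSpace (Euc (n + 1)) M]

/-- `D' = D + Υ`, i.e. `D'_v Y = D_v Y + Υ(v) Y + Υ(Y) v` for a 1-form `Υ`
(which is automatically smooth, `D` and `D'` being so). -/
def IsProjectiveChange [IsManifold (𝓡 (n + 1)) ∞ M] (D D' : TorsionFreeConnection n M)
    (Υ : (x : M) → TangentSpace (𝓡 (n + 1)) x →L[ℝ] ℝ) : Prop :=
  ∀ (Y : (x : M) → TangentSpace (𝓡 (n + 1)) x) (x : M),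
    MDifferentiableAt (𝓡 (n + 1)) ((𝓡 (n + 1)).prod 𝓘(ℝ, Euc (n + 1)))
      (fun y => (⟨y, Y y⟩ : TangentBundle (𝓡 (n + 1)) M)) x →
    ∀ v : TangentSpace (𝓡 (n + 1)) x,
      D'.cov Y x v = D.cov Y x v + Υ x v • Y x + Υ x (Y x) • v

variable (n M) in
/-- A projective structure: a projective equivalence class of torsion-free connections. -/
structure ProjectiveStructure [IsManifold (𝓡 (n + 1)) ∞ M] where
  /-- The connections of the class. -/
  conns : Set (TorsionFreeConnection n M)
  nonempty : conns.Nonempty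
  mem_iff : ∀ D ∈ conns, ∀ D', D' ∈ conns ↔ ∃ Υ, IsProjectiveChange D D' Υ

/-- Some connection of the class (a "scale"). -/
def ProjectiveStructure.rep [IsManifold (𝓡 (n + 1)) ∞ M] (c : ProjectiveStructure n M) :
    c.conns :=
  ⟨c.nonempty.choose, c.nonempty.choose_spec⟩

theorem ProjectiveStructure.exists_change [IsManifold (𝓡 (n + 1)) ∞ M]
    (c : ProjectiveStructure n M) (D D' : c.conns) :
    ∃ Υ, IsProjectiveChange D.1 D'.1 Υ :=
  (c.mem_iff D.1 D.2 D'.1).1 D'.2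

/-! ### Coordinates -/

/-- The coordinate vector field `∂_j` of the chart `φ` (meaningful on `φ.source`). -/
def coordField (φ : OpenPartialHomeomorph M (Euc (n + 1))) (j : Fin (n + 1)) (x : M) :
    TangentSpace (𝓡 (n + 1)) x :=
  (mfderiv (𝓡 (n + 1)) 𝓘(ℝ, Euc (n + 1)) φ x).inverse
    (EuclideanSpace.single j (1 : ℝ) : Euc (n + 1))

/-- The coordinate frame `(∂_0, …, ∂_n)` of the chart `φ` at `x`. -/
def coordFrame (φ : OpenPartialHomeomorph M (Euc (n + 1))) (x : M) :
    Fin (n + 1) → TangentSpace (𝓡 (n + 1)) x :=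
  fun j => coordField φ j x

/-- The partial derivative `∂_i f` in the chart `φ`. -/
def partialDeriv (φ : OpenPartialHomeomorph M (Euc (n + 1))) (i : Fin (n + 1))
    (f : M → ℝ) (x : M) : ℝ :=
  mfderiv (𝓡 (n + 1)) 𝓘(ℝ, ℝ) f x (coordField φ i x)

/-- The Christoffel symbol `Γ^k_{ij}`: `∇_{∂_i} ∂_j = Γ^k_{ij} ∂_k`. -/
def christoffel [IsManifold (𝓡 (n + 1)) ∞ M] (D : TorsionFreeConnection n M)
    (φ : OpenPartialHomeomorph M (Euc (n + 1))) (k i j : Fin (n + 1)) (x : M) : ℝ :=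
  let v : Euc (n + 1) := mfderiv (𝓡 (n + 1)) 𝓘(ℝ, Euc (n + 1)) φ x
    (D.cov (coordField φ j) x (coordField φ i x))
  v k

/-- The trace `Γ^k_{ik}`: minus the connection form of the bundle of volume densities. -/
def christoffelTrace [IsManifold (𝓡 (n + 1)) ∞ M] (D : TorsionFreeConnection n M)
    (φ : OpenPartialHomeomorph M (Euc (n + 1))) (i : Fin (n + 1)) (x : M) : ℝ :=
  ∑ k, christoffel D φ k i k x

/-- The component `R_{ij}{}^k{}_l` of the curvature, `[∇_i, ∇_j] v^k = R_{ij}{}^k{}_l v^l`. -/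
def curvature [IsManifold (𝓡 (n + 1)) ∞ M] (D : TorsionFreeConnection n M)
    (φ : OpenPartialHomeomorph M (Euc (n + 1))) (i j k l : Fin (n + 1)) (x : M) : ℝ :=
  partialDeriv φ i (christoffel D φ k j l) x - partialDeriv φ j (christoffel D φ k i l) x
    + ∑ m, (christoffel D φ k i m x * christoffel D φ m j l x
      - christoffel D φ k j m x * christoffel D φ m i l x)

/-- The Ricci tensor `R_{ab} = R_{da}{}^d{}_b`. -/
def ricci [IsManifold (𝓡 (n + 1)) ∞ M] (D : TorsionFreeConnection n M)
    (φ : OpenPartialHomeomorph M (Euc (n + 1))) (a b : Fin (n + 1)) (x : M) : ℝ :=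
  ∑ d, curvature D φ d a d b x

/-- The projective Schouten tensor: `n P_{ab} = R_{ab} + β_{ab}` with
`β_{ab} = -(R_{ab} - R_{ba}) / (n + 2)`. -/
def schouten [IsManifold (𝓡 (n + 1)) ∞ M] (D : TorsionFreeConnection n M)
    (φ : OpenPartialHomeomorph M (Euc (n + 1))) (a b : Fin (n + 1)) (x : M) : ℝ :=
  (ricci D φ a b x - (ricci D φ a b x - ricci D φ b a x) / (n + 2)) / n

/-! ### Densities

A frame at `x` is a linearly independent family `u : Fin (n + 1) → T_x M`; the group
`GL(n + 1, ℝ)` acts on frames by `(u · A)_j = ∑ i, A i j • u i`.  Sections of the bundle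
associated with a representation `r` are functions `s` of the frames with
`s (u · A) = r (A)⁻¹ s (u)`. -/

/-- The frame `u · A`. -/
def frameMul {x : M} (u : Fin (n + 1) → TangentSpace (𝓡 (n + 1)) x)
    (A : Matrix (Fin (n + 1)) (Fin (n + 1)) ℝ) : Fin (n + 1) → TangentSpace (𝓡 (n + 1)) x :=
  fun j => ∑ i, A i j • u i

/-- The standard frame of the tangent space `T_x M`, which is modelled on `Euc (n + 1)`. -/
def stdFrame (x : M) : Fin (n + 1) → TangentSpace (𝓡 (n + 1)) x :=
  fun j => (EuclideanSpace.single j (1 : ℝ) : Euc (n + 1))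

theorem stdFrame_linearIndependent (x : M) :
    LinearIndependent ℝ (stdFrame x : Fin (n + 1) → TangentSpace (𝓡 (n + 1)) x) := by
  have h := (EuclideanSpace.basisFun (Fin (n + 1)) ℝ).toBasis.linearIndependent
  have e : (⇑(EuclideanSpace.basisFun (Fin (n + 1)) ℝ).toBasis : Fin (n + 1) → Euc (n + 1)) =
      fun j => EuclideanSpace.single j (1 : ℝ) := by
    ext j
    simp
  rw [e] at h
  exact h

/-- Any two frames differ by an invertible matrix. -/
theorem exists_frameMul_eq {x : M} {u v : Fin (n + 1) → TangentSpace (𝓡 (n + 1)) x}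
    (hu : LinearIndependent ℝ u) (hv : LinearIndependent ℝ v) :
    ∃ A : Matrix (Fin (n + 1)) (Fin (n + 1)) ℝ, A.det ≠ 0 ∧ v = frameMul u A := by
  have hd : Fintype.card (Fin (n + 1)) =
      Module.finrank ℝ (TangentSpace (𝓡 (n + 1)) x) := by
    change _ = Module.finrank ℝ (Euc (n + 1))
    simp
  let bu := basisOfLinearIndependentOfCardEqFinrank hu hd
  let bv := basisOfLinearIndependentOfCardEqFinrank hv hd
  refine ⟨bu.toMatrix bv, ?_, ?_⟩
  · have h : (bu.toMatrix bv * bv.toMatrix bu).det = 1 := by simp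
    rw [Matrix.det_mul] at h
    exact left_ne_zero_of_mul_eq_one h
  · funext j
    have h := bu.sum_toMatrix_smul_self bv j
    simp only [bu, bv, coe_basisOfLinearIndependentOfCardEqFinrank] at h
    simp only [frameMul, bu, bv]
    rw [← h]
    simp

variable (n M) in
/-- A section of `E(w)`, the bundle associated with the frame bundle by the representation
`A ↦ |det A| ^ (w / (n + 2))`: a projective density of weight `w`. -/
structure Density (w : ℝ) where
  /-- The value at `x` in the frame `u`. -/
  toFun : (x : M) → (Fin (n + 1) → TangentSpace (𝓡 (n + 1)) x) → ℝ
  frame_change : ∀ (x : M) (u : Fin (n + 1) → TangentSpace (𝓡 (n + 1)) x),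
    LinearIndependent ℝ u → ∀ A : Matrix (Fin (n + 1)) (Fin (n + 1)) ℝ, A.det ≠ 0 →
      toFun x (frameMul u A) = |A.det| ^ (-w / (n + 2)) * toFun x u

/-- Smoothness: the components in the charts of the atlas are smooth. -/
def Density.IsSmooth {w : ℝ} (s : Density n M w) : Prop :=
  ∀ φ ∈ atlas (Euc (n + 1)) M,
    ContMDiffOn (𝓡 (n + 1)) 𝓘(ℝ, ℝ) ∞ (fun x => s.toFun x (coordFrame φ x)) φ.source

/-- The density vanishes at `x`. -/
def Density.ZeroAt {w : ℝ} (s : Density n M w) (x : M) : Prop :=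
  ∀ u : Fin (n + 1) → TangentSpace (𝓡 (n + 1)) x, LinearIndependent ℝ u → s.toFun x u = 0

/-- The density is positive at `x`. -/
def Density.PosAt {w : ℝ} (s : Density n M w) (x : M) : Prop :=
  ∀ u : Fin (n + 1) → TangentSpace (𝓡 (n + 1)) x, LinearIndependent ℝ u → 0 < s.toFun x u

/-- The density is negative at `x`. -/
def Density.NegAt {w : ℝ} (s : Density n M w) (x : M) : Prop :=
  ∀ u : Fin (n + 1) → TangentSpace (𝓡 (n + 1)) x, LinearIndependent ℝ u → s.toFun x u < 0

/-! ### Tractors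

In a scale `D` and a frame `u`, a standard tractor `T = ξ^a W_a + ρ X` has the components
`(ξ^a, ρ)`, indexed by `Fin (n + 1) ⊕ Unit`; `ξ` and `ρ` are of weight `-1`. -/

/-- Index set of the components of tractors. -/
abbrev TIdx (n : ℕ) : Type := Fin (n + 1) ⊕ Unit

/-- Passage from the components in the frame `u` to those in the frame `u · A`:
`ξ ↦ |det A| ^ (1 / (n + 2)) A⁻¹ ξ`, `ρ ↦ |det A| ^ (1 / (n + 2)) ρ`. -/
def frameMatrix (A : Matrix (Fin (n + 1)) (Fin (n + 1)) ℝ) : Matrix (TIdx n) (TIdx n) ℝ :=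
  (|A.det| ^ ((1 : ℝ) / (n + 2))) • Matrix.fromBlocks A⁻¹ 0 0 1

/-- Passage from the components in the scale `D` to those in the scale `D + Υ`, where
`υ_a = Υ(u_a)`: `ξ ↦ ξ`, `ρ ↦ ρ - υ_a ξ^a`. -/
def scaleMatrix (υ : Fin (n + 1) → ℝ) : Matrix (TIdx n) (TIdx n) ℝ :=
  Matrix.fromBlocks 1 0 (Matrix.of fun _ a => -υ a) 1

/-- The matrix `A_i` of the normal tractor connection in the chart `φ` and the scale `D`:
`∇_i T = ∂_i T + A_i T`, that is
`∇_i (ξ^a W_a + ρ X) = (∇_i ξ^a + ρ δ_i^a) W_a + (∇_i ρ - P_{ib} ξ^b) X`, where on densities of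
weight `-1` one has `∇_i = ∂_i - Γ^k_{ik} / (n + 2)`. -/
def tractorConnection [IsManifold (𝓡 (n + 1)) ∞ M] (D : TorsionFreeConnection n M)
    (φ : OpenPartialHomeomorph M (Euc (n + 1))) (i : Fin (n + 1)) (x : M) :
    Matrix (TIdx n) (TIdx n) ℝ :=
  Matrix.fromBlocks
    (Matrix.of fun a b =>
      christoffel D φ a i b x - if a = b then christoffelTrace D φ i x / (n + 2) else 0)
    (Matrix.of fun a _ => if a = i then 1 else 0)
    (Matrix.of fun _ b => -schouten D φ i b x)
    (Matrix.of fun _ _ => -(christoffelTrace D φ i x / (n + 2)))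

/-- The components of the canonical tractor `X`, of weight `1`. -/
def tractorX (n : ℕ) : TIdx n → ℝ := Sum.elim (fun _ => 0) (fun _ => 1)

variable [IsManifold (𝓡 (n + 1)) ∞ M]

/-- A section of the standard tractor bundle of a projective structure. -/
structure TractorField (c : ProjectiveStructure n M) where
  /-- The components in the scale `D` and the frame `u` at `x`. -/
  toFun : c.conns → (x : M) → (Fin (n + 1) → TangentSpace (𝓡 (n + 1)) x) → (TIdx n → ℝ)
  frame_change : ∀ (D : c.conns) (x : M) (u : Fin (n + 1) → TangentSpace (𝓡 (n + 1)) x),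
    LinearIndependent ℝ u → ∀ A : Matrix (Fin (n + 1)) (Fin (n + 1)) ℝ, A.det ≠ 0 →
      toFun D x (frameMul u A) = (frameMatrix A).mulVec (toFun D x u)
  scale_change : ∀ (D D' : c.conns) (Υ : (x : M) → TangentSpace (𝓡 (n + 1)) x →L[ℝ] ℝ),
    IsProjectiveChange D.1 D'.1 Υ →
    ∀ (x : M) (u : Fin (n + 1) → TangentSpace (𝓡 (n + 1)) x), LinearIndependent ℝ u →
      toFun D' x u = (scaleMatrix fun a => Υ x (u a)).mulVec (toFun D x u)

/-- A section `H^{AB}` of the tensor square of the standard tractor bundle. -/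
structure TractorBitensor (c : ProjectiveStructure n M) where
  /-- The components in the scale `D` and the frame `u` at `x`. -/
  toFun : c.conns → (x : M) → (Fin (n + 1) → TangentSpace (𝓡 (n + 1)) x) →
    Matrix (TIdx n) (TIdx n) ℝ
  frame_change : ∀ (D : c.conns) (x : M) (u : Fin (n + 1) → TangentSpace (𝓡 (n + 1)) x),
    LinearIndependent ℝ u → ∀ A : Matrix (Fin (n + 1)) (Fin (n + 1)) ℝ, A.det ≠ 0 →
      toFun D x (frameMul u A) = frameMatrix A * toFun D x u * (frameMatrix A).transpose
  scale_change : ∀ (D D' : c.conns) (Υ : (x : M) → TangentSpace (𝓡 (n + 1)) x →L[ℝ] ℝ),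
    IsProjectiveChange D.1 D'.1 Υ →
    ∀ (x : M) (u : Fin (n + 1) → TangentSpace (𝓡 (n + 1)) x), LinearIndependent ℝ u →
      toFun D' x u = scaleMatrix (fun a => Υ x (u a)) * toFun D x u *
        (scaleMatrix fun a => Υ x (u a)).transpose

variable {c : ProjectiveStructure n M}

/-- Smoothness of a tractor field. -/
def TractorField.IsSmooth (T : TractorField c) : Prop :=
  ∀ D : c.conns, ∀ φ ∈ atlas (Euc (n + 1)) M, ∀ A : TIdx n,
    ContMDiffOn (𝓡 (n + 1)) 𝓘(ℝ, ℝ) ∞ (fun x => T.toFun D x (coordFrame φ x) A) φ.source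

/-- Smoothness of a tractor bitensor. -/
def TractorBitensor.IsSmooth (H : TractorBitensor c) : Prop :=
  ∀ D : c.conns, ∀ φ ∈ atlas (Euc (n + 1)) M, ∀ A B : TIdx n,
    ContMDiffOn (𝓡 (n + 1)) 𝓘(ℝ, ℝ) ∞ (fun x => H.toFun D x (coordFrame φ x) A B) φ.source

/-- `∇_a T^A = 0` for the normal tractor connection. -/
def TractorField.IsParallel (T : TractorField c) : Prop :=
  ∀ D : c.conns, ∀ φ ∈ atlas (Euc (n + 1)) M, ∀ x ∈ φ.source, ∀ i : Fin (n + 1), ∀ A : TIdx n,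
    partialDeriv φ i (fun y => T.toFun D y (coordFrame φ y) A) x
      + (tractorConnection D.1 φ i x).mulVec (T.toFun D x (coordFrame φ x)) A = 0

/-- `∇_a H^{AB} = 0` for the normal tractor connection. -/
def TractorBitensor.IsParallel (H : TractorBitensor c) : Prop :=
  ∀ D : c.conns, ∀ φ ∈ atlas (Euc (n + 1)) M, ∀ x ∈ φ.source, ∀ i : Fin (n + 1), ∀ A B : TIdx n,
    partialDeriv φ i (fun y => H.toFun D y (coordFrame φ y) A B) x
      + (tractorConnection D.1 φ i x * H.toFun D x (coordFrame φ x)) A B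
      + (H.toFun D x (coordFrame φ x) * (tractorConnection D.1 φ i x).transpose) A B = 0

/-- The tractor field vanishes nowhere. -/
def TractorField.NowhereZero (T : TractorField c) : Prop :=
  ∀ (D : c.conns) (x : M) (u : Fin (n + 1) → TangentSpace (𝓡 (n + 1)) x),
    LinearIndependent ℝ u → T.toFun D x u ≠ 0

/-- `H^{AB}` is symmetric, non-degenerate, with `q` minus signs and `p` plus signs. -/
def TractorBitensor.HasSignature (H : TractorBitensor c) (q p : ℕ) : Prop :=
  ∀ (D : c.conns) (x : M) (u : Fin (n + 1) → TangentSpace (𝓡 (n + 1)) x),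
    LinearIndependent ℝ u →
      (H.toFun D x u).IsSymm ∧ (H.toFun D x u).det ≠ 0 ∧
      sigNeg (H.toFun D x u).toQuadraticForm' = q ∧
      sigPos (H.toFun D x u).toQuadraticForm' = p

/-- The tractor `I` is null for the inverse `Φ_{AB}` of `H^{AB}`: `Φ_{AB} I^A I^B = 0`. -/
def TractorBitensor.IsNull (H : TractorBitensor c) (I : TractorField c) : Prop :=
  ∀ (D : c.conns) (x : M) (u : Fin (n + 1) → TangentSpace (𝓡 (n + 1)) x),
    LinearIndependent ℝ u →
      I.toFun D x u ⬝ᵥ ((H.toFun D x u)⁻¹).mulVec (I.toFun D x u) = 0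

/-! ### The densities `σ`, `λ` and the weighted vector field `n^a` -/

theorem frameMatrix_isUnit {A : Matrix (Fin (n + 1)) (Fin (n + 1)) ℝ} (hA : A.det ≠ 0) :
    IsUnit (frameMatrix A).det := by
  have h : (0 : ℝ) < |A.det| ^ ((1 : ℝ) / (n + 2)) := by positivity
  rw [frameMatrix, Matrix.det_smul, Matrix.det_fromBlocks_zero₁₂, Matrix.det_one, mul_one,
    Matrix.det_nonsing_inv]
  refine IsUnit.mul (IsUnit.mk0 _ (pow_ne_zero _ h.ne')) ?_
  rw [Ring.inverse_eq_inv']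
  exact IsUnit.mk0 _ (inv_ne_zero hA)

theorem scaleMatrix_isUnit (υ : Fin (n + 1) → ℝ) : IsUnit (scaleMatrix υ).det := by
  rw [scaleMatrix, Matrix.det_fromBlocks_zero₁₂]
  simp

theorem frameMatrix_mulVec_X (A : Matrix (Fin (n + 1)) (Fin (n + 1)) ℝ) :
    (frameMatrix A).mulVec (tractorX n) = (|A.det| ^ ((1 : ℝ) / (n + 2))) • tractorX n := by
  ext (a | a) <;> simp [frameMatrix, tractorX, Matrix.mulVec, dotProduct]

theorem scaleMatrix_mulVec_X (υ : Fin (n + 1) → ℝ) :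
    (scaleMatrix υ).mulVec (tractorX n) = tractorX n := by
  ext (a | a) <;> simp [scaleMatrix, tractorX, Matrix.mulVec, dotProduct, Matrix.one_apply]

/-- Congruence-invariance of the pairing with the inverse matrix. -/
theorem pairing_congr {ι : Type*} [Fintype ι] [DecidableEq ι] (B S : Matrix ι ι ℝ)
    (hB : IsUnit B.det) (v w : ι → ℝ) :
    B.mulVec v ⬝ᵥ ((B * S * B.transpose)⁻¹).mulVec (B.mulVec w) = v ⬝ᵥ (S⁻¹).mulVec w := by
  have h1 : B⁻¹ * B = 1 := Matrix.nonsing_inv_mul B hB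
  rw [Matrix.mul_inv_rev, Matrix.mul_inv_rev, Matrix.mulVec_mulVec, Matrix.mul_assoc,
    Matrix.mul_assoc, h1, Matrix.mul_one, ← Matrix.transpose_nonsing_inv, ← Matrix.mulVec_mulVec,
    Matrix.dotProduct_mulVec, Matrix.vecMul_transpose, Matrix.mulVec_mulVec, h1,
    Matrix.one_mulVec]

/-- `σ = Φ_{AB} I^A X^B`, a density of weight `1`. -/
def sigmaDensity (H : TractorBitensor c) (I : TractorField c) : Density n M 1 where
  toFun x u := I.toFun c.rep x u ⬝ᵥ ((H.toFun c.rep x u)⁻¹).mulVec (tractorX n)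
  frame_change x u hu A hA := by
    have h : (0 : ℝ) < |A.det| ^ ((1 : ℝ) / (n + 2)) := by positivity
    have hX : tractorX n =
        (frameMatrix A).mulVec ((|A.det| ^ ((1 : ℝ) / (n + 2)))⁻¹ • tractorX n) := by
      rw [Matrix.mulVec_smul, frameMatrix_mulVec_X, smul_smul, inv_mul_cancel₀ h.ne', one_smul]
    rw [I.frame_change _ x u hu A hA, H.frame_change _ x u hu A hA]
    conv_lhs => rw [hX]
    rw [pairing_congr _ _ (frameMatrix_isUnit hA), Matrix.mulVec_smul, dotProduct_smul,
      smul_eq_mul, neg_div, Real.rpow_neg (abs_nonneg _)]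

/-- `λ = Φ_{AB} X^A X^B`, a density of weight `2`. -/
def lambdaDensity (H : TractorBitensor c) : Density n M 2 where
  toFun x u := tractorX n ⬝ᵥ ((H.toFun c.rep x u)⁻¹).mulVec (tractorX n)
  frame_change x u hu A hA := by
    have h : (0 : ℝ) < |A.det| ^ ((1 : ℝ) / (n + 2)) := by positivity
    have hX : tractorX n =
        (frameMatrix A).mulVec ((|A.det| ^ ((1 : ℝ) / (n + 2)))⁻¹ • tractorX n) := by
      rw [Matrix.mulVec_smul, frameMatrix_mulVec_X, smul_smul, inv_mul_cancel₀ h.ne', one_smul]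
    have h2 : |A.det| ^ (-(2 : ℝ) / (n + 2)) =
        (|A.det| ^ ((1 : ℝ) / (n + 2)))⁻¹ * (|A.det| ^ ((1 : ℝ) / (n + 2)))⁻¹ := by
      rw [← Real.rpow_neg (abs_nonneg _), ← Real.rpow_add (abs_pos.2 hA)]
      congr 1
      ring
    rw [H.frame_change _ x u hu A hA]
    conv_lhs => rw [hX]
    rw [pairing_congr _ _ (frameMatrix_isUnit hA), Matrix.mulVec_smul, dotProduct_smul,
      smul_dotProduct, h2, smul_eq_mul, smul_eq_mul, mul_assoc]

/-- `σ` may be computed in any scale. -/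
theorem sigmaDensity_apply (H : TractorBitensor c) (I : TractorField c) (D : c.conns) (x : M)
    (u : Fin (n + 1) → TangentSpace (𝓡 (n + 1)) x) (hu : LinearIndependent ℝ u) :
    (sigmaDensity H I).toFun x u = I.toFun D x u ⬝ᵥ ((H.toFun D x u)⁻¹).mulVec (tractorX n) := by
  obtain ⟨Υ, hΥ⟩ := c.exists_change c.rep D
  rw [I.scale_change _ _ Υ hΥ x u hu, H.scale_change _ _ Υ hΥ x u hu]
  conv_rhs => rw [← scaleMatrix_mulVec_X fun a => Υ x (u a)]
  rw [pairing_congr _ _ (scaleMatrix_isUnit _)]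
  rfl

/-- `λ` may be computed in any scale. -/
theorem lambdaDensity_apply (H : TractorBitensor c) (D : c.conns) (x : M)
    (u : Fin (n + 1) → TangentSpace (𝓡 (n + 1)) x) (hu : LinearIndependent ℝ u) :
    (lambdaDensity H).toFun x u = tractorX n ⬝ᵥ ((H.toFun D x u)⁻¹).mulVec (tractorX n) := by
  obtain ⟨Υ, hΥ⟩ := c.exists_change c.rep D
  rw [H.scale_change _ _ Υ hΥ x u hu]
  conv_rhs => rw [← scaleMatrix_mulVec_X fun a => Υ x (u a)]
  rw [pairing_congr _ _ (scaleMatrix_isUnit _)]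
  rfl

/-- The components in the frame `u` of the vector field `n^a = Z^a_A I^A` of weight `-1`. -/
def TractorField.vec (I : TractorField c) (x : M)
    (u : Fin (n + 1) → TangentSpace (𝓡 (n + 1)) x) (a : Fin (n + 1)) : ℝ :=
  I.toFun c.rep x u (Sum.inl a)

/-- The components of `n^a` may be computed in any scale. -/
theorem TractorField.vec_apply (I : TractorField c) (D : c.conns) (x : M)
    (u : Fin (n + 1) → TangentSpace (𝓡 (n + 1)) x) (hu : LinearIndependent ℝ u)
    (a : Fin (n + 1)) : I.vec x u a = I.toFun D x u (Sum.inl a) := by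
  obtain ⟨Υ, hΥ⟩ := c.exists_change c.rep D
  rw [I.scale_change _ _ Υ hΥ x u hu]
  simp [scaleMatrix, TractorField.vec, Matrix.mulVec, dotProduct, Matrix.one_apply]

/-- The vector field `N^a = ν n^a`, for a density `ν` of weight `1`; any frame may be used. -/
def scaledField (ν : Density n M 1) (I : TractorField c) (x : M) : TangentSpace (𝓡 (n + 1)) x :=
  ∑ a, (ν.toFun x (stdFrame x) * I.vec x (stdFrame x) a) • stdFrame x a

/-- `N^a = ν n^a` may be computed in any frame. -/
theorem scaledField_apply (ν : Density n M 1) (I : TractorField c) (x : M)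
    (u : Fin (n + 1) → TangentSpace (𝓡 (n + 1)) x) (hu : LinearIndependent ℝ u) :
    scaledField ν I x = ∑ a, (ν.toFun x u * I.vec x u a) • u a := by
  have hs : LinearIndependent ℝ (stdFrame x : Fin (n + 1) → TangentSpace (𝓡 (n + 1)) x) :=
    stdFrame_linearIndependent x
  obtain ⟨A, hA, rfl⟩ := exists_frameMul_eq hs hu
  have h : (0 : ℝ) < |A.det| ^ ((1 : ℝ) / (n + 2)) := by positivity
  have hv : I.vec x (frameMul (stdFrame x) A) =
      (|A.det| ^ ((1 : ℝ) / (n + 2))) • A⁻¹.mulVec (I.vec x (stdFrame x)) := by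
    ext a
    simp [TractorField.vec, I.frame_change _ x _ hs A hA, frameMatrix, Matrix.mulVec, dotProduct,
      Finset.mul_sum, mul_assoc]
  rw [ν.frame_change x _ hs A hA, hv, neg_div, Real.rpow_neg (abs_nonneg _)]
  have hAA : A.mulVec (A⁻¹.mulVec (I.vec x (stdFrame x))) = I.vec x (stdFrame x) := by
    rw [Matrix.mulVec_mulVec, Matrix.mul_nonsing_inv _ (IsUnit.mk0 _ hA), Matrix.one_mulVec]
  simp only [frameMul, scaledField, Finset.smul_sum, smul_smul]
  rw [Finset.sum_comm]
  refine Finset.sum_congr rfl fun i _ => ?_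
  rw [← Finset.sum_smul]
  congr 1
  conv_lhs => rw [← hAA]
  simp only [Matrix.mulVec, dotProduct, Finset.mul_sum, Pi.smul_apply, smul_eq_mul]
  refine Finset.sum_congr rfl fun j _ => ?_
  rw [Finset.sum_mul]
  refine Finset.sum_congr rfl fun k _ => ?_
  field_simp

/-- The set `Z(n)` of zeros of `n^a`. -/
def zeroLocus (I : TractorField c) : Set M :=
  {x | ∀ u : Fin (n + 1) → TangentSpace (𝓡 (n + 1)) x, LinearIndependent ℝ u → I.vec x u = 0}

/-- `O = {σ ≠ 0}`. -/
def openOrbit (H : TractorBitensor c) (I : TractorField c) : Set M :=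
  {x | ¬ (sigmaDensity H I).ZeroAt x}

/-- `Σ⁻ = {σ = 0} ∩ {λ < 0}`. -/
def sigmaMinus (H : TractorBitensor c) (I : TractorField c) : Set M :=
  {x | (sigmaDensity H I).ZeroAt x ∧ (lambdaDensity H).NegAt x}

/-- `Σ⁰ = {σ = 0} ∩ {λ = 0} \ Z(n)`. -/
def sigmaZero (H : TractorBitensor c) (I : TractorField c) : Set M :=
  {x | (sigmaDensity H I).ZeroAt x ∧ (lambdaDensity H).ZeroAt x} \ zeroLocus I

/-- `Σ⁺ = {σ = 0} ∩ {λ > 0}`. -/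
def sigmaPlus (H : TractorBitensor c) (I : TractorField c) : Set M :=
  {x | (sigmaDensity H I).ZeroAt x ∧ (lambdaDensity H).PosAt x}

end Geometry

/-! ### Orbit spaces of a flow -/

section Orbits

variable {M : Type*} [TopologicalSpace M]

/-- Two points of `U` are equivalent if they lie on the same orbit of the flow. -/
def orbitSetoid (θ : Flow ℝ M) (U : Opens M) : Setoid U where
  r x y := ∃ t : ℝ, θ t x = y
  iseqv :=
    { refl := fun x => ⟨0, θ.map_zero_apply _⟩
      symm := by
        rintro x y ⟨t, h⟩
        exact ⟨-t, by rw [← h, ← θ.map_add, neg_add_cancel, θ.map_zero_apply]⟩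
      trans := by
        rintro x y z ⟨t, h⟩ ⟨s, h'⟩
        exact ⟨s + t, by rw [θ.map_add, h, h']⟩ }

/-- The quotient of `U` by the flow, with the quotient topology. -/
abbrev OrbitSpace (θ : Flow ℝ M) (U : Opens M) : Type _ := Quotient (orbitSetoid θ U)

/-- The projection `π : U → U / θ`. -/
def orbitProj (θ : Flow ℝ M) (U : Opens M) : U → OrbitSpace θ U :=
  Quotient.mk (orbitSetoid θ U)

/-- The map of orbit spaces induced by an inclusion `U ⊆ V`. -/
def orbitInclusion (θ : Flow ℝ M) {U V : Opens M} (h : U ≤ V) :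
    OrbitSpace θ U → OrbitSpace θ V :=
  Quotient.map (fun x : U => (⟨x.1, h x.2⟩ : V)) fun _ _ hxy => hxy

/-- The image in the orbit space of the part of `S` that lies in `U`. -/
def orbitImage (θ : Flow ℝ M) (U : Opens M) (S : Set M) : Set (OrbitSpace θ U) :=
  orbitProj θ U '' (Subtype.val ⁻¹' S)

end Orbits

/-- `Q` is a smooth manifold of dimension `k` (Hausdorff and second countable) such that the
map `π : P → Q` from an `m`-dimensional manifold is a smooth submersion. -/
structure IsManifoldSubmersion (m k : ℕ) {P Q : Type*} [TopologicalSpace P]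
    [ChartedSpace (Euc m) P] [TopologicalSpace Q] [ChartedSpace (Euc k) Q] (π : P → Q) : Prop where
  isManifold : IsManifold (𝓡 k) ∞ Q
  t2 : T2Space Q
  secondCountable : SecondCountableTopology Q
  contMDiff : ContMDiff (𝓡 m) (𝓡 k) ∞ π
  submersion : ∀ x : P, Function.Surjective (mfderiv (𝓡 m) (𝓡 k) π x)

/-- `S` is an embedded smooth submanifold of codimension `r` of the `k`-dimensional manifold `Q`:
near each of its points it is a regular level set of a smooth map to `ℝ^r`. -/
def IsEmbeddedSubmanifold (k r : ℕ) {Q : Type*} [TopologicalSpace Q] [ChartedSpace (Euc k) Q]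
    (S : Set Q) : Prop :=
  ∀ p ∈ S, ∃ (W : Set Q) (f : Q → Euc r), IsOpen W ∧ p ∈ W ∧
    ContMDiffOn (𝓡 k) 𝓘(ℝ, Euc r) ∞ f W ∧
    (∀ q ∈ W, Function.Surjective (mfderiv (𝓡 k) 𝓘(ℝ, Euc r) f q)) ∧
    S ∩ W = {q ∈ W | f q = 0}

end

/-!
# Orbit spaces of the flow of a parallel null tractor

Everything is read off from the two functions `u = σ / ν` and `v = λ / ν²`.  Since `H` and `I` are
parallel, `∇σ` and `∇λ` are the algebraic pairings of `I`, respectively of `2 X`, with the tractors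
`W_a = ∇_a X`.  Contracting them with `I = n^a W_a + ρ X`, where `Φ(I, I) = 0`, gives
`N u = g u` and `N v = 2 u + 2 g v` for a locally defined continuous function `g`
(`IsNullParallel.mfderiv_sigmaRatio_scaledField`, `IsNullParallel.mfderiv_lambdaRatio_scaledField`).

*Invariance.*  The smooth vector field `N` on a compact manifold has a global smooth flow
(`exists_smooth_flow`; smooth dependence on the initial value comes from the inverse function
theorem in a space of continuous curves).  Along an orbit `u` solves a linear homogeneous equation,
and so does `v` as long as `u = 0`; uniqueness for such equations shows that the signs of `u` and,
on `{u = 0}`, of `v` are constant.  At a zero of `n` the tractor `I` is a multiple of `X`, so that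
`u = v = 0` there: this gives the decomposition of the complement of the zeros.

*The quotient of the open orbit.*  On `{u ≠ 0}` the two equations give `N (v / u²) = 2 / u`, and `u`
is bounded by compactness.  Thus `v / u²` is a clock (`IsClock`): it changes at a definite rate along
all orbits.  Hence the orbit relation is closed (`IsClock.t2Space`), and a small transversal of a
flow box meets every orbit at most once; such transversals are the charts of the orbit space
(`IsClock.exists_chartedSpace_orbitSpace`).

*The decomposition of the full quotient.*  If the quotient of the complement of the zeros is a
manifold, the projection is a submersion and has smooth local sections.  They show that the
inclusion of the orbit spaces is a local diffeomorphism (`isLocalDiffeomorph_orbitInclusion`), and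
they pull back local equations of an invariant set to local equations of its image.  These remain
regular when their differentials annihilate `N` at the point in question
(`isEmbeddedSubmanifold_orbitImage`).  The equations are `u = 0`, regular because `I` has no zeros
and `Φ` is nondegenerate, and `(u, v) = 0`, regular because a relation between the differentials
would make `I` a multiple of `X` (`IsNullParallel.exists_partialDeriv_sigmaRatio_ne_zero`,
`IsNullParallel.eq_zero_of_partialDeriv_relation`).
-/

/-! ### The inverse function theorem on an open set -/

section InverseFunction

variable {E F : Type*} [NormedAddCommGroup E] [NormedSpace ℝ E] [CompleteSpace E]
  [NormedAddCommGroup F] [NormedSpace ℝ F]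

/-- The inverse function theorem, with an inverse that is smooth on its whole domain. -/
theorem exists_openPartialHomeomorph_of_contDiffOn {f : E → F} {U : Set E} {a : E}
    (hU : IsOpen U) (hf : ContDiffOn ℝ ∞ f U) (ha : a ∈ U) (f' : E ≃L[ℝ] F)
    (hf' : HasFDerivAt f (f' : E →L[ℝ] F) a) :
    ∃ G : OpenPartialHomeomorph E F, a ∈ G.source ∧ G.source ⊆ U ∧ (∀ x, G x = f x) ∧
      ContDiffOn ℝ ∞ G.symm G.target := by
  have hfa : ContDiffAt ℝ ∞ f a := hf.contDiffAt (hU.mem_nhds ha)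
  set G₀ := hfa.toOpenPartialHomeomorph f hf' (by simp) with hG₀
  have hG₀a : a ∈ G₀.source := hfa.mem_toOpenPartialHomeomorph_source hf' (by simp)
  have hG₀c : ∀ x, G₀ x = f x := fun x => by
    rw [hG₀, ContDiffAt.toOpenPartialHomeomorph_coe]
  -- the derivative stays invertible on a neighbourhood
  have hcont : ContinuousOn (fderiv ℝ f) U := hf.continuousOn_fderiv_of_isOpen hU (by simp)
  obtain ⟨V, hVU, hVo, hV⟩ : ∃ V : Set E, V ⊆ U ∧ IsOpen V ∧ a ∈ V ∧
      ∀ x ∈ V, fderiv ℝ f x ∈ range ((↑) : (E ≃L[ℝ] F) → E →L[ℝ] F) := by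
    have h1 := hcont.isOpen_inter_preimage hU
      (ContinuousLinearEquiv.isOpen (𝕜 := ℝ) (E := E) (F := F))
    exact ⟨_, inter_subset_left, h1, ⟨ha, by rw [mem_preimage, hf'.fderiv]; exact ⟨f', rfl⟩⟩,
      fun x hx => hx.2⟩
  refine ⟨G₀.restrOpen V hVo, ⟨hG₀a, hV.1⟩, fun x hx => hVU hx.2, fun x => hG₀c x, ?_⟩
  intro y hy
  refine ContDiffAt.contDiffWithinAt ?_
  set G := G₀.restrOpen V hVo
  have hx : G.symm y ∈ G.source := G.map_target hy
  have hxV : G.symm y ∈ V := hx.2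
  obtain ⟨e, he⟩ := hV.2 _ hxV
  have hfx : ContDiffAt ℝ ∞ f (G.symm y) := hf.contDiffAt (hU.mem_nhds (hVU hxV))
  have hGf : (G : E → F) = f := funext hG₀c
  refine G.contDiffAt_symm hy (f₀' := e) ?_ ?_
  · rw [hGf, he]
    exact (hfx.differentiableAt (by simp)).hasFDerivAt
  · rw [hGf]
    exact hfx

end InverseFunction

/-! ### Superposition operators on spaces of continuous functions -/

section Superposition

universe u

variable {K : Type*} [TopologicalSpace K] [CompactSpace K]

/-- Pointwise application `A ↦ (h ↦ (s ↦ A s (h s)))` of a continuous family of operators. -/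
noncomputable def applyCLM (K : Type*) [TopologicalSpace K] [CompactSpace K] (E F : Type*)
    [NormedAddCommGroup E] [NormedSpace ℝ E] [NormedAddCommGroup F] [NormedSpace ℝ F] :
    C(K, E →L[ℝ] F) →L[ℝ] C(K, E) →L[ℝ] C(K, F) :=
  LinearMap.mkContinuous₂
    (LinearMap.mk₂ ℝ
      (fun (A : C(K, E →L[ℝ] F)) (h : C(K, E)) =>
        (⟨fun s => A s (h s), A.continuous.clm_apply h.continuous⟩ : C(K, F)))
      (fun _ _ _ => by ext; simp) (fun _ _ _ => by ext; simp)
      (fun _ _ _ => by ext; simp) (fun _ _ _ => by ext; simp))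
    1 (fun A h => by
      rw [ContinuousMap.norm_le _ (by positivity)]
      intro s
      simp only [LinearMap.mk₂_apply, ContinuousMap.coe_mk, one_mul]
      exact ((A s).le_opNorm (h s)).trans
        (mul_le_mul (A.norm_coe_le_norm s) (h.norm_coe_le_norm s) (norm_nonneg _)
          (norm_nonneg A)))

@[simp]
theorem applyCLM_apply {E F : Type*}
    [NormedAddCommGroup E] [NormedSpace ℝ E] [NormedAddCommGroup F] [NormedSpace ℝ F]
    (A : C(K, E →L[ℝ] F)) (h : C(K, E)) (s : K) : applyCLM K E F A h s = A s (h s) := rfl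

/-- The superposition operator of a `C¹` function is differentiable, with the pointwise
derivative. -/
theorem hasFDerivAt_comp_continuousMap {E F : Type*}
    [NormedAddCommGroup E] [NormedSpace ℝ E] [NormedAddCommGroup F] [NormedSpace ℝ F]
    (f : C(E, F)) (f' : C(E, E →L[ℝ] F)) (hf : ∀ x, HasFDerivAt f (f' x) x) (γ : C(K, E)) :
    HasFDerivAt (fun γ : C(K, E) => f.comp γ) (applyCLM K E F (f'.comp γ)) γ := by
  rw [hasFDerivAt_iff_isLittleO_nhds_zero, Asymptotics.isLittleO_iff]
  intro ε hε
  have hc : Continuous fun γ : C(K, E) => f'.comp γ := f'.continuous_postcomp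
  obtain ⟨δ, hδ, hδ'⟩ := (Metric.continuous_iff (β := C(K, E →L[ℝ] F))).1 hc γ ε hε
  filter_upwards [Metric.ball_mem_nhds (0 : C(K, E)) hδ] with h hh
  rw [mem_ball_zero_iff] at hh
  rw [ContinuousMap.norm_le _ (by positivity)]
  intro s
  have hs : ‖h s‖ < δ := (h.norm_coe_le_norm s).trans_lt hh
  have hbound : ∀ y ∈ Metric.ball (γ s) δ, ‖f' y - f' (γ s)‖ ≤ ε := by
    intro y hy
    -- translate the curve `γ` by a constant vector
    have h1 : dist (γ + ContinuousMap.const K (y - γ s)) γ < δ := by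
      rw [dist_eq_norm, add_sub_cancel_left]
      refine (ContinuousMap.norm_lt_iff _ hδ).2 fun s' => ?_
      simpa [← dist_eq_norm] using hy
    have h2 := hδ' _ h1
    have h3 := (ContinuousMap.dist_apply_le_dist (f := f'.comp (γ + ContinuousMap.const K (y - γ s)))
      (g := f'.comp γ) s).trans h2.le
    simpa [dist_eq_norm] using h3
  have hmv := (convex_ball (γ s) δ).norm_image_sub_le_of_norm_hasFDerivWithin_le'
    (f := f) (f' := fun y => f' y) (φ := f' (γ s)) (C := ε)
    (fun y _ => (hf y).hasFDerivWithinAt) hbound (Metric.mem_ball_self hδ)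
    (y := γ s + h s) (by simpa [Metric.mem_ball, dist_eq_norm] using hs)
  calc _ = ‖f (γ s + h s) - f (γ s) - f' (γ s) (γ s + h s - γ s)‖ := by simp
    _ ≤ ε * ‖γ s + h s - γ s‖ := hmv
    _ ≤ ε * ‖h‖ := by
      rw [add_sub_cancel_left]
      exact mul_le_mul_of_nonneg_left (h.norm_coe_le_norm s) hε.le

/-- The superposition operator of a smooth function is smooth, one derivative at a time: its
derivative is a bounded linear image of the superposition operator of the derivative. -/
theorem contDiff_comp_continuousMap_nat {E : Type u} [NormedAddCommGroup E] [NormedSpace ℝ E]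
    (m : ℕ) : ∀ {F : Type u} [NormedAddCommGroup F] [NormedSpace ℝ F] (f : C(E, F)),
    ContDiff ℝ ∞ f → ContDiff ℝ m (fun γ : C(K, E) => f.comp γ) := by
  induction m with
  | zero =>
    intro F _ _ f _
    exact contDiff_zero.2 f.continuous_postcomp
  | succ m ih =>
    intro F _ _ f hf
    have h1 : ContDiff ℝ ∞ (fderiv ℝ f) := hf.fderiv_right (m := ∞) le_rfl
    have hd : ∀ γ : C(K, E), HasFDerivAt (fun γ : C(K, E) => f.comp γ)
        (applyCLM K E F ((⟨fderiv ℝ f, h1.continuous⟩ : C(E, E →L[ℝ] F)).comp γ)) γ :=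
      hasFDerivAt_comp_continuousMap f ⟨fderiv ℝ f, h1.continuous⟩
        (fun x => (hf.differentiable (by simp) x).hasFDerivAt)
    rw [Nat.cast_succ]
    refine contDiff_succ_iff_fderiv.2 ⟨fun γ => (hd γ).differentiableAt,
      fun h => absurd h (by simp), ?_⟩
    have h2 : fderiv ℝ (fun γ : C(K, E) => f.comp γ) = fun γ =>
        applyCLM K E F ((⟨fderiv ℝ f, h1.continuous⟩ : C(E, E →L[ℝ] F)).comp γ) :=
      funext fun γ => (hd γ).fderiv
    rw [h2]
    exact (applyCLM K E F).contDiff.comp (ih (⟨fderiv ℝ f, h1.continuous⟩ : C(E, E →L[ℝ] F)) h1)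

theorem contDiff_comp_continuousMap {E F : Type u} [NormedAddCommGroup E] [NormedSpace ℝ E]
    [NormedAddCommGroup F] [NormedSpace ℝ F] (f : C(E, F)) (hf : ContDiff ℝ ∞ f) :
    ContDiff ℝ ∞ (fun γ : C(K, E) => f.comp γ) :=
  contDiff_infty.2 fun m => contDiff_comp_continuousMap_nat m f hf

end Superposition

/-! ### Smooth dependence of solutions of differential equations -/

section SmoothDependence

theorem neg_two_le_two_real : (-2 : ℝ) ≤ 2 := by norm_num

/-- The integration operator `γ ↦ ∫₀ γ` on curves parametrized by `[-2, 2]`; the integrand is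
extended to the line by `projIcc`, which does not affect the integral. -/
noncomputable def integralCLM (E : Type*) [NormedAddCommGroup E] [NormedSpace ℝ E] :
    C(Icc (-2 : ℝ) 2, E) →L[ℝ] C(Icc (-2 : ℝ) 2, E) :=
  LinearMap.mkContinuous
    { toFun := fun γ => ⟨fun s => ∫ r in (0 : ℝ)..s, γ (projIcc (-2) 2 neg_two_le_two_real r),
        (intervalIntegral.continuous_primitive (fun _ _ =>
          (γ.continuous.comp (continuous_projIcc (h := neg_two_le_two_real))).intervalIntegrable _ _) 0).comp
            continuous_subtype_val⟩
      map_add' := fun γ η => by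
        ext s
        simp only [ContinuousMap.coe_mk, ContinuousMap.add_apply]
        exact intervalIntegral.integral_add
          ((γ.continuous.comp (continuous_projIcc (h := neg_two_le_two_real))).intervalIntegrable _ _)
          ((η.continuous.comp (continuous_projIcc (h := neg_two_le_two_real))).intervalIntegrable _ _)
      map_smul' := fun c γ => by
        ext s
        simp only [ContinuousMap.coe_mk, ContinuousMap.smul_apply, RingHom.id_apply]
        exact intervalIntegral.integral_smul _ _ }
    2 (fun γ => by
      rw [ContinuousMap.norm_le _ (by positivity)]
      intro s
      have h := intervalIntegral.norm_integral_le_of_norm_le_const (a := (0 : ℝ)) (b := s)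
        (C := ‖γ‖) (f := fun r => γ (projIcc (-2) 2 neg_two_le_two_real r))
        (fun r _ => γ.norm_coe_le_norm _)
      have hs : |(s : ℝ) - 0| ≤ 2 := by
        rw [sub_zero, abs_le]
        exact s.2
      refine h.trans ?_
      rw [mul_comm]
      exact mul_le_mul_of_nonneg_right hs (norm_nonneg γ))

/-- Local smooth dependence on the initial value and on the speed: for `(t, x)` near `(0, x₀)`
the equation `γ' = t f(γ)`, `γ 0 = x` has a solution on `(-2, 2)`, and `γ 1`
depends smoothly on `(t, x)`.  The solution is obtained from the inverse function theorem in the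
Banach space of continuous curves: for `t = 0` the linearized equation is trivial. -/
theorem exists_contDiffOn_solution_of_contDiff {E : Type} [NormedAddCommGroup E] [NormedSpace ℝ E]
    [CompleteSpace E] {f : E → E} (hf : ContDiff ℝ ∞ f) (x₀ : E) {Ω : Set E} (hΩ : Ω ∈ 𝓝 x₀) :
    ∃ W : Set (ℝ × E), IsOpen W ∧ ((0 : ℝ), x₀) ∈ W ∧ ∃ Γ : ℝ × E → ℝ → E,
      ContDiffOn ℝ ∞ (fun p => Γ p 1) W ∧ ∀ p ∈ W, Γ p 0 = p.2 ∧
        ∀ s ∈ Ioo (-2 : ℝ) 2, Γ p s ∈ Ω ∧ HasDerivAt (Γ p) (p.1 • f (Γ p s)) s := by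
  obtain ⟨r, hr, hrΩ⟩ := Metric.mem_nhds_iff.1 hΩ
  let X := C(Icc (-2 : ℝ) 2, E)
  let cst : E →L[ℝ] X := ContinuousLinearMap.const ℝ (Icc (-2 : ℝ) 2)
  let fc : C(E, E) := ⟨f, hf.continuous⟩
  let Nf : X → X := fun γ => integralCLM E (fc.comp γ)
  have hNf : ContDiff ℝ ∞ Nf :=
    (integralCLM E).contDiff.comp (contDiff_comp_continuousMap fc hf)
  let Fm : (ℝ × E) × X → (ℝ × E) × X := fun q => (q.1, q.2 - cst q.1.2 - q.1.1 • Nf q.2)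
  have hFm : ContDiff ℝ ∞ Fm := by
    have h1 : ContDiff ℝ ∞ fun q : (ℝ × E) × X => Nf q.2 := hNf.comp contDiff_snd
    have h2 : ContDiff ℝ ∞ fun q : (ℝ × E) × X => cst q.1.2 :=
      cst.contDiff.comp (contDiff_snd.comp contDiff_fst)
    exact contDiff_fst.prodMk ((contDiff_snd.sub h2).sub
      ((contDiff_fst.comp contDiff_fst).smul h1))
  let γ₀ : X := cst x₀
  let q₀ : (ℝ × E) × X := ((0, x₀), γ₀)
  -- the derivative at `q₀` is a shear
  let B : ℝ × E →L[ℝ] X :=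
    -(cst.comp (ContinuousLinearMap.snd ℝ ℝ E)) -
      (ContinuousLinearMap.fst ℝ ℝ E).smulRight (Nf γ₀)
  let e : ((ℝ × E) × X) ≃L[ℝ] ((ℝ × E) × X) :=
    ContinuousLinearEquiv.equivOfInverse
      ((ContinuousLinearMap.fst ℝ (ℝ × E) X).prod
        (ContinuousLinearMap.snd ℝ (ℝ × E) X + B.comp (ContinuousLinearMap.fst ℝ (ℝ × E) X)))
      ((ContinuousLinearMap.fst ℝ (ℝ × E) X).prod
        (ContinuousLinearMap.snd ℝ (ℝ × E) X - B.comp (ContinuousLinearMap.fst ℝ (ℝ × E) X)))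
      (fun q => by simp) (fun q => by simp)
  have he : HasFDerivAt Fm (e : ((ℝ × E) × X) →L[ℝ] ((ℝ × E) × X)) q₀ := by
    have h1 : HasFDerivAt (fun q : (ℝ × E) × X => Nf q.2)
        ((fderiv ℝ Nf γ₀).comp (ContinuousLinearMap.snd ℝ (ℝ × E) X)) q₀ :=
      HasFDerivAt.comp q₀ (g := Nf)
        ((hNf.differentiable (by simp) γ₀).hasFDerivAt) hasFDerivAt_snd
    have h0 : HasFDerivAt (fun q : (ℝ × E) × X => q.1.1)
        ((ContinuousLinearMap.fst ℝ ℝ E).comp (ContinuousLinearMap.fst ℝ (ℝ × E) X)) q₀ :=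
      ((ContinuousLinearMap.fst ℝ ℝ E).comp (ContinuousLinearMap.fst ℝ (ℝ × E) X)).hasFDerivAt
    have h2 : HasFDerivAt (fun q : (ℝ × E) × X => q.2 - cst q.1.2)
        (ContinuousLinearMap.snd ℝ (ℝ × E) X - (cst.comp (ContinuousLinearMap.snd ℝ ℝ E)).comp
          (ContinuousLinearMap.fst ℝ (ℝ × E) X)) q₀ :=
      (ContinuousLinearMap.snd ℝ (ℝ × E) X - (cst.comp (ContinuousLinearMap.snd ℝ ℝ E)).comp
          (ContinuousLinearMap.fst ℝ (ℝ × E) X)).hasFDerivAt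
    have h3 := (hasFDerivAt_fst (𝕜 := ℝ) (p := q₀)).prodMk (h2.sub (h0.smul h1))
    refine h3.congr_fderiv ?_
    ext q <;> simp [e, B, q₀]
  obtain ⟨G, hG0, -, hGF, hGs⟩ := exists_openPartialHomeomorph_of_contDiffOn isOpen_univ
    hFm.contDiffOn (mem_univ q₀) e he
  have hFq₀ : Fm q₀ = ((0, x₀), 0) := by simp [Fm, q₀, γ₀]
  have hGt0 : (((0 : ℝ), x₀), (0 : X)) ∈ G.target := by
    rw [← hFq₀, ← hGF]
    exact G.map_source hG0
  have hGs0 : G.symm (((0 : ℝ), x₀), (0 : X)) = q₀ := by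
    rw [← hFq₀, ← hGF]
    exact G.left_inv hG0
  let ι : ℝ × E → (ℝ × E) × X := fun p => (p, 0)
  have hι : ContDiff ℝ ∞ ι := contDiff_id.prodMk contDiff_const
  let c : ℝ × E → C(Icc (-2 : ℝ) 2, E) := fun p => (G.symm (ι p)).2
  have hcs : ContDiffOn ℝ ∞ c (ι ⁻¹' G.target) :=
    contDiff_snd.comp_contDiffOn (hGs.comp hι.contDiffOn (fun p hp => hp))
  have hWo : IsOpen (ι ⁻¹' G.target) := G.open_target.preimage hι.continuous
  refine ⟨ι ⁻¹' G.target ∩ c ⁻¹' Metric.ball (γ₀ : C(Icc (-2 : ℝ) 2, E)) r,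
    hcs.continuousOn.isOpen_inter_preimage hWo Metric.isOpen_ball, ⟨hGt0, ?_⟩,
    fun p s => p.2 + p.1 • ∫ r in (0 : ℝ)..s, f (c p (projIcc (-2) 2 neg_two_le_two_real r)), ?_, ?_⟩
  · have hc0 : c (0, x₀) = γ₀ := congrArg Prod.snd hGs0
    rw [mem_preimage, hc0]
    exact Metric.mem_ball_self hr
  all_goals
    have hsol : ∀ p ∈ ι ⁻¹' G.target, c p = cst p.2 + p.1 • Nf (c p) := by
      intro p hp
      have h1 : Fm (G.symm (ι p)) = ι p := by
        rw [← hGF]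
        exact G.right_inv hp
      have h2 : (G.symm (ι p)).1 = p := congrArg Prod.fst h1
      have h3 : c p - cst (G.symm (ι p)).1.2 - (G.symm (ι p)).1.1 • Nf (c p) = 0 :=
        congrArg Prod.snd h1
      rw [h2] at h3
      rw [sub_sub, sub_eq_zero] at h3
      exact h3
    have hΓ : ∀ p ∈ ι ⁻¹' G.target, ∀ s : Icc (-2 : ℝ) 2,
        p.2 + p.1 • ∫ r in (0 : ℝ)..s, f (c p (projIcc (-2) 2 neg_two_le_two_real r)) = c p s := by
      intro p hp s
      conv_rhs => rw [hsol p hp]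
      rfl
  · have h1 : ContDiffOn ℝ ∞ (fun p => c p ⟨1, by norm_num, by norm_num⟩) (ι ⁻¹' G.target) :=
      (ContinuousMap.evalCLM ℝ (⟨1, by norm_num, by norm_num⟩ : Icc (-2 : ℝ) 2) :
        C(Icc (-2 : ℝ) 2, E) →L[ℝ] E).contDiff.comp_contDiffOn hcs
    refine (h1.congr fun p hp => ?_).mono inter_subset_left
    exact hΓ p hp ⟨1, by norm_num, by norm_num⟩
  · rintro p ⟨hp, hpr⟩
    refine ⟨by simp, fun s hs => ?_⟩
    have hsI : s ∈ Icc (-2 : ℝ) 2 := Ioo_subset_Icc_self hs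
    have hΓs := hΓ p hp ⟨s, hsI⟩
    have hcont : Continuous fun r : ℝ => f (c p (projIcc (-2) 2 neg_two_le_two_real r)) :=
      hf.continuous.comp ((c p).continuous.comp continuous_projIcc)
    dsimp only at hΓs ⊢
    rw [hΓs]
    refine ⟨hrΩ ?_, ?_⟩
    · exact (ContinuousMap.dist_apply_le_dist (g := γ₀) ⟨s, hsI⟩).trans_lt hpr
    · have h1 := ((hcont.integral_hasStrictDerivAt 0 s).hasDerivAt.const_smul p.1).const_add p.2
      rwa [projIcc_of_mem _ hsI] at h1

/-- The local form of `exists_contDiffOn_solution_of_contDiff`, for a vector field defined on an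
open set. -/
theorem exists_contDiffOn_solution {E : Type} [NormedAddCommGroup E] [NormedSpace ℝ E]
    [FiniteDimensional ℝ E] {f : E → E} {Ω : Set E} (hΩ : IsOpen Ω) (hf : ContDiffOn ℝ ∞ f Ω)
    {x₀ : E} (hx₀ : x₀ ∈ Ω) :
    ∃ W : Set (ℝ × E), IsOpen W ∧ ((0 : ℝ), x₀) ∈ W ∧ ∃ Γ : ℝ × E → ℝ → E,
      ContDiffOn ℝ ∞ (fun p => Γ p 1) W ∧ ∀ p ∈ W, Γ p 0 = p.2 ∧
        ∀ s ∈ Ioo (-2 : ℝ) 2, Γ p s ∈ Ω ∧ HasDerivAt (Γ p) (p.1 • f (Γ p s)) s := by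
  have : CompleteSpace E := FiniteDimensional.complete ℝ E
  obtain ⟨r, hr, hrΩ⟩ := Metric.mem_nhds_iff.1 (hΩ.mem_nhds hx₀)
  let χ : ContDiffBump x₀ := ⟨r / 3, r / 2, by positivity, by linarith⟩
  have hχf : ContDiff ℝ ∞ (fun x => χ x • f x) := by
    refine contDiff_iff_contDiffAt.2 fun x => ?_
    by_cases hx : x ∈ Ω
    · exact χ.contDiffAt.smul (hf.contDiffAt (hΩ.mem_nhds hx))
    · have h1 : x ∉ tsupport χ := by
        rw [χ.tsupport_eq]
        intro h
        exact hx (hrΩ (Metric.closedBall_subset_ball (by change r / 2 < r; linarith) h))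
      have h2 : (fun x => χ x • f x) =ᶠ[𝓝 x] fun _ => 0 := by
        filter_upwards [(isClosed_tsupport χ).isOpen_compl.mem_nhds h1] with y hy
        rw [image_eq_zero_of_notMem_tsupport hy, zero_smul]
      exact contDiffAt_const.congr_of_eventuallyEq h2
  obtain ⟨W, hWo, hW0, Γ, hΓ, hsol⟩ := exists_contDiffOn_solution_of_contDiff hχf x₀
    (Metric.ball_mem_nhds x₀ (by positivity : 0 < r / 3))
  refine ⟨W, hWo, hW0, Γ, hΓ, fun p hp => ⟨(hsol p hp).1, fun s hs => ?_⟩⟩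
  obtain ⟨h1, h2⟩ := (hsol p hp).2 s hs
  refine ⟨hrΩ (Metric.ball_subset_ball (by linarith) h1), ?_⟩
  rwa [χ.one_of_mem_closedBall (Metric.ball_subset_closedBall h1), one_smul] at h2

end SmoothDependence

/-! ### Complete flows of vector fields on compact manifolds -/

section Flow

variable {E : Type} [NormedAddCommGroup E] [NormedSpace ℝ E]
  {M : Type*} [TopologicalSpace M] [ChartedSpace E M] [IsManifold 𝓘(ℝ, E) ∞ M]

/-- The representative of a vector field in the preferred chart at `x₀`, meaningful on the target
of the chart. -/
noncomputable def chartField (v : (x : M) → TangentSpace 𝓘(ℝ, E) x) (x₀ : M) (y : E) : E :=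
  mfderiv 𝓘(ℝ, E) 𝓘(ℝ, E) (chartAt E x₀) ((chartAt E x₀).symm y) (v ((chartAt E x₀).symm y))

theorem contMDiffOn_mfderiv_chartAt_apply {v : (x : M) → TangentSpace 𝓘(ℝ, E) x} (x₀ : M)
    (hv : ContMDiffOn 𝓘(ℝ, E) (𝓘(ℝ, E).prod 𝓘(ℝ, E)) ∞
      (fun x => (⟨x, v x⟩ : TangentBundle 𝓘(ℝ, E) M)) (chartAt E x₀).source) :
    ContMDiffOn 𝓘(ℝ, E) 𝓘(ℝ, E) ∞
      (fun x => mfderiv 𝓘(ℝ, E) 𝓘(ℝ, E) (chartAt E x₀) x (v x)) (chartAt E x₀).source := by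
  have h := ((trivializationAt E (TangentSpace 𝓘(ℝ, E) : M → Type _)
    x₀).contMDiffOn_section_baseSet_iff (IB := 𝓘(ℝ, E)) (n := ∞) (s := v)).1 hv
  refine h.congr fun x hx => ?_
  have h2 := TangentBundle.continuousLinearMapAt_trivializationAt (I := 𝓘(ℝ, E)) hx
  have h3 := congrArg (fun A => A (v x)) h2
  simp only [mfld_simps] at h3
  have h4 : (trivializationAt E (TangentSpace 𝓘(ℝ, E) : M → Type _) x₀).continuousLinearMapAt ℝ x
      (v x) = (trivializationAt E (TangentSpace 𝓘(ℝ, E) : M → Type _) x₀ ⟨x, v x⟩).2 := by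
    rw [Bundle.Trivialization.continuousLinearMapAt_apply,
      Bundle.Trivialization.linearMapAt_apply, if_pos hx]
  exact h3.symm.trans h4

theorem contDiffOn_chartField {v : (x : M) → TangentSpace 𝓘(ℝ, E) x}
    (hv : ContMDiff 𝓘(ℝ, E) (𝓘(ℝ, E).prod 𝓘(ℝ, E)) ∞
      (fun x => (⟨x, v x⟩ : TangentBundle 𝓘(ℝ, E) M))) (x₀ : M) :
    ContDiffOn ℝ ∞ (chartField v x₀) (chartAt E x₀).target := by
  have h1 := contMDiffOn_mfderiv_chartAt_apply x₀ hv.contMDiffOn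
  have h2 : ContMDiffOn 𝓘(ℝ, E) 𝓘(ℝ, E) ∞ (chartAt E x₀).symm (chartAt E x₀).target :=
    contMDiffOn_chart_symm
  exact (h1.comp h2 fun y hy => (chartAt E x₀).map_target hy).contDiffOn

theorem mfderiv_chart_symm_chartField (v : (x : M) → TangentSpace 𝓘(ℝ, E) x) (x₀ : M) {y : E}
    (hy : y ∈ (chartAt E x₀).target) :
    mfderiv 𝓘(ℝ, E) 𝓘(ℝ, E) (chartAt E x₀).symm y (chartField (E := E) v x₀ y) =
      v ((chartAt E x₀).symm y) := by
  have h1 := congrArg (fun A => A (v ((chartAt E x₀).symm y)))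
    ((mdifferentiable_chart (I := 𝓘(ℝ, E)) x₀).symm_comp_deriv ((chartAt E x₀).map_target hy))
  rw [(chartAt E x₀).right_inv hy] at h1
  exact h1

/-- For `p = (t, x)` near `(0, x₀)` there is an integral curve `Γ p` of `t v` on `(-2, 2)` starting
at `x`.  Its value at the time `1` is the flow of `v` for the time `t` and is smooth in `p`. -/
theorem exists_local_solution [FiniteDimensional ℝ E] {v : (x : M) → TangentSpace 𝓘(ℝ, E) x}
    (hv : ContMDiff 𝓘(ℝ, E) (𝓘(ℝ, E).prod 𝓘(ℝ, E)) ∞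
      (fun x => (⟨x, v x⟩ : TangentBundle 𝓘(ℝ, E) M))) (x₀ : M) :
    ∃ W : Set (ℝ × M), IsOpen W ∧ ((0 : ℝ), x₀) ∈ W ∧ ∃ Γ : ℝ × M → ℝ → M,
      ContMDiffOn (𝓘(ℝ, ℝ).prod 𝓘(ℝ, E)) 𝓘(ℝ, E) ∞ (fun p => Γ p 1) W ∧
      ∀ p ∈ W, Γ p 0 = p.2 ∧ IsMIntegralCurveOn (Γ p) (p.1 • v) (Ioo (-2) 2) := by
  set φ := chartAt E x₀ with hφ
  obtain ⟨W, hWo, hW0, Γ, hΓ, hsol⟩ := exists_contDiffOn_solution φ.open_target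
    (contDiffOn_chartField hv x₀) (φ.map_source (mem_chart_source E x₀))
  have hφs : ContMDiffOn 𝓘(ℝ, E) 𝓘(ℝ, E) ∞ φ.symm φ.target := contMDiffOn_chart_symm
  have hφc : ContMDiffOn 𝓘(ℝ, E) 𝓘(ℝ, E) ∞ φ φ.source := contMDiffOn_chart
  let j : ℝ × M → ℝ × E := fun p => (p.1, φ p.2)
  have hjs : ContMDiffOn (𝓘(ℝ, ℝ).prod 𝓘(ℝ, E)) 𝓘(ℝ, ℝ × E) ∞ j
      (Prod.snd ⁻¹' φ.source) :=
    contMDiffOn_fst.prodMk_space (hφc.comp contMDiffOn_snd fun p hp => hp)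
  refine ⟨Prod.snd ⁻¹' φ.source ∩ j ⁻¹' W, ?_, ⟨mem_chart_source E x₀, hW0⟩,
    fun p s => φ.symm (Γ (j p) s), ?_, ?_⟩
  · exact hjs.continuousOn.isOpen_inter_preimage (φ.open_source.preimage continuous_snd) hWo
  · have h2 := hΓ.contMDiffOn.comp (hjs.mono inter_subset_left) fun p (hp : p ∈ _ ∩ j ⁻¹' W) => hp.2
    exact hφs.comp h2 fun p hp => ((hsol _ hp.2).2 1 (by norm_num)).1
  · rintro p ⟨hp1, hp2⟩
    obtain ⟨h0, h1⟩ := hsol _ hp2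
    refine ⟨?_, fun s hs => ?_⟩
    · exact (congrArg φ.symm h0).trans (φ.left_inv hp1)
    · obtain ⟨h2, h3⟩ := h1 s hs
      have h4 : HasMFDerivAt 𝓘(ℝ, E) 𝓘(ℝ, E) φ.symm (Γ (j p) s) _ :=
        ((hφs.contMDiffAt (φ.open_target.mem_nhds h2)).mdifferentiableAt (by simp)).hasMFDerivAt
      refine HasMFDerivAt.hasMFDerivWithinAt ?_
      have h5 := h4.comp s h3.hasFDerivAt.hasMFDerivAt
      refine h5.congr_mfderiv ?_
      ext
      have h6 := mfderiv_chart_symm_chartField v x₀ h2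
      let A : E →L[ℝ] E := mfderiv 𝓘(ℝ, E) 𝓘(ℝ, E) φ.symm (Γ (j p) s)
      have h7 : A ((1 : ℝ) • p.1 • chartField v x₀ (Γ (j p) s)) =
          (1 : ℝ) • p.1 • A (chartField v x₀ (Γ (j p) s)) := by
        rw [map_smul, map_smul]
      exact h7.trans (congrArg (fun w : E => (1 : ℝ) • p.1 • w) h6)

variable [T2Space M]

/-- A smooth vector field on a compact manifold has a smooth global flow. -/
theorem exists_smooth_flow [FiniteDimensional ℝ E] [CompactSpace M]
    {v : (x : M) → TangentSpace 𝓘(ℝ, E) x}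
    (hv : ContMDiff 𝓘(ℝ, E) (𝓘(ℝ, E).prod 𝓘(ℝ, E)) ∞
      (fun x => (⟨x, v x⟩ : TangentBundle 𝓘(ℝ, E) M))) :
    ∃ θ : Flow ℝ M,
      ContMDiff (𝓘(ℝ, ℝ).prod 𝓘(ℝ, E)) 𝓘(ℝ, E) ∞ (fun p : ℝ × M => θ p.1 p.2) ∧
      ∀ x : M, IsMIntegralCurve (fun t => θ t x) v := by
  have hv1 : ContMDiff 𝓘(ℝ, E) (𝓘(ℝ, E).prod 𝓘(ℝ, E)) 1
      (fun x => (⟨x, v x⟩ : TangentBundle 𝓘(ℝ, E) M)) := hv.of_le (by simp)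
  choose W hWo hW0 Γ hΓ hsol using exists_local_solution hv
  -- by compactness there is a time `ε` that works for all initial values
  have hopen : IsOpen (⋃ x, W x) := isOpen_iUnion hWo
  obtain ⟨ε, hε, hεW⟩ : ∃ ε > (0 : ℝ), ∀ t ∈ Ioo (-ε) ε, ∀ x : M, ∃ x₀, (t, x) ∈ W x₀ := by
    obtain ⟨U, V, hUo, -, hU0, hV, hUV⟩ := generalized_tube_lemma (isCompact_singleton (x := (0 : ℝ)))
      (isCompact_univ (X := M)) hopen (by
        rintro ⟨t, x⟩ ⟨ht, -⟩
        obtain rfl : t = 0 := ht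
        exact mem_iUnion.2 ⟨x, hW0 x⟩)
    obtain ⟨ε, hε, h⟩ := Metric.isOpen_iff.1 hUo 0 (hU0 rfl)
    refine ⟨ε, hε, fun t ht x => mem_iUnion.1 (hUV ⟨h ?_, hV (mem_univ x)⟩)⟩
    rwa [Real.ball_eq_Ioo, zero_sub, zero_add]
  have hloc : ∀ x : M, ∃ γ : ℝ → M, γ 0 = x ∧ IsMIntegralCurveOn γ v (Ioo (-ε) ε) := by
    intro x
    obtain ⟨x₀, hx₀⟩ := hεW (ε / 2) ⟨by linarith, by linarith⟩ x
    obtain ⟨h0, h1⟩ := hsol x₀ _ hx₀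
    refine ⟨Γ x₀ (ε / 2, x) ∘ (· * (2 / ε)), by simpa using h0, ?_⟩
    have h2 := h1.comp_mul (2 / ε)
    have h3 : (2 / ε) • (ε / 2, x).1 • v = v := by
      rw [smul_smul]
      simp [hε.ne']
    rw [h3] at h2
    refine h2.mono fun t ht => ?_
    have h4 : 0 < 2 / ε := by positivity
    have h5 : ε * (2 / ε) = 2 := by field_simp
    simp only [mem_ofPred_eq, mem_Ioo]
    constructor
    · nlinarith [ht.1]
    · nlinarith [ht.2]
  choose c hc0 hc using exists_isMIntegralCurve_of_isMIntegralCurveOn hv1 hε hloc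
  have hadd : ∀ (s t : ℝ) (x : M), c x (s + t) = c (c x t) s := by
    intro s t x
    have h1 : IsMIntegralCurve (c x ∘ (· + t)) v := (hc x).comp_add t
    exact congrFun (isMIntegralCurve_Ioo_eq_of_contMDiff_boundaryless (t₀ := 0) hv1 h1 (hc (c x t))
      (by simp [hc0])) s
  let F : ℝ × M → M := fun p => c p.2 p.1
  have hFε : ∀ t ∈ Ioo (-ε) ε, ∀ x : M, ContMDiffAt (𝓘(ℝ, ℝ).prod 𝓘(ℝ, E)) 𝓘(ℝ, E) ∞ F (t, x) := by
    intro t ht x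
    obtain ⟨x₀, hx₀⟩ := hεW t ht x
    refine ((hΓ x₀).contMDiffAt ((hWo x₀).mem_nhds hx₀)).congr_of_eventuallyEq ?_
    filter_upwards [(hWo x₀).mem_nhds hx₀] with p hp
    obtain ⟨h0, h1⟩ := hsol x₀ p hp
    have h2 : IsMIntegralCurve (c p.2 ∘ (· * p.1)) (p.1 • v) := (hc p.2).comp_mul p.1
    have hpv : ContMDiff 𝓘(ℝ, E) (𝓘(ℝ, E).prod 𝓘(ℝ, E)) 1
        (fun x => (⟨x, (p.1 • v) x⟩ : TangentBundle 𝓘(ℝ, E) M)) :=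
      ContMDiff.const_smul_section (a := p.1) hv1
    have h3 := isMIntegralCurveOn_Ioo_eqOn_of_contMDiff_boundaryless (t₀ := 0) (by norm_num) hpv
      (h2.isMIntegralCurveOn (Ioo (-2) 2)) h1 (by simp [hc0, h0])
    simpa [F] using h3 (show (1 : ℝ) ∈ Ioo (-2) 2 by norm_num)
  -- spread smoothness to all times by the group law
  have hFn : ∀ k : ℕ, ∀ t ∈ Ioo (-(2 ^ k * ε)) (2 ^ k * ε), ∀ x : M,
      ContMDiffAt (𝓘(ℝ, ℝ).prod 𝓘(ℝ, E)) 𝓘(ℝ, E) ∞ F (t, x) := by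
    intro k
    induction k with
    | zero => simpa using hFε
    | succ k ih =>
      intro t ht x
      have hF2 : F = fun p => F (p.1 / 2, F (p.1 / 2, p.2)) := by
        funext p
        simp only [F]
        rw [← hadd, add_halves]
      have ht2 : t / 2 ∈ Ioo (-(2 ^ k * ε)) (2 ^ k * ε) := by
        rw [pow_succ] at ht
        constructor <;> [linarith [ht.1]; linarith [ht.2]]
      rw [hF2]
      have hdiv : ContMDiffAt (𝓘(ℝ, ℝ).prod 𝓘(ℝ, E)) 𝓘(ℝ, ℝ) ∞ (fun p : ℝ × M => p.1 / 2)
          (t, x) := by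
        have h : ContDiff ℝ ∞ fun r : ℝ => r / 2 := by fun_prop
        exact h.contMDiff.contMDiffAt.comp _ contMDiffAt_fst
      have h1 : ContMDiffAt (𝓘(ℝ, ℝ).prod 𝓘(ℝ, E)) 𝓘(ℝ, E) ∞
          (fun p : ℝ × M => F (p.1 / 2, p.2)) (t, x) :=
        (ih (t / 2) ht2 x).comp (t, x) (hdiv.prodMk contMDiffAt_snd)
      exact (ih (t / 2) ht2 (F (t / 2, x))).comp (t, x) (hdiv.prodMk h1)
  have hF : ContMDiff (𝓘(ℝ, ℝ).prod 𝓘(ℝ, E)) 𝓘(ℝ, E) ∞ F := by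
    rintro ⟨t, x⟩
    obtain ⟨k, hk⟩ := pow_unbounded_of_one_lt (|t| / ε) (one_lt_two (α := ℝ))
    rw [div_lt_iff₀ hε] at hk
    exact hFn k t (abs_lt.1 hk) x
  exact ⟨{  toFun := fun t x => c x t
            cont' := hF.continuous
            map_add' := hadd
            map_zero' := hc0 }, hF, hc⟩

end Flow

/-! ### Orbit spaces, clocks and flow boxes -/

section LocalSections

/-- A manifold structure on the target of a map that has smooth local sections: charts of the
target whose composition with the map is smooth and whose inverses lift smoothly. -/
theorem exists_isManifoldSubmersion {m k : ℕ} {P Q : Type*} [TopologicalSpace P]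
    [ChartedSpace (Euc m) P] [TopologicalSpace Q] [T2Space Q]
    [SecondCountableTopology Q] {π : P → Q} (hπ : Continuous π) (hsurj : Function.Surjective π)
    (H : ∀ x : P, ∃ (e : OpenPartialHomeomorph Q (Euc k)) (s : Euc k → P), π x ∈ e.source ∧
      ContMDiffOn (𝓡 m) (𝓡 k) ∞ (e ∘ π) (π ⁻¹' e.source) ∧
      ContMDiffOn (𝓡 k) (𝓡 m) ∞ s e.target ∧
      (∀ y ∈ e.target, π (s y) = e.symm y) ∧ s (e (π x)) = x) :
    ∃ _ : ChartedSpace (Euc k) Q, IsManifoldSubmersion m k π := by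
  choose e s hsrc heπ hs hπs hsx using H
  let C : ChartedSpace (Euc k) Q :=
    { atlas := range e
      chartAt := fun q => e (Function.surjInv hsurj q)
      mem_chart_source := fun q => by
        have h := hsrc (Function.surjInv hsurj q)
        rwa [Function.surjInv_eq hsurj] at h
      chart_mem_atlas := fun q => mem_range_self _ }
  have hman : IsManifold (𝓡 k) ∞ Q := by
    refine isManifold_of_contDiffOn (𝓡 k) ∞ Q ?_
    rintro _ _ ⟨x, rfl⟩ ⟨x', rfl⟩
    have h1 : ContMDiffOn (𝓡 k) (𝓡 k) ∞ ((e x' ∘ π) ∘ s x) ((e x).symm ≫ₕ e x').source := by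
      refine (heπ x').comp ((hs x).mono fun y hy => hy.1) fun y hy => ?_
      rw [mem_preimage, mem_preimage, hπs x y hy.1]
      exact hy.2
    simp only [modelWithCornersSelf_coe, modelWithCornersSelf_coe_symm, Function.comp_id,
      Function.id_comp, preimage_id, range_id, inter_univ]
    refine h1.contDiffOn.congr fun y hy => ?_
    simp [hπs x y hy.1]
  have hatlas : ∀ x, e x ∈ IsManifold.maximalAtlas (𝓡 k) ∞ Q := fun x =>
    IsManifold.subset_maximalAtlas (mem_range_self x)
  have hπm : ContMDiff (𝓡 m) (𝓡 k) ∞ π := by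
    intro x
    have ho : IsOpen (π ⁻¹' (e x).source) := (e x).open_source.preimage hπ
    have h1 : ContMDiffOn (𝓡 m) (𝓡 k) ∞ ((e x).symm ∘ (e x ∘ π)) (π ⁻¹' (e x).source) :=
      (contMDiffOn_symm_of_mem_maximalAtlas (hatlas x)).comp (heπ x) fun y hy =>
        (e x).map_source hy
    refine (h1.contMDiffAt (ho.mem_nhds (hsrc x))).congr_of_eventuallyEq ?_
    filter_upwards [ho.mem_nhds (hsrc x)] with y hy
    exact ((e x).left_inv hy).symm
  refine ⟨C, hman, ‹_›, ‹_›, hπm, fun x => ?_⟩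
  set y := e x (π x) with hy
  have hyt : y ∈ (e x).target := (e x).map_source (hsrc x)
  have hes : ContMDiffAt (𝓡 k) (𝓡 k) ∞ (e x).symm y :=
    (contMDiffOn_symm_of_mem_maximalAtlas (hatlas x)).contMDiffAt ((e x).open_target.mem_nhds hyt)
  have hee : ContMDiffAt (𝓡 k) (𝓡 k) ∞ (e x) ((e x).symm y) :=
    (contMDiffOn_of_mem_maximalAtlas (hatlas x)).contMDiffAt
      ((e x).open_source.mem_nhds ((e x).map_target hyt))
  have hsy : ContMDiffAt (𝓡 k) (𝓡 m) ∞ (s x) y :=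
    (hs x).contMDiffAt ((e x).open_target.mem_nhds hyt)
  -- `π ∘ s ∘ e` is the identity near `π x`, so the derivative of `π` at `x` has a right inverse
  have hq : (e x).symm y = π x := (e x).left_inv (hsrc x)
  have h1 : HasMFDerivAt (𝓡 k) (𝓡 k) (π ∘ (s x ∘ e x)) (π x) _ :=
    HasMFDerivAt.comp (π x) (g := π) (f := s x ∘ e x)
      ((hπm ((s x ∘ e x) (π x))).mdifferentiableAt (by simp)).hasMFDerivAt
      (HasMFDerivAt.comp (π x) (hsy.mdifferentiableAt (by simp)).hasMFDerivAt
        ((hq ▸ hee).mdifferentiableAt (by simp)).hasMFDerivAt)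
  have h2 : HasMFDerivAt (𝓡 k) (𝓡 k) (π ∘ (s x ∘ e x)) (π x)
      (ContinuousLinearMap.id ℝ (TangentSpace (𝓡 k) (π x))) := by
    refine (hasMFDerivAt_id (π x)).congr_of_eventuallyEq ?_
    filter_upwards [(e x).open_source.mem_nhds (hsrc x)] with q hq
    simp [hπs x _ ((e x).map_source hq), (e x).left_inv hq]
  have h3 := hasMFDerivAt_unique h1 h2
  intro w
  have h4 := congrArg (fun A => A w) h3
  have h5 : (s x ∘ e x) (π x) = x := hsx x
  have h6 : ∀ z, z = x → ∀ B : Euc k →L[ℝ] Euc m,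
      (mfderiv (𝓡 m) (𝓡 k) π z : Euc m →L[ℝ] Euc k) (B w) = w →
      ∃ a, mfderiv (𝓡 m) (𝓡 k) π x a = w := by
    rintro z rfl B hB
    exact ⟨B w, hB⟩
  exact h6 _ h5 _ h4

end LocalSections

section OrbitSpaces

variable {M : Type*} [TopologicalSpace M] {θ : Flow ℝ M} {U : Opens M}

theorem orbitProj_eq_iff {x y : U} : orbitProj θ U x = orbitProj θ U y ↔ ∃ t : ℝ, θ t x = y :=
  Quotient.eq (r := orbitSetoid θ U)

theorem orbitProj_flow {x y : U} (t : ℝ) (h : θ t x = y) : orbitProj θ U y = orbitProj θ U x :=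
  (orbitProj_eq_iff.2 ⟨t, h⟩).symm

theorem isOpenQuotientMap_orbitProj (hU : ∀ t : ℝ, ∀ x ∈ U, θ t x ∈ U) :
    IsOpenQuotientMap (orbitProj θ U) := by
  refine ⟨Quotient.mk_surjective, continuous_quot_mk, fun S hS => ?_⟩
  have hq : IsQuotientMap (orbitProj θ U) := isQuotientMap_quot_mk
  rw [← hq.isOpen_preimage]
  have h : orbitProj θ U ⁻¹' (orbitProj θ U '' S) =
      ⋃ t : ℝ, (fun x : U => (⟨θ t x, hU t x x.2⟩ : U)) ⁻¹' S := by
    ext x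
    simp only [mem_preimage, mem_image, mem_iUnion]
    constructor
    · rintro ⟨y, hy, hyx⟩
      obtain ⟨t, ht⟩ := orbitProj_eq_iff.1 hyx.symm
      exact ⟨t, by convert hy⟩
    · rintro ⟨t, ht⟩
      exact ⟨_, ht, orbitProj_flow t rfl⟩
  rw [h]
  refine isOpen_iUnion fun t => hS.preimage ?_
  exact ((θ.continuous continuous_const continuous_subtype_val)).subtype_mk _

/-- A clock of a flow on an invariant open set: a function that changes at least at the rate `c`
along all orbits. -/
structure IsClock (θ : Flow ℝ M) (U : Opens M) (F : M → ℝ) (c : ℝ) : Prop where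
  pos : 0 < c
  continuousOn : ContinuousOn F U
  invariant : ∀ t : ℝ, ∀ x ∈ U, θ t x ∈ U
  le_abs_sub : ∀ t : ℝ, ∀ x ∈ U, c * |t| ≤ |F (θ t x) - F x|

variable {F : M → ℝ} {c : ℝ}

/-- Points on the same orbit with nearby clock readings are separated by a short time only, so the
orbit relation is closed. -/
theorem IsClock.t2Space [T2Space M] (h : IsClock θ U F c) : T2Space (OrbitSpace θ U) := by
  rw [t2Space_iff_of_isOpenQuotientMap (isOpenQuotientMap_orbitProj h.invariant)]
  rw [← isOpen_compl_iff, isOpen_iff_mem_nhds]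
  rintro ⟨x, y⟩ hxy
  have hF : Continuous fun x : U => F x := continuousOn_iff_continuous_domRestrict.1 h.continuousOn
  let d : U × U → ℝ := fun q => |F q.2 - F q.1|
  have hd : Continuous d := ((hF.comp continuous_snd).sub (hF.comp continuous_fst)).abs
  let T := (d (x, y) + 1) / c
  -- near `(x, y)` only the times in `[-T, T]` matter
  let S : Set (U × U) := Prod.snd '' {q : Icc (-T) T × (U × U) | θ q.1 q.2.1 = q.2.2}
  have hS : IsClosed S := by
    refine isClosedMap_snd_of_compactSpace _ (isClosed_eq ?_ ?_)
    · exact θ.continuous (by fun_prop) (by fun_prop)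
    · fun_prop
  have hxyS : (x, y) ∈ Sᶜ := by
    rintro ⟨⟨t, q⟩, hq, rfl⟩
    exact hxy (orbitProj_eq_iff.2 ⟨t, hq⟩)
  filter_upwards [hS.isOpen_compl.mem_nhds hxyS,
    hd.continuousAt.eventually_lt continuousAt_const (lt_add_one (d (x, y)))] with q hq hqd hπ
  obtain ⟨t, ht⟩ := orbitProj_eq_iff.1 hπ
  have h1 := h.le_abs_sub t q.1 q.1.2
  rw [ht] at h1
  have h2 : |t| ≤ T := by
    rw [le_div_iff₀ h.pos, mul_comm]
    exact h1.trans hqd.le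
  exact hq ⟨(⟨t, abs_le.1 h2⟩, q), ht, rfl⟩

end OrbitSpaces

section FlowBox

variable {n : ℕ} {M : Type*} [TopologicalSpace M] [ChartedSpace (Euc (n + 1)) M]
  [IsManifold (𝓡 (n + 1)) ∞ M] {θ : Flow ℝ M}

/-- A vector `w ≠ 0` of `ℝⁿ⁺¹` spans a complement of a hyperplane. -/
theorem exists_equiv_prod_apply_eq {w : Euc (n + 1)} (hw : w ≠ 0) :
    ∃ L : (ℝ × Euc n) ≃L[ℝ] Euc (n + 1), L (1, 0) = w := by
  obtain ⟨V, hV⟩ := Submodule.exists_isCompl (ℝ ∙ w)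
  have h1 : Module.finrank ℝ (ℝ ∙ w) = 1 := finrank_span_singleton hw
  have h2 : Module.finrank ℝ V = n := by
    have h := Submodule.finrank_add_eq_of_isCompl hV
    rw [h1, finrank_euclideanSpace_fin] at h
    omega
  have h3 : Nonempty (V ≃ₗ[ℝ] Euc n) := ⟨LinearEquiv.ofFinrankEq _ _ (by simp [h2])⟩
  obtain ⟨e⟩ := h3
  let L : (ℝ × Euc n) ≃ₗ[ℝ] Euc (n + 1) :=
    ((LinearEquiv.toSpanNonzeroSingleton ℝ (Euc (n + 1)) w hw).prodCongr e.symm).trans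
      (Submodule.prodEquivOfIsCompl _ _ hV)
  exact ⟨L.toContinuousLinearEquiv, by simp [L]⟩

/-- A flow box around a point that is not an equilibrium: `(t, y) ↦ θ t (s y)` for a transversal
`s` through the point is an open embedding of a small cylinder. -/
theorem exists_flowBox
    (hθ : ContMDiff (𝓘(ℝ, ℝ).prod (𝓡 (n + 1))) (𝓡 (n + 1)) ∞ (fun p : ℝ × M => θ p.1 p.2))
    {v : (x : M) → TangentSpace (𝓡 (n + 1)) x} (hv : ∀ x, IsMIntegralCurve (fun t => θ t x) v)
    {x₀ : M} (hx₀ : v x₀ ≠ 0) :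
    ∃ δ > (0 : ℝ), ∃ (s : Euc n → M) (G : OpenPartialHomeomorph (ℝ × Euc n) M),
      s 0 = x₀ ∧ ContMDiffOn (𝓡 n) (𝓡 (n + 1)) ∞ s (Metric.ball 0 δ) ∧
      G.source = Ioo (-δ) δ ×ˢ Metric.ball 0 δ ∧ (∀ p ∈ G.source, G p = θ p.1 (s p.2)) ∧
      ContMDiffOn (𝓡 (n + 1)) 𝓘(ℝ, ℝ × Euc n) ∞ G.symm G.target := by
  set φ := chartAt (Euc (n + 1)) x₀ with hφ
  have hφ0 : x₀ ∈ φ.source := mem_chart_source _ x₀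
  have hφs : ContMDiffOn (𝓡 (n + 1)) (𝓡 (n + 1)) ∞ φ.symm φ.target := contMDiffOn_chart_symm
  have hφc : ContMDiffOn (𝓡 (n + 1)) (𝓡 (n + 1)) ∞ φ φ.source := contMDiffOn_chart
  set w : Euc (n + 1) := mfderiv (𝓡 (n + 1)) (𝓡 (n + 1)) φ x₀ (v x₀) with hw
  have hw0 : w ≠ 0 := by
    intro h
    have hinj := (mdifferentiable_chart (I := 𝓡 (n + 1)) x₀).mfderiv_injective hφ0
    exact hx₀ (hinj (h.trans (map_zero _).symm))
  -- coordinates in which the vector field at `x₀` is the direction of the first factor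
  obtain ⟨L, hL⟩ := exists_equiv_prod_apply_eq hw0
  let a := φ x₀
  let s : Euc n → M := fun y => φ.symm (a + L (0, y))
  let D : Set (Euc n) := (fun y => a + L (0, y)) ⁻¹' φ.target
  have hDo : IsOpen D := φ.open_target.preimage (by fun_prop)
  have hs0 : s 0 = x₀ := by
    have h : (0 : ℝ × Euc n) = (0, 0) := rfl
    simp [s, ← h, a, φ.left_inv hφ0]
  have hD0 : (0 : Euc n) ∈ D := by
    have h : (0 : ℝ × Euc n) = (0, 0) := rfl
    simp [D, ← h, a, φ.map_source hφ0]
  have hs : ContMDiffOn (𝓡 n) (𝓡 (n + 1)) ∞ s D := by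
    refine hφs.comp (f := fun y => a + L (0, y)) (ContDiff.contMDiff ?_).contMDiffOn fun y hy => hy
    fun_prop
  -- the flow box in the chart
  let Θ : ℝ × Euc n → M := fun p => θ p.1 (s p.2)
  have hΘ : ContMDiffOn 𝓘(ℝ, ℝ × Euc n) (𝓡 (n + 1)) ∞ Θ (Prod.snd ⁻¹' D) := by
    have h1 : ContMDiffOn 𝓘(ℝ, ℝ × Euc n) 𝓘(ℝ, ℝ) ∞ (fun p : ℝ × Euc n => p.1)
        (Prod.snd ⁻¹' D) := contDiff_fst.contMDiff.contMDiffOn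
    have h2 : ContMDiffOn 𝓘(ℝ, ℝ × Euc n) (𝓡 (n + 1)) ∞ (fun p : ℝ × Euc n => s p.2)
        (Prod.snd ⁻¹' D) := hs.comp (contDiff_snd.contMDiff.contMDiffOn) fun p hp => hp
    exact hθ.comp_contMDiffOn (h1.prodMk h2)
  let Ω : Set (ℝ × Euc n) := Prod.snd ⁻¹' D ∩ Θ ⁻¹' φ.source
  have hΩo : IsOpen Ω :=
    hΘ.continuousOn.isOpen_inter_preimage (hDo.preimage continuous_snd) φ.open_source
  have hΘ0 : Θ (0, 0) = x₀ := by simp [Θ, hs0]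
  have hΩ0 : ((0 : ℝ), (0 : Euc n)) ∈ Ω := ⟨hD0, by rw [mem_preimage, hΘ0]; exact hφ0⟩
  have hΨ : ContDiffOn ℝ ∞ (φ ∘ Θ) Ω :=
    (hφc.comp (hΘ.mono inter_subset_left) fun p hp => hp.2).contDiffOn
  have hd : HasFDerivAt (φ ∘ Θ) (L : (ℝ × Euc n) →L[ℝ] Euc (n + 1)) (0, 0) := by
    have h0 : HasFDerivAt (φ ∘ Θ) (fderiv ℝ (φ ∘ Θ) (0, 0)) (0, 0) :=
      ((hΨ.contDiffAt (hΩo.mem_nhds hΩ0)).differentiableAt (by simp)).hasFDerivAt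
    have h1 : fderiv ℝ (φ ∘ Θ) (0, 0) (1, 0) = w := by
      have h2 : HasDerivAt (fun t : ℝ => (φ ∘ Θ) (t, 0)) (fderiv ℝ (φ ∘ Θ) (0, 0) (1, 0)) 0 :=
        HasFDerivAt.comp_hasDerivAt (f := fun t : ℝ => (t, (0 : Euc n))) (0 : ℝ) h0
          ((hasDerivAt_id (0 : ℝ)).prodMk (hasDerivAt_const (0 : ℝ) (0 : Euc n)))
      have h3 : HasMFDerivAt 𝓘(ℝ, ℝ) (𝓡 (n + 1)) (fun t : ℝ => θ t x₀) 0
        ((1 : ℝ →L[ℝ] ℝ).smulRight (v (θ 0 x₀))) := hv x₀ 0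
      have hφd : HasMFDerivAt (𝓡 (n + 1)) (𝓡 (n + 1)) φ x₀ (mfderiv (𝓡 (n + 1)) (𝓡 (n + 1)) φ x₀) :=
        ((hφc.contMDiffAt (φ.open_source.mem_nhds hφ0)).mdifferentiableAt (by simp)).hasMFDerivAt
      have hφd' : HasMFDerivAt (𝓡 (n + 1)) (𝓡 (n + 1)) φ (θ 0 x₀)
          (mfderiv (𝓡 (n + 1)) (𝓡 (n + 1)) φ x₀ : Euc (n + 1) →L[ℝ] Euc (n + 1)) := by
        -- `θ 0 x₀` and `x₀` are equal, but not definitionally so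
        have h4 : ∀ z, z = x₀ → HasMFDerivAt (𝓡 (n + 1)) (𝓡 (n + 1)) φ z
            (mfderiv (𝓡 (n + 1)) (𝓡 (n + 1)) φ x₀ : Euc (n + 1) →L[ℝ] Euc (n + 1)) := by
          rintro z rfl
          exact hφd
        exact h4 _ (θ.map_zero_apply x₀)
      have h4 := HasMFDerivAt.comp (0 : ℝ) hφd' h3
      have h40 : ∀ (A : Euc (n + 1) →L[ℝ] Euc (n + 1)) (V : Euc (n + 1)),
          HasFDerivAt (φ ∘ fun t : ℝ => θ t x₀) (A.comp ((1 : ℝ →L[ℝ] ℝ).smulRight V)) 0 →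
          HasDerivAt (φ ∘ fun t : ℝ => θ t x₀) (A V) 0 := by
        intro A V h
        simpa using h.hasDerivAt
      have h5 := h40 (mfderiv (𝓡 (n + 1)) (𝓡 (n + 1)) φ x₀) (v (θ 0 x₀))
        (hasMFDerivAt_iff_hasFDerivAt.1 h4)
      have h6 : (fun t : ℝ => (φ ∘ Θ) (t, 0)) = φ ∘ fun t : ℝ => θ t x₀ := by
        funext t
        simp [Θ, hs0]
      rw [h6] at h2
      refine (h2.unique h5).trans ?_
      have h7 : ∀ z, z = x₀ → (mfderiv (𝓡 (n + 1)) (𝓡 (n + 1)) φ x₀ : Euc (n + 1) →L[ℝ] Euc (n + 1))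
          (v z : Euc (n + 1)) = w := by
        rintro z rfl
        rfl
      exact h7 _ (θ.map_zero_apply x₀)
    have h5 : ∀ y, fderiv ℝ (φ ∘ Θ) (0, 0) (0, y) = L (0, y) := by
      intro y
      have h2 : HasFDerivAt (fun y : Euc n => (φ ∘ Θ) (0, y)) _ 0 :=
        h0.comp (0 : Euc n) (hasFDerivAt_prodMk_right (𝕜 := ℝ) (0 : ℝ) (0 : Euc n))
      have h3 : HasFDerivAt (fun y : Euc n => (φ ∘ Θ) (0, y))
          ((L : (ℝ × Euc n) →L[ℝ] Euc (n + 1)).comp (ContinuousLinearMap.inr ℝ ℝ (Euc n))) 0 := by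
        have h4 := (((L : (ℝ × Euc n) →L[ℝ] Euc (n + 1)).comp
          (ContinuousLinearMap.inr ℝ ℝ (Euc n))).hasFDerivAt (x := 0)).const_add a
        refine h4.congr_of_eventuallyEq ?_
        filter_upwards [hDo.mem_nhds hD0] with y hy
        simp only [Function.comp, Θ, θ.map_zero_apply, s]
        exact φ.right_inv hy
      simpa using congrArg (fun A => A y) (h2.unique h3)
    have h6 : fderiv ℝ (φ ∘ Θ) (0, 0) = L := by
      refine ContinuousLinearMap.ext fun p => ?_
      have hp : p = p.1 • ((1 : ℝ), (0 : Euc n)) + (0, p.2) := by ext <;> simp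
      rw [hp, map_add, map_smul, h1, h5]
      simp [← hL, ← map_smul, ← map_add]
    rwa [h6] at h0
  obtain ⟨G, hG0, hGΩ, hGΘ, hGs⟩ := exists_openPartialHomeomorph_of_contDiffOn hΩo hΨ hΩ0 L hd
  obtain ⟨δ, hδ, hδG⟩ := Metric.isOpen_iff.1 G.open_source _ hG0
  have hbox : Ioo (-δ) δ ×ˢ Metric.ball (0 : Euc n) δ ⊆ G.source := by
    refine Subset.trans (fun p hp => ?_) hδG
    rw [← ball_prod_same]
    refine ⟨?_, hp.2⟩
    rw [Real.ball_eq_Ioo, zero_sub, zero_add]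
    exact hp.1
  have hboxo : IsOpen (Ioo (-δ) δ ×ˢ Metric.ball (0 : Euc n) δ) := isOpen_Ioo.prod Metric.isOpen_ball
  let G' := (G.restrOpen _ hboxo).trans φ.symm
  have hG's : G'.source = Ioo (-δ) δ ×ˢ Metric.ball (0 : Euc n) δ := by
    ext p
    simp only [G', OpenPartialHomeomorph.trans_source, OpenPartialHomeomorph.restrOpen_source,
      OpenPartialHomeomorph.symm_source, mem_inter_iff, mem_preimage]
    constructor
    · exact fun h => h.1.2
    · intro h
      refine ⟨⟨hbox h, h⟩, ?_⟩
      change G p ∈ φ.target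
      rw [hGΘ]
      exact φ.map_source (hGΩ (hbox h)).2
  have hG'Θ : ∀ p ∈ G'.source, G' p = Θ p := by
    intro p hp
    rw [hG's] at hp
    change φ.symm (G p) = _
    rw [hGΘ]
    exact φ.left_inv (hGΩ (hbox hp)).2
  refine ⟨δ, hδ, s, G', hs0, hs.mono fun y hy => ?_, hG's, hG'Θ, ?_⟩
  · exact (hGΩ (hbox (show ((0 : ℝ), y) ∈ _ from ⟨⟨by linarith, hδ⟩, hy⟩))).1
  · have h1 : ContMDiffOn (𝓡 (n + 1)) 𝓘(ℝ, ℝ × Euc n) ∞ (G.symm ∘ φ) (φ.source ∩ φ ⁻¹' G.target) :=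
      hGs.contMDiffOn.comp (hφc.mono inter_subset_left) fun x hx => hx.2
    refine h1.mono fun x hx => ?_
    have h2 := G'.map_target hx
    have h3 := G'.right_inv hx
    rw [hG'Θ _ h2] at h3
    rw [hG's] at h2
    have h4 := hGΩ (hbox h2)
    rw [← h3]
    refine ⟨h4.2, ?_⟩
    have h5 := G.map_source (hbox h2)
    rwa [hGΘ] at h5

end FlowBox

/-! ### The manifold structure of an orbit space with a clock -/

section Quotient

variable {n : ℕ} {M : Type*} [TopologicalSpace M] [ChartedSpace (Euc (n + 1)) M]
  [IsManifold (𝓡 (n + 1)) ∞ M] [T2Space M] [SecondCountableTopology M] {θ : Flow ℝ M} {U : Opens M}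
  {F : M → ℝ} {c : ℝ}

/-- The orbit space of a smooth flow with a clock is a manifold: transversals of flow boxes on which
the clock varies little meet every orbit at most once and are the charts. -/
theorem IsClock.exists_chartedSpace_orbitSpace (h : IsClock θ U F c)
    (hθ : ContMDiff (𝓘(ℝ, ℝ).prod (𝓡 (n + 1))) (𝓡 (n + 1)) ∞ (fun p : ℝ × M => θ p.1 p.2))
    {v : (x : M) → TangentSpace (𝓡 (n + 1)) x} (hv : ∀ x, IsMIntegralCurve (fun t => θ t x) v)
    (hv0 : ∀ x ∈ U, v x ≠ 0) :
    ∃ _ : ChartedSpace (Euc n) (OrbitSpace θ U), IsManifoldSubmersion (n + 1) n (orbitProj θ U) := by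
  have hπ := isOpenQuotientMap_orbitProj h.invariant
  have := h.t2Space
  have : SecondCountableTopology (OrbitSpace θ U) :=
    hπ.isQuotientMap.secondCountableTopology hπ.isOpenMap
  refine exists_isManifoldSubmersion hπ.continuous hπ.surjective fun x₀ => ?_
  obtain ⟨δ, hδ, s, G, hs0, hs, hGs, hG, hGsymm⟩ := exists_flowBox hθ hv (hv0 x₀ x₀.2)
  -- on the transversal the clock is to vary by less than `c δ`, so that two of its points on one
  -- orbit are less than `δ` apart in time
  have hVo : IsOpen ((U : Set M) ∩ F ⁻¹' Metric.ball (F x₀) (c * δ / 2)) :=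
    h.continuousOn.isOpen_inter_preimage U.isOpen Metric.isOpen_ball
  have hWo := hs.continuousOn.isOpen_inter_preimage Metric.isOpen_ball hVo
  have hc := h.pos
  obtain ⟨ε, hε, hεW⟩ := Metric.isOpen_iff.1 hWo 0 ⟨Metric.mem_ball_self hδ, by
    rw [mem_preimage, hs0]
    exact ⟨x₀.2, Metric.mem_ball_self (by positivity)⟩⟩
  set W : Set (Euc n) := Metric.ball 0 ε with hW
  have hWδ : ∀ y ∈ W, y ∈ Metric.ball (0 : Euc n) δ := fun y hy => (hεW hy).1
  have hWo : IsOpen W := Metric.isOpen_ball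
  classical
  let r : Euc n → U := fun y => if hy : s y ∈ U then ⟨s y, hy⟩ else x₀
  have hr : ∀ y ∈ W, (r y : M) = s y := by
    intro y hy
    have h1 : s y ∈ U := (hεW hy).2.1
    simp [r, h1]
  have hrs : ContMDiffOn (𝓡 n) (𝓡 (n + 1)) ∞ r W := by
    intro y hy
    refine (ContMDiffWithinAt.subtypeVal_comp_iff U r W y).1 ?_
    exact ((hs.mono hWδ).congr hr) y hy
  have hr0 : r 0 = x₀ := Subtype.ext ((hr 0 (Metric.mem_ball_self hε)).trans hs0)
  have h0 : ∀ y ∈ W, ((0 : ℝ), y) ∈ G.source := by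
    intro y hy
    rw [hGs]
    exact ⟨⟨by linarith, hδ⟩, hWδ y hy⟩
  let p : Euc n → OrbitSpace θ U := orbitProj θ U ∘ r
  have hinj : InjOn p W := by
    intro y hy y' hy' hyy
    obtain ⟨t, ht⟩ := orbitProj_eq_iff.1 hyy
    rw [hr y hy, hr y' hy'] at ht
    have h1 := h.le_abs_sub t (s y) (hεW hy).2.1
    have h2 : |F (s y') - F (s y)| < c * δ := by
      have h3 := (hεW hy).2.2
      have h4 := (hεW hy').2.2
      rw [mem_preimage, Metric.mem_ball, Real.dist_eq] at h3 h4
      rw [abs_lt] at h3 h4 ⊢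
      constructor <;> linarith [h3.1, h3.2, h4.1, h4.2]
    rw [ht] at h1
    have h3 : |t| < δ := lt_of_mul_lt_mul_left (h1.trans_lt h2) hc.le
    have h4 : (t, y) ∈ G.source := by
      rw [hGs]
      exact ⟨abs_lt.1 h3, hWδ y hy⟩
    have h5 : G (t, y) = G (0, y') := by
      rw [hG _ h4, hG _ (h0 y' hy')]
      simpa using ht
    exact congrArg Prod.snd (G.injOn h4 (h0 y' hy') h5)
  have hpc : ContinuousOn p W := hπ.continuous.comp_continuousOn hrs.continuousOn
  -- the saturation of a part of the transversal is the saturation of an open part of the flow box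
  have hpo : ∀ A ⊆ W, IsOpen A → IsOpen (p '' A) := by
    intro A hAW hA
    have h1 : IsOpen (G '' (Ioo (-δ) δ ×ˢ A)) := by
      refine G.isOpen_image_of_subset_source (isOpen_Ioo.prod hA) ?_
      rw [hGs]
      exact prod_mono_right fun y hy => hWδ y (hAW hy)
    have h2 : p '' A = orbitProj θ U '' (Subtype.val ⁻¹' (G '' (Ioo (-δ) δ ×ˢ A))) := by
      ext q
      constructor
      · rintro ⟨y, hy, rfl⟩
        refine ⟨r y, ⟨(0, y), ⟨⟨by linarith, hδ⟩, hy⟩, ?_⟩, rfl⟩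
        rw [hG _ (h0 y (hAW hy)), hr y (hAW hy)]
        exact θ.map_zero_apply _
      · rintro ⟨x, ⟨⟨t, y⟩, ⟨ht, hy⟩, hx⟩, rfl⟩
        refine ⟨y, hy, orbitProj_eq_iff.2 ⟨t, ?_⟩⟩
        rw [hr y (hAW hy), ← hx, hG]
        rw [hGs]
        exact ⟨ht, hWδ y (hAW hy)⟩
    rw [h2]
    exact hπ.isOpenMap _ (h1.preimage continuous_subtype_val)
  let e₀ : PartialEquiv (Euc n) (OrbitSpace θ U) := hinj.toPartialEquiv p W
  let e : OpenPartialHomeomorph (Euc n) (OrbitSpace θ U) :=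
    OpenPartialHomeomorph.ofContinuousOpenRestrict e₀ hpc (by
      intro A hA
      have h1 : IsOpen (Subtype.val '' A : Set (Euc n)) := hWo.isOpenMap_subtype_val A hA
      have h2 := hpo _ (by rintro _ ⟨y, -, rfl⟩; exact y.2) h1
      rw [image_image] at h2
      exact h2) hWo
  have hep : ∀ y, e y = p y := fun y => rfl
  have hes : e.source = W := rfl
  have het : e.target = p '' W := rfl
  refine ⟨e.symm, r, ?_, ?_, hrs, fun y hy => rfl, ?_⟩
  · change _ ∈ e.target
    rw [het]
    exact ⟨0, Metric.mem_ball_self hε, congrArg (orbitProj θ U) hr0⟩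
  · intro x hx
    change _ ∈ e.target at hx
    rw [het] at hx
    obtain ⟨y, hy, hyx⟩ := hx
    obtain ⟨t, ht⟩ := orbitProj_eq_iff.1 hyx
    rw [hr y hy] at ht
    -- move the point back to the flow box and read off the transversal coordinate
    let B : Set (ℝ × Euc n) := Ioo (-δ) δ ×ˢ W
    have hBG : B ⊆ G.source := by
      rw [hGs]
      exact prod_mono_right hWδ
    have hBo : IsOpen (G '' B) := G.isOpen_image_of_subset_source (isOpen_Ioo.prod hWo) hBG
    let k : U → M := fun x' => θ (-t) x'
    have hk : ContMDiff (𝓡 (n + 1)) (𝓡 (n + 1)) ∞ k :=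
      hθ.comp (contMDiff_const.prodMk contMDiff_subtype_val)
    have hkx : k x ∈ G '' B := by
      refine ⟨(0, y), ⟨⟨by linarith, hδ⟩, hy⟩, ?_⟩
      rw [hG _ (h0 y hy)]
      simp only [k, ← ht, ← θ.map_add]
      simp
    have hkn : k ⁻¹' (G '' B) ∈ 𝓝 x := (hBo.preimage hk.continuous).mem_nhds hkx
    have hsm : ContMDiffAt (𝓡 (n + 1)) (𝓡 n) ∞ (fun x' => (G.symm (k x')).2) x := by
      have h1 : ContMDiffAt (𝓡 (n + 1)) 𝓘(ℝ, ℝ × Euc n) ∞ G.symm (k x) := by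
        refine hGsymm.contMDiffAt (G.open_target.mem_nhds ?_)
        obtain ⟨b, hb, hbk⟩ := hkx
        rw [← hbk]
        exact G.map_source (hBG hb)
      exact ContMDiffAt.comp x (contDiff_snd.contMDiff.contMDiffAt)
        (ContMDiffAt.comp x h1 (hk x))
    refine (hsm.congr_of_eventuallyEq ?_).contMDiffWithinAt
    filter_upwards [hkn] with x' hx'
    obtain ⟨⟨a, y'⟩, hb, hbk⟩ := hx'
    have h1 : G.symm (k x') = (a, y') := by
      rw [← hbk]
      exact G.left_inv (hBG hb)
    rw [h1]
    have h2 : orbitProj θ U x' = e y' := by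
      refine (orbitProj_eq_iff.2 ⟨t + a, ?_⟩ : orbitProj θ U (r y') = orbitProj θ U x').symm
      rw [hr y' hb.2, θ.map_add, ← hG _ (hBG hb), hbk]
      simp only [k, ← θ.map_add]
      simp
    change e.symm (orbitProj θ U x') = y'
    rw [h2]
    exact e.left_inv hb.2
  · have h1 : e.symm (orbitProj θ U x₀) = 0 := by
      have h2 : orbitProj θ U x₀ = e 0 := (congrArg (orbitProj θ U) hr0).symm
      rw [h2]
      exact e.left_inv (Metric.mem_ball_self hε)
    change r (e.symm (orbitProj θ U x₀)) = x₀
    rw [h1, hr0]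

end Quotient

/-! ### Submanifolds and open subsets of orbit spaces -/

section LinearAlgebra

theorem ContinuousLinearMap.eventually_surjective {E F : Type*} [NormedAddCommGroup E]
    [NormedSpace ℝ E] [NormedAddCommGroup F] [NormedSpace ℝ F] [FiniteDimensional ℝ F]
    {A : E →L[ℝ] F} (hA : Function.Surjective A) :
    ∀ᶠ B in 𝓝 A, Function.Surjective (B : E →L[ℝ] F) := by
  have := FiniteDimensional.complete ℝ F
  obtain ⟨R, hR⟩ := A.exists_rightInverse_of_surjective (LinearMap.range_eq_top.2 hA)
  have h1 : Continuous fun B : E →L[ℝ] F => B.comp R := by fun_prop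
  have h2 : IsUnit (A.comp R) := by
    rw [hR]
    exact isUnit_one
  filter_upwards [(Units.isOpen.preimage h1).mem_nhds h2] with B hB y
  obtain ⟨C, hC⟩ := IsUnit.exists_right_inv (hB : IsUnit (B.comp R))
  exact ⟨R (C y), congrArg (fun T : F →L[ℝ] F => T y) hC⟩

/-- A map that kills the kernel of `p`, here a line, stays surjective on the image of a section. -/
theorem surjective_comp_section {E F G : Type*} [AddCommGroup E] [Module ℝ E] [AddCommGroup F]
    [Module ℝ F] [AddCommGroup G] [Module ℝ G] [FiniteDimensional ℝ E] [FiniteDimensional ℝ F]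
    (hdim : Module.finrank ℝ E = Module.finrank ℝ F + 1) {p : E →ₗ[ℝ] F} {s : F →ₗ[ℝ] E}
    (hps : ∀ y, p (s y) = y) {g : E} (hg : g ≠ 0) (hpg : p g = 0) {A : E →ₗ[ℝ] G}
    (hA : Function.Surjective A) (hAg : A g = 0) : Function.Surjective fun y => A (s y) := by
  have h1 : Module.finrank ℝ (LinearMap.ker p) = 1 := by
    have h := p.finrank_range_add_finrank_ker
    rw [LinearMap.range_eq_top.2 fun y => ⟨s y, hps y⟩, finrank_top] at h
    omega
  intro z
  obtain ⟨x, rfl⟩ := hA z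
  have h2 : x - s (p x) ∈ LinearMap.ker p := by simp [hps]
  obtain ⟨a, ha⟩ := exists_smul_eq_of_finrank_eq_one h1
    (x := (⟨g, hpg⟩ : LinearMap.ker p)) (fun h => hg (congrArg Subtype.val h)) ⟨_, h2⟩
  have h3 : a • g = x - s (p x) := congrArg Subtype.val ha
  refine ⟨p x, ?_⟩
  have h4 := congrArg A h3
  rw [map_smul, hAg, smul_zero, map_sub] at h4
  exact (sub_eq_zero.1 h4.symm).symm

end LinearAlgebra

section Sections

variable {m k : ℕ} {P Q : Type*} [TopologicalSpace P] [ChartedSpace (Euc m) P]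
  [IsManifold (𝓡 m) ∞ P] [TopologicalSpace Q] [ChartedSpace (Euc k) Q]

/-- A submersion has smooth local sections through any point: the inverse function theorem applies
to its restriction to the image of a right inverse of the derivative. -/
theorem IsManifoldSubmersion.exists_section {π : P → Q} (h : IsManifoldSubmersion m k π) (x : P) :
    ∃ (W : Set Q) (s : Q → P), IsOpen W ∧ π x ∈ W ∧ ContMDiffOn (𝓡 k) (𝓡 m) ∞ s W ∧
      s (π x) = x ∧ ∀ q ∈ W, π (s q) = q := by
  have := h.isManifold
  set φ := chartAt (Euc m) x with hφ
  set ψ := chartAt (Euc k) (π x) with hψ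
  have hx : x ∈ φ.source := mem_chart_source _ x
  have hπx : π x ∈ ψ.source := mem_chart_source _ _
  have hφs : ContMDiffOn (𝓡 m) (𝓡 m) ∞ φ.symm φ.target := contMDiffOn_chart_symm
  have hψc : ContMDiffOn (𝓡 k) (𝓡 k) ∞ ψ ψ.source := contMDiffOn_chart
  set a : Euc m := φ x with ha
  have hat : a ∈ φ.target := φ.map_source hx
  have hax : φ.symm a = x := φ.left_inv hx
  let f : Euc m → Euc k := ψ ∘ π ∘ φ.symm
  let Ω : Set (Euc m) := φ.target ∩ (π ∘ φ.symm) ⁻¹' ψ.source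
  have hπφ : ContMDiffOn (𝓡 m) (𝓡 k) ∞ (π ∘ φ.symm) φ.target :=
    h.contMDiff.comp_contMDiffOn hφs
  have hΩ : IsOpen Ω := hπφ.continuousOn.isOpen_inter_preimage φ.open_target ψ.open_source
  have haΩ : a ∈ Ω := ⟨hat, by
    change π (φ.symm a) ∈ ψ.source
    rw [hax]
    exact hπx⟩
  have hf : ContDiffOn ℝ ∞ f Ω :=
    (hψc.comp (hπφ.mono inter_subset_left) fun y hy => hy.2).contDiffOn
  have hfa : HasFDerivAt f (fderiv ℝ f a) a :=
    ((hf.contDiffAt (hΩ.mem_nhds haΩ)).differentiableAt (by simp)).hasFDerivAt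
  -- the derivative in charts is surjective
  have hsurj : Function.Surjective (fderiv ℝ f a) := by
    have h1 : MDifferentiableAt (𝓡 m) (𝓡 m) φ x :=
      (contMDiffOn_chart.contMDiffAt (φ.open_source.mem_nhds hx)).mdifferentiableAt
        (n := ∞) (by simp)
    have h2 : HasMFDerivAt (𝓡 m) (𝓡 k) (f ∘ φ) x
        ((fderiv ℝ f a).comp (mfderiv (𝓡 m) (𝓡 m) φ x : Euc m →L[ℝ] Euc m)) :=
      HasMFDerivAt.comp x hfa.hasMFDerivAt h1.hasMFDerivAt
    have h3 : MDifferentiableAt (𝓡 k) (𝓡 k) ψ (π x) :=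
      (contMDiffOn_chart.contMDiffAt (ψ.open_source.mem_nhds hπx)).mdifferentiableAt
        (n := ∞) (by simp)
    have h4 : HasMFDerivAt (𝓡 m) (𝓡 k) (ψ ∘ π) x
        ((mfderiv (𝓡 k) (𝓡 k) ψ (π x) : Euc k →L[ℝ] Euc k).comp
          (mfderiv (𝓡 m) (𝓡 k) π x : Euc m →L[ℝ] Euc k)) :=
      HasMFDerivAt.comp x h3.hasMFDerivAt
        ((h.contMDiff x).mdifferentiableAt (by simp)).hasMFDerivAt
    have h5 : f ∘ φ =ᶠ[𝓝 x] ψ ∘ π := by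
      filter_upwards [φ.open_source.mem_nhds hx] with y hy
      simp [f, φ.left_inv hy]
    have h6 := hasMFDerivAt_unique (h4.congr_of_eventuallyEq h5) h2
    have h7 : Function.Surjective ((mfderiv (𝓡 k) (𝓡 k) ψ (π x) : Euc k →L[ℝ] Euc k).comp
          (mfderiv (𝓡 m) (𝓡 k) π x : Euc m →L[ℝ] Euc k)) := by
      have h8 := (mdifferentiable_chart (I := 𝓡 k) (π x)).mfderiv_surjective hπx
      exact h8.comp (h.submersion x)
    have h8 : Function.Surjective
        ((fderiv ℝ f a).comp (mfderiv (𝓡 m) (𝓡 m) φ x : Euc m →L[ℝ] Euc m)) := h6 ▸ h7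
    exact Function.Surjective.of_comp (g := (mfderiv (𝓡 m) (𝓡 m) φ x : Euc m →L[ℝ] Euc m)) h8
  obtain ⟨R, hR⟩ := (fderiv ℝ f a).exists_rightInverse_of_surjective (LinearMap.range_eq_top.2 hsurj)
  let l : Euc k → Euc m := fun y => a + R y
  have hl : ContDiff ℝ ∞ l := by fun_prop
  have hl0 : l 0 = a := by simp [l]
  have hΩl : IsOpen (l ⁻¹' Ω) := hΩ.preimage hl.continuous
  have hfl : ContDiffOn ℝ ∞ (f ∘ l) (l ⁻¹' Ω) := hf.comp hl.contDiffOn fun y hy => hy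
  have h0 : (0 : Euc k) ∈ l ⁻¹' Ω := by rwa [mem_preimage, hl0]
  have hd : HasFDerivAt (f ∘ l) ((ContinuousLinearEquiv.refl ℝ (Euc k) : Euc k →L[ℝ] Euc k)) 0 := by
    have h1 : HasFDerivAt l R 0 := R.hasFDerivAt.const_add a
    have h2 : HasFDerivAt f (fderiv ℝ f a) (l 0) := by rwa [hl0]
    have h3 := h2.comp (0 : Euc k) h1
    rw [hR] at h3
    exact h3
  obtain ⟨G, hG0, hGΩ, hGf, hGs⟩ := exists_openPartialHomeomorph_of_contDiffOn hΩl hfl h0 _ hd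
  refine ⟨ψ.source ∩ ψ ⁻¹' G.target, φ.symm ∘ l ∘ G.symm ∘ ψ,
    ψ.isOpen_inter_preimage G.open_target, ⟨hπx, ?_⟩, ?_, ?_, ?_⟩
  · have h1 := G.map_source hG0
    rw [hGf] at h1
    simpa [f, hl0, hax] using h1
  · refine hφs.comp (hl.contMDiff.comp_contMDiffOn
      (hGs.contMDiffOn.comp (hψc.mono inter_subset_left) fun q hq => hq.2)) fun q hq => ?_
    exact (hGΩ (G.map_target hq.2)).1
  · have h1 := G.left_inv hG0
    rw [hGf] at h1
    have h2 : (f ∘ l) 0 = ψ (π x) := by simp [f, hl0, hax]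
    rw [h2] at h1
    simp [h1, hl0, hax]
  · intro q hq
    have h1 := hGΩ (G.map_target hq.2)
    have h2 := G.right_inv hq.2
    rw [hGf] at h2
    exact ψ.injOn h1.2 hq.1 h2

end Sections

section Opens

variable {m : ℕ} {M : Type*} [TopologicalSpace M] [ChartedSpace (Euc m) M]

/-- The inclusion of an open subset has a local right inverse. -/
theorem mfderiv_subtype_val_surjective (U : Opens M) (x : U) :
    Function.Surjective (mfderiv (𝓡 m) (𝓡 m) (Subtype.val : U → M) x) := by
  classical
  let g : M → U := fun y => if hy : y ∈ U then ⟨y, hy⟩ else x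
  have hval : (Subtype.val ∘ g) =ᶠ[𝓝 (x : M)] id := by
    filter_upwards [U.isOpen.mem_nhds x.2] with y hy
    have hy' : y ∈ U := hy
    simp [g, hy']
  have hg : ContMDiffAt (𝓡 m) (𝓡 m) ∞ g x :=
    (ContMDiffAt.subtypeVal_comp_iff U g x).1 (contMDiffAt_id.congr_of_eventuallyEq hval)
  have hgx : g x = x := by simp [g]
  have h1 : MDifferentiableAt (𝓡 m) (𝓡 m) (Subtype.val : U → M) (g x) :=
    (contMDiff_subtype_val (n := ∞) _).mdifferentiableAt (by simp)
  have h2 := (HasMFDerivAt.comp (x : M) h1.hasMFDerivAt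
    (hg.mdifferentiableAt (by simp)).hasMFDerivAt)
  have h3 := hasMFDerivAt_unique h2 ((hasMFDerivAt_id (x : M)).congr_of_eventuallyEq hval)
  have h4 : Function.Surjective (mfderiv (𝓡 m) (𝓡 m) (Subtype.val : U → M) (g x)) :=
    fun w => ⟨_, congrArg (fun T : Euc m →L[ℝ] Euc m => T w) h3⟩
  rwa [hgx] at h4

end Opens

section Embedded

variable {n : ℕ} {M : Type*} [TopologicalSpace M] [ChartedSpace (Euc (n + 1)) M]
  [IsManifold (𝓡 (n + 1)) ∞ M] {θ : Flow ℝ M} {U : Opens M}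

/-- The submanifolds of the orbit space cut out by invariant sets: the local equations, restricted
to a local section, stay regular since they are constant in the direction of the flow at the point
in question. -/
theorem isEmbeddedSubmanifold_orbitImage
    (hθ : ContMDiff (𝓘(ℝ, ℝ).prod (𝓡 (n + 1))) (𝓡 (n + 1)) ∞ (fun p : ℝ × M => θ p.1 p.2))
    {v : (x : M) → TangentSpace (𝓡 (n + 1)) x} (hv : ∀ x, IsMIntegralCurve (fun t => θ t x) v)
    (hv0 : ∀ x ∈ U, v x ≠ 0) (hU : ∀ t : ℝ, ∀ x ∈ U, θ t x ∈ U)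
    [ChartedSpace (Euc n) (OrbitSpace θ U)] (hπ : IsManifoldSubmersion (n + 1) n (orbitProj θ U))
    {S : Set M} (hS : ∀ t : ℝ, ∀ x ∈ S, θ t x ∈ S) {r : ℕ}
    (hloc : ∀ x ∈ S, x ∈ U → ∃ (V : Set M) (w : M → Euc r), IsOpen V ∧ x ∈ V ∧
      ContMDiffOn (𝓡 (n + 1)) (𝓡 r) ∞ w V ∧ S ∩ V = {y ∈ V | w y = 0} ∧
      Function.Surjective (mfderiv (𝓡 (n + 1)) (𝓡 r) w x) ∧
      mfderiv (𝓡 (n + 1)) (𝓡 r) w x (v x) = (0 : Euc r)) :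
    IsEmbeddedSubmanifold n r (orbitImage θ U S) := by
  rintro _ ⟨x, hxS, rfl⟩
  have := hπ.isManifold
  obtain ⟨V, w, hVo, hxV, hw, hSV, hsurj, hwv⟩ := hloc x hxS x.2
  obtain ⟨W, s, hWo, hxW, hs, hsx, hπs⟩ := hπ.exists_section x
  set p := orbitProj θ U x with hp
  have hsv : ContMDiffOn (𝓡 n) (𝓡 (n + 1)) ∞ (Subtype.val ∘ s) W :=
    contMDiff_subtype_val.comp_contMDiffOn hs
  set f : OrbitSpace θ U → Euc r := w ∘ Subtype.val ∘ s with hf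
  set W₁ : Set (OrbitSpace θ U) := W ∩ (Subtype.val ∘ s) ⁻¹' V with hW₁
  have hW₁o : IsOpen W₁ := hsv.continuousOn.isOpen_inter_preimage hWo hVo
  have hfW₁ : ContMDiffOn (𝓡 n) (𝓡 r) ∞ f W₁ :=
    hw.comp (hsv.mono inter_subset_left) fun q hq => hq.2
  have hpW₁ : p ∈ W₁ := ⟨hxW, by
    change ((s p : U) : M) ∈ V
    rw [hsx]
    exact hxV⟩
  -- the derivative at `p` is surjective
  have hfp : Function.Surjective (mfderiv (𝓡 n) (𝓡 r) f p) := by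
    have hds : HasMFDerivAt (𝓡 n) (𝓡 (n + 1)) s p (mfderiv (𝓡 n) (𝓡 (n + 1)) s p) :=
      ((hs.contMDiffAt (hWo.mem_nhds hxW)).mdifferentiableAt (by simp)).hasMFDerivAt
    have hdw : MDifferentiableAt (𝓡 (n + 1)) (𝓡 r) w x :=
      (hw.contMDiffAt (hVo.mem_nhds hxV)).mdifferentiableAt (by simp)
    have hdval : MDifferentiableAt (𝓡 (n + 1)) (𝓡 (n + 1)) (Subtype.val : U → M) x :=
      (contMDiff_subtype_val (n := ∞) _).mdifferentiableAt (by simp)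
    have hdπ : MDifferentiableAt (𝓡 (n + 1)) (𝓡 n) (orbitProj θ U) x :=
      (hπ.contMDiff x).mdifferentiableAt (by simp)
    -- the orbit of `x`, whose velocity spans the kernel of the derivative of the projection
    let γ : ℝ → U := fun t => ⟨θ t x, hU t x x.2⟩
    have hγ0 : γ 0 = x := Subtype.ext (θ.map_zero_apply _)
    have hγ : ContMDiff 𝓘(ℝ, ℝ) (𝓡 (n + 1)) ∞ γ := by
      refine (ContMDiff.subtypeVal_comp_iff U γ).1 ?_
      exact hθ.comp (contMDiff_id.prodMk contMDiff_const)
    have hdγ : HasMFDerivAt 𝓘(ℝ, ℝ) (𝓡 (n + 1)) γ 0 (mfderiv 𝓘(ℝ, ℝ) (𝓡 (n + 1)) γ 0) :=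
      ((hγ 0).mdifferentiableAt (by simp)).hasMFDerivAt
    let A : Euc (n + 1) →L[ℝ] Euc r := mfderiv (𝓡 (n + 1)) (𝓡 r) w x
    let B : Euc (n + 1) →L[ℝ] Euc (n + 1) :=
      mfderiv (𝓡 (n + 1)) (𝓡 (n + 1)) (Subtype.val : U → M) x
    let C : Euc n →L[ℝ] Euc (n + 1) := mfderiv (𝓡 n) (𝓡 (n + 1)) s p
    let p' : Euc (n + 1) →L[ℝ] Euc n := mfderiv (𝓡 (n + 1)) (𝓡 n) (orbitProj θ U) x
    let g : Euc (n + 1) := mfderiv 𝓘(ℝ, ℝ) (𝓡 (n + 1)) γ 0 (1 : ℝ)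
    -- `s p`, `γ 0` and `x` are equal, but not definitionally so: the derivatives at `x` have to be
    -- transported
    have hf' : HasMFDerivAt (𝓡 n) (𝓡 r) f p ((A.comp B).comp C) := by
      have h1 : HasMFDerivAt (𝓡 (n + 1)) (𝓡 r) (w ∘ Subtype.val) x (A.comp B) :=
        HasMFDerivAt.comp x hdw.hasMFDerivAt hdval.hasMFDerivAt
      have h2 : ∀ z, z = x → HasMFDerivAt (𝓡 (n + 1)) (𝓡 r) (w ∘ Subtype.val) z (A.comp B) := by
        rintro z rfl
        exact h1
      exact HasMFDerivAt.comp p (g := w ∘ Subtype.val) (f := s) (h2 _ hsx) hds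
    have hpC : ∀ y, p' (C y) = y := by
      have h2 : ∀ z, z = x → HasMFDerivAt (𝓡 (n + 1)) (𝓡 n) (orbitProj θ U) z p' := by
        rintro z rfl
        exact hdπ.hasMFDerivAt
      have h3 : orbitProj θ U ∘ s =ᶠ[𝓝 p] id := by
        filter_upwards [hWo.mem_nhds hxW] with q hq
        exact hπs q hq
      have h4 := hasMFDerivAt_unique (HasMFDerivAt.comp p (h2 _ hsx) hds)
        ((hasMFDerivAt_id p).congr_of_eventuallyEq h3)
      exact fun y => congrArg (fun T : Euc n →L[ℝ] Euc n => T y) h4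
    have hpg : p' g = 0 := by
      have h2 : ∀ z, z = x → HasMFDerivAt (𝓡 (n + 1)) (𝓡 n) (orbitProj θ U) z p' := by
        rintro z rfl
        exact hdπ.hasMFDerivAt
      have h3 : orbitProj θ U ∘ γ = fun _ => p := by
        funext t
        exact orbitProj_flow t rfl
      have h4 := HasMFDerivAt.comp (0 : ℝ) (h2 _ hγ0) hdγ
      rw [h3] at h4
      have h5 := hasMFDerivAt_unique h4 (hasMFDerivAt_const p (0 : ℝ))
      exact congrArg (fun T : ℝ →L[ℝ] Euc n => T 1) h5
    have hBg : B g = (v x : Euc (n + 1)) := by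
      have h2 : ∀ z, z = x → HasMFDerivAt (𝓡 (n + 1)) (𝓡 (n + 1)) (Subtype.val : U → M) z B := by
        rintro z rfl
        exact hdval.hasMFDerivAt
      have h4 := HasMFDerivAt.comp (0 : ℝ) (h2 _ hγ0) hdγ
      have h5 := hasMFDerivAt_unique h4 (hv x 0)
      have h6 := congrArg (fun T : ℝ →L[ℝ] Euc (n + 1) => T 1) h5
      have h7 : ∀ z : M, z = x → ((1 : ℝ) • (v z : Euc (n + 1))) = (v x : Euc (n + 1)) := by
        rintro z rfl
        exact one_smul ℝ (v x : Euc (n + 1))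
      exact h6.trans (h7 _ (θ.map_zero_apply _))
    have hg0 : g ≠ 0 := by
      intro h
      rw [h, map_zero] at hBg
      exact hv0 x x.2 hBg.symm
    have hAB : Function.Surjective (A.comp B) :=
      Function.Surjective.comp (g := A) (f := B) hsurj (mfderiv_subtype_val_surjective U x)
    have hABg : (A.comp B) g = 0 := by
      have h1 : A (B g) = 0 := by
        rw [hBg]
        exact hwv
      exact h1
    have h := surjective_comp_section (by simp) (p := (p' : Euc (n + 1) →ₗ[ℝ] Euc n))
      (s := (C : Euc n →ₗ[ℝ] Euc (n + 1))) hpC hg0 hpg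
      (A := (A.comp B : Euc (n + 1) →ₗ[ℝ] Euc r)) hAB hABg
    rw [hf'.mfderiv]
    exact h
  -- and therefore near `p`
  set ψ := chartAt (Euc n) p with hψ
  have hpψ : p ∈ ψ.source := mem_chart_source _ p
  have hψs : ContMDiffOn (𝓡 n) (𝓡 n) ∞ ψ.symm ψ.target := contMDiffOn_chart_symm
  have hψc : ContMDiffOn (𝓡 n) (𝓡 n) ∞ ψ ψ.source := contMDiffOn_chart
  let Ω : Set (Euc n) := ψ.target ∩ ψ.symm ⁻¹' W₁
  have hΩo : IsOpen Ω := ψ.isOpen_inter_preimage_symm hW₁o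
  have hfΩ : ContDiffOn ℝ ∞ (f ∘ ψ.symm) Ω :=
    (hfW₁.comp (hψs.mono inter_subset_left) fun y hy => hy.2).contDiffOn
  have hΩd : ∀ y ∈ Ω, HasFDerivAt (f ∘ ψ.symm) (fderiv ℝ (f ∘ ψ.symm) y) y := fun y hy =>
    ((hfΩ.contDiffAt (hΩo.mem_nhds hy)).differentiableAt (by simp)).hasFDerivAt
  have hψΩ : ∀ q ∈ ψ.source ∩ W₁, ψ q ∈ Ω := by
    intro q hq
    refine ⟨ψ.map_source hq.1, ?_⟩
    rw [mem_preimage, ψ.left_inv hq.1]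
    exact hq.2
  have hchain : ∀ q ∈ ψ.source ∩ W₁, HasMFDerivAt (𝓡 n) (𝓡 r) f q
      ((fderiv ℝ (f ∘ ψ.symm) (ψ q)).comp (mfderiv (𝓡 n) (𝓡 n) ψ q : Euc n →L[ℝ] Euc n)) := by
    intro q hq
    have h1 : MDifferentiableAt (𝓡 n) (𝓡 n) ψ q :=
      (hψc.contMDiffAt (ψ.open_source.mem_nhds hq.1)).mdifferentiableAt (by simp)
    have h2 : HasMFDerivAt (𝓡 n) (𝓡 r) ((f ∘ ψ.symm) ∘ ψ) q _ :=
      HasMFDerivAt.comp q (hΩd _ (hψΩ q hq)).hasMFDerivAt h1.hasMFDerivAt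
    refine h2.congr_of_eventuallyEq ?_
    filter_upwards [ψ.open_source.mem_nhds hq.1] with y hy
    simp [ψ.left_inv hy]
  have hsurj1 : Function.Surjective (fderiv ℝ (f ∘ ψ.symm) (ψ p)) := by
    have h1 := (hchain p ⟨hpψ, hpW₁⟩).mfderiv
    rw [h1] at hfp
    exact Function.Surjective.of_comp (g := (mfderiv (𝓡 n) (𝓡 n) ψ p : Euc n →L[ℝ] Euc n)) hfp
  have hev : ∀ᶠ y in 𝓝 (ψ p), Function.Surjective (fderiv ℝ (f ∘ ψ.symm) y) := by
    have h1 : ContinuousAt (fderiv ℝ (f ∘ ψ.symm)) (ψ p) :=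
      (hfΩ.continuousOn_fderiv_of_isOpen hΩo (by simp)).continuousAt
        (hΩo.mem_nhds (hψΩ p ⟨hpψ, hpW₁⟩))
    exact h1.eventually (ContinuousLinearMap.eventually_surjective hsurj1)
  obtain ⟨Ω', hΩ', hΩ'o, hpΩ'⟩ := eventually_nhds_iff.1 hev
  refine ⟨(ψ.source ∩ ψ ⁻¹' Ω') ∩ W₁, f, (ψ.isOpen_inter_preimage hΩ'o).inter hW₁o,
    ⟨⟨hpψ, hpΩ'⟩, hpW₁⟩, hfW₁.mono inter_subset_right, ?_, ?_⟩
  · intro q hq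
    rw [(hchain q ⟨hq.1.1, hq.2⟩).mfderiv]
    have h1 := hΩ' _ hq.1.2
    exact h1.comp ((mdifferentiable_chart (I := 𝓡 n) p).mfderiv_surjective hq.1.1)
  · ext q
    have key : q ∈ W₁ → (q ∈ orbitImage θ U S ↔ f q = 0) := by
      intro hq
      have h1 : ((s q : U) : M) ∈ S ↔ f q = 0 := by
        have h2 := Set.ext_iff.1 hSV ((s q : U) : M)
        constructor
        · exact fun h => (h2.1 ⟨h, hq.2⟩).2
        · exact fun h => (h2.2 ⟨hq.2, h⟩).1
      rw [← h1]
      constructor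
      · rintro ⟨y, hyS, hyq⟩
        rw [← hπs q hq.1] at hyq
        obtain ⟨t, ht⟩ := orbitProj_eq_iff.1 hyq
        rw [← ht]
        exact hS t _ hyS
      · exact fun h => ⟨s q, h, hπs q hq.1⟩
    constructor
    · exact fun h => ⟨h.2, (key h.2.2).1 h.1⟩
    · exact fun h => ⟨(key h.1.2).2 h.2, h.1⟩

end Embedded

section Inclusion

variable {n : ℕ} {M : Type*} [TopologicalSpace M] [ChartedSpace (Euc (n + 1)) M]
  [IsManifold (𝓡 (n + 1)) ∞ M] {θ : Flow ℝ M} {U V : Opens M}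

theorem orbitInclusion_injective (h : U ≤ V) : Function.Injective (orbitInclusion θ h) := by
  intro p q
  induction p using Quotient.inductionOn with | h x => ?_
  induction q using Quotient.inductionOn with | h y => ?_
  intro hxy
  obtain ⟨t, ht⟩ := orbitProj_eq_iff.1
    (show orbitProj θ V ⟨x.1, h x.2⟩ = orbitProj θ V ⟨y.1, h y.2⟩ from hxy)
  exact orbitProj_eq_iff.2 ⟨t, ht⟩

theorem range_orbitInclusion (h : U ≤ V) : range (orbitInclusion θ h) = orbitImage θ V U := by
  ext q
  constructor
  · rintro ⟨p, rfl⟩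
    induction p using Quotient.inductionOn with | h x => ?_
    exact ⟨⟨x.1, h x.2⟩, x.2, rfl⟩
  · rintro ⟨x, hx, rfl⟩
    exact ⟨orbitProj θ U ⟨x, hx⟩, rfl⟩

theorem isOpen_orbitImage (hV : ∀ t : ℝ, ∀ x ∈ V, θ t x ∈ V) {S : Set M} (hS : IsOpen S) :
    IsOpen (orbitImage θ V S) :=
  (isOpenQuotientMap_orbitProj hV).isOpenMap _ (hS.preimage continuous_subtype_val)

/-- Both orbit maps being submersions, the induced map of the orbit spaces is smooth in both
directions, by local sections. -/
theorem isLocalDiffeomorph_orbitInclusion (h : U ≤ V) (hV : ∀ t : ℝ, ∀ x ∈ V, θ t x ∈ V)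
    [ChartedSpace (Euc n) (OrbitSpace θ U)] [ChartedSpace (Euc n) (OrbitSpace θ V)]
    (hπU : IsManifoldSubmersion (n + 1) n (orbitProj θ U))
    (hπV : IsManifoldSubmersion (n + 1) n (orbitProj θ V)) :
    IsLocalDiffeomorph (𝓡 n) (𝓡 n) ∞ (orbitInclusion θ h) := by
  classical
  intro p
  have : Nonempty (OrbitSpace θ U) := ⟨p⟩
  let j : OrbitSpace θ U → OrbitSpace θ V := orbitInclusion θ h
  have hinj : InjOn j univ := (orbitInclusion_injective h).injOn
  have hro : IsOpen (j '' univ) := by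
    rw [image_univ, range_orbitInclusion h]
    exact isOpen_orbitImage hV U.isOpen
  let k := Function.invFunOn j univ
  have hkj : ∀ p, k (j p) = p := fun p => hinj.leftInvOn_invFunOn (mem_univ p)
  have hj : ContMDiff (𝓡 n) (𝓡 n) ∞ j := by
    intro p
    obtain ⟨x, rfl⟩ := Quotient.mk_surjective p
    obtain ⟨W, s, hWo, hxW, hs, hsx, hπs⟩ := hπU.exists_section x
    have h1 : ContMDiffOn (𝓡 n) (𝓡 n) ∞ (orbitProj θ V ∘ Opens.inclusion h ∘ s) W :=
      hπV.contMDiff.comp_contMDiffOn ((contMDiff_inclusion h).comp_contMDiffOn hs)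
    refine (h1.contMDiffAt (hWo.mem_nhds hxW)).congr_of_eventuallyEq ?_
    filter_upwards [hWo.mem_nhds hxW] with q hq
    conv_lhs => rw [← hπs q hq]
    rfl
  have hk : ContMDiffOn (𝓡 n) (𝓡 n) ∞ k (j '' univ) := by
    rintro _ ⟨p, -, rfl⟩
    obtain ⟨x, rfl⟩ := Quotient.mk_surjective p
    let x' : V := ⟨x, h x.2⟩
    obtain ⟨W, s, hWo, hxW, hs, hsx, hπs⟩ := hπV.exists_section x'
    have hsv : ContMDiffOn (𝓡 n) (𝓡 (n + 1)) ∞ (Subtype.val ∘ s) W :=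
      contMDiff_subtype_val.comp_contMDiffOn hs
    have hW₁o := hsv.continuousOn.isOpen_inter_preimage hWo U.isOpen
    set W₁ := W ∩ (Subtype.val ∘ s) ⁻¹' (U : Set M)
    have hx₁ : j (Quotient.mk _ x) ∈ W₁ := ⟨hxW, by
      change ((s (orbitProj θ V x') : V) : M) ∈ (U : Set M)
      rw [hsx]
      exact x.2⟩
    let r : OrbitSpace θ V → U := fun q => if hq : (s q : M) ∈ U then ⟨s q, hq⟩ else x
    have hr : ∀ q ∈ W₁, (r q : M) = s q := by
      intro q hq
      have h1 : (s q : M) ∈ U := hq.2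
      simp [r, h1]
    have hrs : ContMDiffOn (𝓡 n) (𝓡 (n + 1)) ∞ r W₁ := by
      intro q hq
      refine (ContMDiffWithinAt.subtypeVal_comp_iff U r W₁ q).1 ?_
      exact ((hsv.mono inter_subset_left).congr hr) q hq
    have h1 : ContMDiffOn (𝓡 n) (𝓡 n) ∞ (orbitProj θ U ∘ r) W₁ :=
      hπU.contMDiff.comp_contMDiffOn hrs
    refine ((h1.contMDiffAt (hW₁o.mem_nhds hx₁)).congr_of_eventuallyEq ?_).contMDiffWithinAt
    filter_upwards [hW₁o.mem_nhds hx₁] with q hq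
    have h2 : j (orbitProj θ U (r q)) = q := by
      have h3 : (⟨(r q : M), h (r q).2⟩ : V) = s q := Subtype.ext (hr q hq)
      have h4 := hπs q hq.1
      rw [← h3] at h4
      exact h4
    conv_lhs => rw [← h2]
    exact hkj _
  let Φ : PartialDiffeomorph (𝓡 n) (𝓡 n) (OrbitSpace θ U) (OrbitSpace θ V) ∞ :=
    { toPartialEquiv := hinj.toPartialEquiv j univ
      open_source := isOpen_univ
      open_target := hro
      contMDiffOn_toFun := hj.contMDiffOn
      contMDiffOn_invFun := hk }
  exact ⟨Φ, mem_univ p, fun _ _ => rfl⟩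

end Inclusion

/-! ### Coordinate frames and Christoffel symbols -/

section MatrixCalculus

variable {ι : Type*} [Fintype ι] [DecidableEq ι]

theorem contMDiffOn_det {m : ℕ} {M : Type*} [TopologicalSpace M] [ChartedSpace (Euc m) M]
    {A : M → Matrix ι ι ℝ} {s : Set M}
    (hA : ∀ i j, ContMDiffOn (𝓡 m) 𝓘(ℝ, ℝ) ∞ (fun x => A x i j) s) :
    ContMDiffOn (𝓡 m) 𝓘(ℝ, ℝ) ∞ (fun x => (A x).det) s := by
  simp only [Matrix.det_apply']
  exact contMDiffOn_finsetSum fun σ _ =>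
    contMDiffOn_const.mul (contMDiffOn_finsetProd fun i _ => hA _ _)

theorem contMDiffOn_matrix_inv_apply {m : ℕ} {M : Type*} [TopologicalSpace M]
    [ChartedSpace (Euc m) M] {A : M → Matrix ι ι ℝ} {s : Set M}
    (hA : ∀ i j, ContMDiffOn (𝓡 m) 𝓘(ℝ, ℝ) ∞ (fun x => A x i j) s)
    (hd : ∀ x ∈ s, (A x).det ≠ 0) (i j : ι) :
    ContMDiffOn (𝓡 m) 𝓘(ℝ, ℝ) ∞ (fun x => (A x)⁻¹ i j) s := by
  have h1 : ContMDiffOn (𝓡 m) 𝓘(ℝ, ℝ) ∞ (fun x => (A x).adjugate i j) s := by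
    simp only [Matrix.adjugate_apply]
    refine contMDiffOn_det fun k l => ?_
    by_cases hk : k = j
    · subst hk
      simp only [Matrix.updateRow_self]
      exact contMDiffOn_const
    · simp only [Matrix.updateRow_ne hk]
      exact hA k l
  have h2 := ((contMDiffOn_det hA).inv₀ hd).mul h1
  refine h2.congr fun x hx => ?_
  rw [Matrix.inv_def, Ring.inverse_eq_inv']
  rfl

omit [DecidableEq ι] in
theorem hasDerivAt_mulVec_dotProduct {Φ : ℝ → Matrix ι ι ℝ} {Φ' : Matrix ι ι ℝ} {v w : ℝ → ι → ℝ}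
    {v' w' : ι → ℝ} {t : ℝ} (hΦ : ∀ i j, HasDerivAt (fun s => Φ s i j) (Φ' i j) t)
    (hv : ∀ i, HasDerivAt (fun s => v s i) (v' i) t)
    (hw : ∀ i, HasDerivAt (fun s => w s i) (w' i) t) :
    HasDerivAt (fun s => v s ⬝ᵥ (Φ s).mulVec (w s))
      (v' ⬝ᵥ (Φ t).mulVec (w t) + v t ⬝ᵥ Φ'.mulVec (w t) + v t ⬝ᵥ (Φ t).mulVec w') t := by
  have h : HasDerivAt (fun s => ∑ i, v s i * ∑ j, Φ s i j * w s j) _ t :=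
    HasDerivAt.fun_sum fun i _ => (hv i).mul (HasDerivAt.fun_sum fun j _ => (hΦ i j).mul (hw j))
  refine h.congr_deriv ?_
  simp only [dotProduct, Matrix.mulVec, ← Finset.sum_add_distrib]
  refine Finset.sum_congr rfl fun i _ => ?_
  simp only [Finset.sum_add_distrib]
  ring

/-- The derivative of the inverse of a matrix `H` that is parallel for the connection matrix `A`:
the inverse is parallel for the dual connection. -/
theorem deriv_inv_of_parallel {H Φ : ℝ → Matrix ι ι ℝ} {H' Φ' A : Matrix ι ι ℝ} {t : ℝ}
    (hH : ∀ i j, HasDerivAt (fun s => H s i j) (H' i j) t)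
    (hΦ : ∀ i j, HasDerivAt (fun s => Φ s i j) (Φ' i j) t) (hinv : ∀ᶠ s in 𝓝 t, H s * Φ s = 1)
    (hpar : H' + A * H t + H t * A.transpose = 0) :
    Φ' = Φ t * A + A.transpose * Φ t := by
  have h1 : H' * Φ t + H t * Φ' = 0 := by
    ext i j
    have h2 : HasDerivAt (fun s => ∑ k, H s i k * Φ s k j)
        (∑ k, (H' i k * Φ t k j + H t i k * Φ' k j)) t :=
      HasDerivAt.fun_sum fun k _ => (hH i k).mul (hΦ k j)
    have h3 : (fun s => ∑ k, H s i k * Φ s k j) =ᶠ[𝓝 t] fun _ => (1 : Matrix ι ι ℝ) i j := by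
      filter_upwards [hinv] with s hs
      rw [← hs, Matrix.mul_apply]
    have h4 := h2.unique ((hasDerivAt_const t ((1 : Matrix ι ι ℝ) i j)).congr_of_eventuallyEq h3)
    rw [Matrix.add_apply, Matrix.mul_apply, Matrix.mul_apply, ← Finset.sum_add_distrib]
    exact h4
  have h2 : H t * Φ t = 1 := hinv.self_of_nhds
  have h3 : Φ t * H t = 1 := mul_eq_one_comm.1 h2
  have h4 : H' = -(A * H t + H t * A.transpose) := by
    rw [add_assoc] at hpar
    exact eq_neg_of_add_eq_zero_left hpar
  have h5 : Φ' = -(Φ t * H' * Φ t) := by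
    have h6 := congrArg (fun B => Φ t * B) h1
    simp only [mul_add, mul_zero, ← mul_assoc, h3, one_mul] at h6
    exact eq_neg_of_add_eq_zero_right h6
  rw [h5, h4, mul_neg, neg_mul, neg_neg, mul_add, add_mul]
  congr 1
  · rw [← mul_assoc, mul_assoc (Φ t * A), h2, mul_one]
  · rw [← mul_assoc, h3, one_mul]

end MatrixCalculus

section Coordinates

variable {n : ℕ} {M : Type*} [TopologicalSpace M] [ChartedSpace (Euc (n + 1)) M]
  [IsManifold (𝓡 (n + 1)) ∞ M] {φ : OpenPartialHomeomorph M (Euc (n + 1))}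

theorem mfderiv_isInvertible_of_mem_atlas (hφ : φ ∈ atlas (Euc (n + 1)) M) {x : M}
    (hx : x ∈ φ.source) : (mfderiv (𝓡 (n + 1)) (𝓡 (n + 1)) φ x).IsInvertible :=
  ⟨(mdifferentiable_of_mem_atlas (I := 𝓡 (n + 1)) hφ).mfderiv hx, rfl⟩

theorem mfderiv_coordField (hφ : φ ∈ atlas (Euc (n + 1)) M) {x : M} (hx : x ∈ φ.source)
    (j : Fin (n + 1)) :
    mfderiv (𝓡 (n + 1)) (𝓡 (n + 1)) φ x (coordField φ j x) = EuclideanSpace.single j (1 : ℝ) :=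
  congrArg (fun T : Euc (n + 1) →L[ℝ] Euc (n + 1) => T (EuclideanSpace.single j (1 : ℝ)))
    (mfderiv_isInvertible_of_mem_atlas hφ hx).self_comp_inverse

theorem coordFrame_linearIndependent (hφ : φ ∈ atlas (Euc (n + 1)) M) {x : M} (hx : x ∈ φ.source) :
    LinearIndependent ℝ (coordFrame φ x) := by
  let A : Euc (n + 1) →L[ℝ] Euc (n + 1) := mfderiv (𝓡 (n + 1)) (𝓡 (n + 1)) φ x
  refine LinearIndependent.of_comp (M := Euc (n + 1)) (A : Euc (n + 1) →ₗ[ℝ] Euc (n + 1)) ?_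
  have h : (fun j => A (coordField φ j x)) = fun j => (EuclideanSpace.single j (1 : ℝ) : Euc (n + 1)) :=
    funext fun j => mfderiv_coordField hφ hx j
  change LinearIndependent ℝ (fun j => A (coordField φ j x))
  rw [h]
  exact stdFrame_linearIndependent x

theorem contMDiffOn_coordField (hφ : φ ∈ atlas (Euc (n + 1)) M) (j : Fin (n + 1)) :
    ContMDiffOn (𝓡 (n + 1)) (𝓡 (n + 1)).tangent ∞
      (fun x => (⟨x, coordField φ j x⟩ : TangentBundle (𝓡 (n + 1)) M)) φ.source := by
  intro x hx
  have hφx : ContMDiffAt (𝓡 (n + 1)) (𝓡 (n + 1)) ∞ φ x :=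
    (contMDiffOn_of_mem_maximalAtlas (IsManifold.subset_maximalAtlas hφ)).contMDiffAt
      (φ.open_source.mem_nhds hx)
  have h1 := (contMDiff_vectorSpace_iff_contDiff (𝕜 := ℝ) (n := ∞)
    (V := fun _ : Euc (n + 1) => (EuclideanSpace.single j (1 : ℝ) : Euc (n + 1)))).2 contDiff_const
  exact (ContMDiffAt.mpullback_vectorField_preimage (h1 (φ x)) hφx
    (mfderiv_isInvertible_of_mem_atlas hφ hx) (by simp)).contMDiffWithinAt

theorem mfderiv_symm_single (hφ : φ ∈ atlas (Euc (n + 1)) M) {x : M} (hx : x ∈ φ.source)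
    (i : Fin (n + 1)) :
    mfderiv (𝓡 (n + 1)) (𝓡 (n + 1)) φ.symm (φ x) (EuclideanSpace.single i (1 : ℝ) : Euc (n + 1)) =
      coordField φ i x := by
  have h := congrArg (fun T : Euc (n + 1) →L[ℝ] Euc (n + 1) => T (coordField φ i x))
    ((mdifferentiable_of_mem_atlas (I := 𝓡 (n + 1)) hφ).symm_comp_deriv hx)
  have h2 := congrArg (mfderiv (𝓡 (n + 1)) (𝓡 (n + 1)) φ.symm (φ x) :
    Euc (n + 1) → Euc (n + 1)) (mfderiv_coordField hφ hx i)
  exact h2.symm.trans h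

theorem exists_hasFDerivAt_comp_symm (hφ : φ ∈ atlas (Euc (n + 1)) M) {x : M} (hx : x ∈ φ.source)
    {f : M → ℝ} (hf : MDifferentiableAt (𝓡 (n + 1)) 𝓘(ℝ, ℝ) f x) :
    ∃ T : Euc (n + 1) →L[ℝ] ℝ, HasFDerivAt (f ∘ φ.symm) T (φ x) ∧
      ∀ i, T (EuclideanSpace.single i (1 : ℝ)) = partialDeriv φ i f x := by
  have h1 := (mdifferentiable_of_mem_atlas (I := 𝓡 (n + 1)) hφ).mdifferentiableAt_symm
    (φ.map_source hx)
  have h2 : ∀ z, z = x → HasMFDerivAt (𝓡 (n + 1)) 𝓘(ℝ, ℝ) f z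
      (mfderiv (𝓡 (n + 1)) 𝓘(ℝ, ℝ) f x : Euc (n + 1) →L[ℝ] ℝ) := by
    rintro z rfl
    exact hf.hasMFDerivAt
  refine ⟨(mfderiv (𝓡 (n + 1)) 𝓘(ℝ, ℝ) f x : Euc (n + 1) →L[ℝ] ℝ).comp
    (mfderiv (𝓡 (n + 1)) (𝓡 (n + 1)) φ.symm (φ x) : Euc (n + 1) →L[ℝ] Euc (n + 1)),
    hasMFDerivAt_iff_hasFDerivAt.1
      (HasMFDerivAt.comp (φ x) (h2 _ (φ.left_inv hx)) h1.hasMFDerivAt), fun i => ?_⟩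
  exact congrArg (mfderiv (𝓡 (n + 1)) 𝓘(ℝ, ℝ) f x : Euc (n + 1) → ℝ)
    (mfderiv_symm_single hφ hx i)

theorem partialDeriv_eq_fderiv (hφ : φ ∈ atlas (Euc (n + 1)) M) {x : M} (hx : x ∈ φ.source)
    {f : M → ℝ} (hf : MDifferentiableAt (𝓡 (n + 1)) 𝓘(ℝ, ℝ) f x) (i : Fin (n + 1)) :
    partialDeriv φ i f x =
      fderiv ℝ (f ∘ φ.symm) (φ x) (EuclideanSpace.single i (1 : ℝ)) := by
  obtain ⟨T, hT, h⟩ := exists_hasFDerivAt_comp_symm hφ hx hf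
  rw [hT.fderiv, h]

/-- The partial derivative is the derivative along the coordinate line. -/
theorem hasDerivAt_comp_coordLine (hφ : φ ∈ atlas (Euc (n + 1)) M) {x : M} (hx : x ∈ φ.source)
    {f : M → ℝ} (hf : MDifferentiableAt (𝓡 (n + 1)) 𝓘(ℝ, ℝ) f x) (i : Fin (n + 1)) :
    HasDerivAt (fun t : ℝ => f (φ.symm (φ x + t • EuclideanSpace.single i (1 : ℝ))))
      (partialDeriv φ i f x) 0 := by
  rw [partialDeriv_eq_fderiv hφ hx hf]
  have h1 : HasDerivAt (fun t : ℝ => φ x + t • (EuclideanSpace.single i (1 : ℝ) : Euc (n + 1)))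
      (EuclideanSpace.single i (1 : ℝ)) 0 := by
    simpa using ((hasDerivAt_id (0 : ℝ)).smul_const
      (EuclideanSpace.single i (1 : ℝ) : Euc (n + 1))).const_add (φ x)
  have h2 : HasFDerivAt (f ∘ φ.symm) (fderiv ℝ (f ∘ φ.symm) (φ x))
      (φ x + (0 : ℝ) • (EuclideanSpace.single i (1 : ℝ) : Euc (n + 1))) := by
    rw [zero_smul, add_zero]
    obtain ⟨T, hT, -⟩ := exists_hasFDerivAt_comp_symm hφ hx hf
    exact hT.differentiableAt.hasFDerivAt
  exact h2.comp_hasDerivAt (0 : ℝ) h1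

omit [ChartedSpace (Euc (n + 1)) M] [IsManifold (𝓡 (n + 1)) ∞ M] in
theorem tendsto_coordLine {x : M} (hx : x ∈ φ.source) (i : Fin (n + 1)) :
    Filter.Tendsto (fun t : ℝ => φ.symm (φ x + t • EuclideanSpace.single i (1 : ℝ))) (𝓝 0) (𝓝 x) := by
  have h1 : ContinuousAt (fun t : ℝ => φ.symm (φ x + t • EuclideanSpace.single i (1 : ℝ))) 0 := by
    refine ContinuousAt.comp (g := φ.symm) ?_ (by fun_prop)
    rw [zero_smul, add_zero]
    exact φ.continuousAt_symm (φ.map_source hx)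
  have h2 : φ.symm (φ x + (0 : ℝ) • EuclideanSpace.single i (1 : ℝ)) = x := by
    rw [zero_smul, add_zero, φ.left_inv hx]
  rw [ContinuousAt, h2] at h1
  exact h1

omit [IsManifold (𝓡 (n + 1)) ∞ M] in
theorem mfderiv_coordFrame_sum (f : M → ℝ) (x : M) (b : Fin (n + 1) → ℝ) :
    mfderiv (𝓡 (n + 1)) 𝓘(ℝ, ℝ) f x (∑ a, b a • coordFrame φ x a) =
      ∑ a, b a * partialDeriv φ a f x := by
  have h := map_sum (mfderiv (𝓡 (n + 1)) 𝓘(ℝ, ℝ) f x : Euc (n + 1) →L[ℝ] ℝ)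
    (fun a => b a • (coordFrame φ x a : Euc (n + 1))) Finset.univ
  refine h.trans (Finset.sum_congr rfl fun a _ => ?_)
  exact map_smul (mfderiv (𝓡 (n + 1)) 𝓘(ℝ, ℝ) f x : Euc (n + 1) →L[ℝ] ℝ) (b a) _

theorem continuousOn_partialDeriv (hφ : φ ∈ atlas (Euc (n + 1)) M) {f : M → ℝ}
    (hf : ContMDiffOn (𝓡 (n + 1)) 𝓘(ℝ, ℝ) ∞ f φ.source) (i : Fin (n + 1)) :
    ContinuousOn (partialDeriv φ i f) φ.source := by
  have h1 : ContDiffOn ℝ ∞ (f ∘ φ.symm) φ.target :=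
    (hf.comp (contMDiffOn_symm_of_mem_maximalAtlas (IsManifold.subset_maximalAtlas hφ))
      fun y hy => φ.map_target hy).contDiffOn
  have h2 := (h1.continuousOn_fderiv_of_isOpen φ.open_target (by simp)).comp φ.continuousOn
    fun x hx => φ.map_source hx
  refine (h2.clm_apply (continuousOn_const (c := EuclideanSpace.single i (1 : ℝ)))).congr
    fun x hx => ?_
  exact partialDeriv_eq_fderiv hφ hx
    ((hf.contMDiffAt (φ.open_source.mem_nhds hx)).mdifferentiableAt (by simp)) i

/-- Smoothness of a connection is a statement about global vector fields, so the coordinate fields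
are multiplied by a bump function, which does not change them near the point in question. -/
theorem continuousAt_christoffel [T2Space M] (D : TorsionFreeConnection n M) (x₀ : M)
    (k i j : Fin (n + 1)) :
    ContinuousAt (christoffel D (chartAt (Euc (n + 1)) x₀) k i j) x₀ := by
  set φ := chartAt (Euc (n + 1)) x₀ with hφ
  have hφa : φ ∈ atlas (Euc (n + 1)) M := chart_mem_atlas _ x₀
  have hx₀ : x₀ ∈ φ.source := mem_chart_source _ x₀
  obtain ⟨b⟩ : Nonempty (SmoothBumpFunction (𝓡 (n + 1)) x₀) := inferInstance
  let Y : (x : M) → TangentSpace (𝓡 (n + 1)) x := (b : M → ℝ) • coordField φ j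
  have hY : ContMDiff (𝓡 (n + 1)) (𝓡 (n + 1)).tangent ∞
      (fun x => (⟨x, Y x⟩ : TangentBundle (𝓡 (n + 1)) M)) :=
    ContMDiffOn.smul_section_of_tsupport (u := φ.source) b.contMDiff.contMDiffOn φ.open_source
      b.tsupport_subset_chartAt_source (contMDiffOn_coordField hφa j)
  have h1 := D.smooth.contMDiff.contMDiff (σ := Y) hY.contMDiffOn
  have h2 := h1.mono (subset_univ φ.source) |>.clm_bundle_apply (contMDiffOn_coordField hφa i)
  have h3 := contMDiffOn_mfderiv_chartAt_apply x₀ h2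
  have h4 : ContinuousAt (fun x =>
      let w : Euc (n + 1) := mfderiv (𝓡 (n + 1)) (𝓡 (n + 1)) φ x (D.cov Y x (coordField φ i x))
      w k) x₀ := by
    have h5 : Continuous fun y : Euc (n + 1) => y k := by fun_prop
    exact h5.continuousAt.comp (h3.continuousOn.continuousAt (φ.open_source.mem_nhds hx₀))
  refine h4.congr ?_
  filter_upwards [b.eventuallyEq_one.eventually_nhds, φ.open_source.mem_nhds hx₀] with x hx hxs
  have h6 : D.cov Y x = D.cov (coordField φ j) x := by
    refine D.cov.isCovariantDerivativeOnUniv.congr_of_eventuallyEq ?_ ?_ Filter.univ_mem ?_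
    · exact hY.mdifferentiableAt (by simp)
    · exact ((contMDiffOn_coordField hφa j).contMDiffAt
        (φ.open_source.mem_nhds hxs)).mdifferentiableAt (by simp)
    · filter_upwards [hx] with y hy
      have h7 : b y = 1 := hy
      change b y • coordField φ j y = _
      rw [h7, one_smul]
  have h8 : christoffel D φ k i j x =
      let w : Euc (n + 1) := mfderiv (𝓡 (n + 1)) (𝓡 (n + 1)) φ x
        (D.cov (coordField φ j) x (coordField φ i x))
      w k := rfl
  rw [h8, ← h6]

end Coordinates

/-! ### Densities and the derivatives of `σ` and `λ` -/

section Densities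

variable {n : ℕ} {M : Type*} [TopologicalSpace M] [ChartedSpace (Euc (n + 1)) M] {w : ℝ}
  {s : Density n M w} {x : M} {u : Fin (n + 1) → TangentSpace (𝓡 (n + 1)) x}

theorem Density.exists_pos_mul (s : Density n M w)
    {u u' : Fin (n + 1) → TangentSpace (𝓡 (n + 1)) x}
    (hu : LinearIndependent ℝ u) (hu' : LinearIndependent ℝ u') :
    ∃ r : ℝ, 0 < r ∧ s.toFun x u' = r * s.toFun x u := by
  obtain ⟨A, hA, rfl⟩ := exists_frameMul_eq hu hu'
  exact ⟨_, Real.rpow_pos_of_pos (abs_pos.2 hA) _, s.frame_change x u hu A hA⟩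

theorem Density.zeroAt_iff (hu : LinearIndependent ℝ u) : s.ZeroAt x ↔ s.toFun x u = 0 := by
  refine ⟨fun h => h u hu, fun h u' hu' => ?_⟩
  obtain ⟨r, -, hr⟩ := s.exists_pos_mul hu hu'
  rw [hr, h, mul_zero]

theorem Density.posAt_iff (hu : LinearIndependent ℝ u) : s.PosAt x ↔ 0 < s.toFun x u := by
  refine ⟨fun h => h u hu, fun h u' hu' => ?_⟩
  obtain ⟨r, hr0, hr⟩ := s.exists_pos_mul hu hu'
  rw [hr]
  positivity

theorem Density.negAt_iff (hu : LinearIndependent ℝ u) : s.NegAt x ↔ s.toFun x u < 0 := by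
  refine ⟨fun h => h u hu, fun h u' hu' => ?_⟩
  obtain ⟨r, hr0, hr⟩ := s.exists_pos_mul hu hu'
  rw [hr]
  exact mul_neg_of_pos_of_neg hr0 h

theorem Density.toFun_ne_zero (hs : ¬ s.ZeroAt x) (hu : LinearIndependent ℝ u) :
    s.toFun x u ≠ 0 := fun h => hs ((Density.zeroAt_iff hu).2 h)

end Densities

section Ratios

variable {n : ℕ} {M : Type*} [TopologicalSpace M] [ChartedSpace (Euc (n + 1)) M]
  [IsManifold (𝓡 (n + 1)) ∞ M] {c : ProjectiveStructure n M}

/-- The function `σ / ν`, a quotient of densities of weight `1`; its values do not depend on the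
frame (`sigmaRatio_eq`). -/
noncomputable def sigmaRatio (H : TractorBitensor c) (I : TractorField c) (ν : Density n M 1)
    (x : M) : ℝ :=
  (sigmaDensity H I).toFun x (stdFrame x) / ν.toFun x (stdFrame x)

/-- The function `λ / ν²`, a quotient of densities of weight `2`; its values do not depend on the
frame (`lambdaRatio_eq`). -/
noncomputable def lambdaRatio (H : TractorBitensor c) (ν : Density n M 1) (x : M) : ℝ :=
  (lambdaDensity H).toFun x (stdFrame x) / ν.toFun x (stdFrame x) ^ 2

variable (H : TractorBitensor c) (I : TractorField c) (ν : Density n M 1)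

theorem sigmaRatio_eq {x : M} {u : Fin (n + 1) → TangentSpace (𝓡 (n + 1)) x}
    (hu : LinearIndependent ℝ u) :
    sigmaRatio H I ν x = (sigmaDensity H I).toFun x u / ν.toFun x u := by
  have hs : LinearIndependent ℝ (stdFrame x : Fin (n + 1) → TangentSpace (𝓡 (n + 1)) x) :=
    stdFrame_linearIndependent x
  obtain ⟨A, hA, rfl⟩ := exists_frameMul_eq hs hu
  have h : |A.det| ^ (-(1 : ℝ) / (n + 2)) ≠ 0 := (Real.rpow_pos_of_pos (abs_pos.2 hA) _).ne'
  rw [(sigmaDensity H I).frame_change x _ hs A hA, ν.frame_change x _ hs A hA,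
    mul_div_mul_left _ _ h]
  rfl

theorem lambdaRatio_eq {x : M} {u : Fin (n + 1) → TangentSpace (𝓡 (n + 1)) x}
    (hu : LinearIndependent ℝ u) :
    lambdaRatio H ν x = (lambdaDensity H).toFun x u / ν.toFun x u ^ 2 := by
  have hs : LinearIndependent ℝ (stdFrame x : Fin (n + 1) → TangentSpace (𝓡 (n + 1)) x) :=
    stdFrame_linearIndependent x
  obtain ⟨A, hA, rfl⟩ := exists_frameMul_eq hs hu
  have h : |A.det| ^ (-(1 : ℝ) / (n + 2)) ≠ 0 := (Real.rpow_pos_of_pos (abs_pos.2 hA) _).ne'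
  have h2 : |A.det| ^ (-(2 : ℝ) / (n + 2)) = (|A.det| ^ (-(1 : ℝ) / (n + 2))) ^ 2 := by
    rw [sq, ← Real.rpow_add (abs_pos.2 hA)]
    congr 1
    ring
  rw [(lambdaDensity H).frame_change x _ hs A hA, ν.frame_change x _ hs A hA, mul_pow, h2,
    mul_div_mul_left _ _ (pow_ne_zero 2 h)]
  rfl

variable {H I ν}

theorem sigma_zeroAt_iff (hν : ∀ x, ¬ ν.ZeroAt x) {x : M} :
    (sigmaDensity H I).ZeroAt x ↔ sigmaRatio H I ν x = 0 := by
  have hs : LinearIndependent ℝ (stdFrame x : Fin (n + 1) → TangentSpace (𝓡 (n + 1)) x) :=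
    stdFrame_linearIndependent x
  have h := Density.toFun_ne_zero (hν x) hs
  rw [Density.zeroAt_iff hs, sigmaRatio, div_eq_zero_iff, or_iff_left h]

theorem lambda_zeroAt_iff (hν : ∀ x, ¬ ν.ZeroAt x) {x : M} :
    (lambdaDensity H).ZeroAt x ↔ lambdaRatio H ν x = 0 := by
  have hs : LinearIndependent ℝ (stdFrame x : Fin (n + 1) → TangentSpace (𝓡 (n + 1)) x) :=
    stdFrame_linearIndependent x
  have h := Density.toFun_ne_zero (hν x) hs
  rw [Density.zeroAt_iff hs, lambdaRatio, div_eq_zero_iff, or_iff_left (pow_ne_zero 2 h)]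

theorem lambda_posAt_iff (hν : ∀ x, ¬ ν.ZeroAt x) {x : M} :
    (lambdaDensity H).PosAt x ↔ 0 < lambdaRatio H ν x := by
  have hs : LinearIndependent ℝ (stdFrame x : Fin (n + 1) → TangentSpace (𝓡 (n + 1)) x) :=
    stdFrame_linearIndependent x
  have h := Density.toFun_ne_zero (hν x) hs
  rw [Density.posAt_iff hs, lambdaRatio, div_pos_iff_of_pos_right (by positivity)]

theorem lambda_negAt_iff (hν : ∀ x, ¬ ν.ZeroAt x) {x : M} :
    (lambdaDensity H).NegAt x ↔ lambdaRatio H ν x < 0 := by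
  have hs : LinearIndependent ℝ (stdFrame x : Fin (n + 1) → TangentSpace (𝓡 (n + 1)) x) :=
    stdFrame_linearIndependent x
  have h := Density.toFun_ne_zero (hν x) hs
  rw [Density.negAt_iff hs, lambdaRatio, div_neg_iff]
  have h2 : 0 < ν.toFun x (stdFrame x) ^ 2 := by positivity
  constructor
  · exact fun h3 => Or.inr ⟨h3, h2⟩
  · rintro (h3 | h3)
    · exact absurd h3.2 (not_lt.2 h2.le)
    · exact h3.1

theorem scaledField_eq_zero_iff (hν : ∀ x, ¬ ν.ZeroAt x) {x : M}
    {u : Fin (n + 1) → TangentSpace (𝓡 (n + 1)) x} (hu : LinearIndependent ℝ u) :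
    scaledField ν I x = 0 ↔ I.vec x u = 0 := by
  rw [scaledField_apply ν I x u hu]
  constructor
  · intro h
    have h1 := Fintype.linearIndependent_iff.1 hu _ h
    funext a
    exact (mul_eq_zero.1 (h1 a)).resolve_left (Density.toFun_ne_zero (hν x) hu)
  · intro h
    simp [h]

theorem mem_zeroLocus_iff (hν : ∀ x, ¬ ν.ZeroAt x) {x : M} :
    x ∈ zeroLocus I ↔ scaledField ν I x = 0 := by
  have hs : LinearIndependent ℝ (stdFrame x : Fin (n + 1) → TangentSpace (𝓡 (n + 1)) x) :=
    stdFrame_linearIndependent x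
  constructor
  · exact fun h => (scaledField_eq_zero_iff hν hs).2 (h _ hs)
  · exact fun h u hu => (scaledField_eq_zero_iff hν hu).1 h

end Ratios

section Parallel

variable {n : ℕ} {M : Type*} [TopologicalSpace M] [ChartedSpace (Euc (n + 1)) M]
  [IsManifold (𝓡 (n + 1)) ∞ M] {c : ProjectiveStructure n M} {H : TractorBitensor c}
  {I : TractorField c} {ν : Density n M 1} {φ : OpenPartialHomeomorph M (Euc (n + 1))}

theorem TractorBitensor.IsSmooth.inv_apply (hH : H.IsSmooth) {q p : ℕ} (hsig : H.HasSignature q p)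
    (hφ : φ ∈ atlas (Euc (n + 1)) M) (A B : TIdx n) :
    ContMDiffOn (𝓡 (n + 1)) 𝓘(ℝ, ℝ) ∞ (fun x => (H.toFun c.rep x (coordFrame φ x))⁻¹ A B)
      φ.source :=
  contMDiffOn_matrix_inv_apply (hH c.rep φ hφ)
    (fun x hx => (hsig c.rep x _ (coordFrame_linearIndependent hφ hx)).2.1) A B

/-- The canonical tractor has weight `1`: its derivative is `W_i`, the `i`-th basis vector, up to the
term from the connection on densities. -/
theorem tractorConnection_mulVec_tractorX (D : TorsionFreeConnection n M) (i : Fin (n + 1))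
    (x : M) :
    (tractorConnection D φ i x).mulVec (tractorX n) =
      Pi.single (Sum.inl i) 1 - (christoffelTrace D φ i x / (n + 2)) • tractorX n := by
  ext (a | a)
  · simp [tractorConnection, tractorX, Matrix.mulVec, dotProduct, Pi.single_apply]
  · simp [tractorConnection, tractorX, Matrix.mulVec, dotProduct]

/-- The splitting `V = V^a W_a + ρ X` of a tractor. -/
theorem tractor_eq_sum (v : TIdx n → ℝ) :
    v = (∑ a, v (Sum.inl a) • Pi.single (Sum.inl a) 1) + v (Sum.inr ()) • tractorX n := by
  ext (a | a)
  · simp [tractorX, Finset.sum_apply, Pi.single_apply]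
  · simp [tractorX, Finset.sum_apply]

theorem pairing_comm {ι : Type*} [Fintype ι] [DecidableEq ι] {S : Matrix ι ι ℝ} (hS : S.IsSymm)
    (v w : ι → ℝ) : v ⬝ᵥ (S⁻¹).mulVec w = w ⬝ᵥ (S⁻¹).mulVec v := by
  have h : (S⁻¹).transpose = S⁻¹ := by rw [Matrix.transpose_nonsing_inv, hS]
  rw [Matrix.dotProduct_mulVec, ← Matrix.mulVec_transpose, h, dotProduct_comm]

/-- The Leibniz rule for the pairing with the parallel metric inverse to `H`. -/
theorem partialDeriv_pairing (hH : H.IsSmooth) {q p : ℕ} (hsig : H.HasSignature q p)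
    (hpar : H.IsParallel) (hφ : φ ∈ atlas (Euc (n + 1)) M) {x : M} (hx : x ∈ φ.source)
    {a b : M → TIdx n → ℝ} {i : Fin (n + 1)} {a' b' : TIdx n → ℝ}
    (ha : ∀ A, MDifferentiableAt (𝓡 (n + 1)) 𝓘(ℝ, ℝ) (fun y => a y A) x)
    (hb : ∀ A, MDifferentiableAt (𝓡 (n + 1)) 𝓘(ℝ, ℝ) (fun y => b y A) x)
    (hab : MDifferentiableAt (𝓡 (n + 1)) 𝓘(ℝ, ℝ)
      (fun y => a y ⬝ᵥ ((H.toFun c.rep y (coordFrame φ y))⁻¹).mulVec (b y)) x)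
    (ha' : ∀ A, partialDeriv φ i (fun y => a y A) x = a' A)
    (hb' : ∀ A, partialDeriv φ i (fun y => b y A) x = b' A) :
    partialDeriv φ i (fun y => a y ⬝ᵥ ((H.toFun c.rep y (coordFrame φ y))⁻¹).mulVec (b y)) x =
      (a' + (tractorConnection c.rep.1 φ i x).mulVec (a x)) ⬝ᵥ
          ((H.toFun c.rep x (coordFrame φ x))⁻¹).mulVec (b x) +
        a x ⬝ᵥ ((H.toFun c.rep x (coordFrame φ x))⁻¹).mulVec
          (b' + (tractorConnection c.rep.1 φ i x).mulVec (b x)) := by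
  set ℓ : ℝ → M := fun t => φ.symm (φ x + t • EuclideanSpace.single i (1 : ℝ)) with hℓ
  have hℓ0 : ℓ 0 = x := by simp [hℓ, φ.left_inv hx]
  have hmd : ∀ {f : M → ℝ}, ContMDiffOn (𝓡 (n + 1)) 𝓘(ℝ, ℝ) ∞ f φ.source →
      MDifferentiableAt (𝓡 (n + 1)) 𝓘(ℝ, ℝ) f x := fun hf =>
    (hf.contMDiffAt (φ.open_source.mem_nhds hx)).mdifferentiableAt (by simp)
  have h1 : ∀ A B, HasDerivAt (fun t => H.toFun c.rep (ℓ t) (coordFrame φ (ℓ t)) A B)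
      (partialDeriv φ i (fun y => H.toFun c.rep y (coordFrame φ y) A B) x) 0 := fun A B =>
    hasDerivAt_comp_coordLine hφ hx (f := fun y => H.toFun c.rep y (coordFrame φ y) A B)
      (hmd (hH c.rep φ hφ A B)) i
  have h2 : ∀ A B, HasDerivAt (fun t => (H.toFun c.rep (ℓ t) (coordFrame φ (ℓ t)))⁻¹ A B)
      (partialDeriv φ i (fun y => (H.toFun c.rep y (coordFrame φ y))⁻¹ A B) x) 0 := fun A B =>
    hasDerivAt_comp_coordLine hφ hx (f := fun y => (H.toFun c.rep y (coordFrame φ y))⁻¹ A B)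
      (hmd (hH.inv_apply hsig hφ A B)) i
  have h3 : ∀ᶠ t in 𝓝 (0 : ℝ), H.toFun c.rep (ℓ t) (coordFrame φ (ℓ t)) *
      (H.toFun c.rep (ℓ t) (coordFrame φ (ℓ t)))⁻¹ = 1 := by
    filter_upwards [(tendsto_coordLine hx i).eventually (φ.open_source.mem_nhds hx)] with t ht
    exact Matrix.mul_nonsing_inv _
      (IsUnit.mk0 _ (hsig c.rep _ _ (coordFrame_linearIndependent hφ ht)).2.1)
  have h4 := deriv_inv_of_parallel (A := tractorConnection c.rep.1 φ i x)
    (H' := Matrix.of fun A B => partialDeriv φ i (fun y => H.toFun c.rep y (coordFrame φ y) A B) x)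
    (Φ' := Matrix.of fun A B =>
      partialDeriv φ i (fun y => (H.toFun c.rep y (coordFrame φ y))⁻¹ A B) x) h1 h2 h3 (by
      rw [hℓ0]
      ext A B
      exact hpar c.rep φ hφ x hx i A B)
  have h5 := hasDerivAt_mulVec_dotProduct (Φ' := Matrix.of fun A B =>
      partialDeriv φ i (fun y => (H.toFun c.rep y (coordFrame φ y))⁻¹ A B) x) h2
    (fun A => (hasDerivAt_comp_coordLine hφ hx (ha A) i).congr_deriv (ha' A))
    (fun A => (hasDerivAt_comp_coordLine hφ hx (hb A) i).congr_deriv (hb' A))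
  have h6 := (hasDerivAt_comp_coordLine hφ hx hab i).unique h5
  rw [h6, h4]
  change a' ⬝ᵥ ((H.toFun c.rep (ℓ 0) (coordFrame φ (ℓ 0)))⁻¹).mulVec (b (ℓ 0)) +
    a (ℓ 0) ⬝ᵥ Matrix.mulVec _ (b (ℓ 0)) + a (ℓ 0) ⬝ᵥ ((H.toFun c.rep (ℓ 0) (coordFrame φ (ℓ 0)))⁻¹).mulVec b' = _
  rw [hℓ0, Matrix.add_mulVec, ← Matrix.mulVec_mulVec, ← Matrix.mulVec_mulVec,
    dotProduct_add, Matrix.dotProduct_mulVec (a x) (Matrix.transpose _), Matrix.vecMul_transpose,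
    add_dotProduct, Matrix.mulVec_add, dotProduct_add]
  ring

omit [IsManifold (𝓡 (n + 1)) ∞ M] in
theorem partialDeriv_const (r : ℝ) (i : Fin (n + 1)) (x : M) :
    partialDeriv φ i (fun _ => r) x = 0 := by
  have h := mfderiv_const (I := 𝓡 (n + 1)) (I' := 𝓘(ℝ, ℝ)) (c := r) (x := x)
  exact congrArg (fun T : Euc (n + 1) →L[ℝ] ℝ => T (coordField φ i x)) h

theorem contMDiffOn_sigma (hH : H.IsSmooth) {q p : ℕ} (hsig : H.HasSignature q p)
    (hI : I.IsSmooth) (hφ : φ ∈ atlas (Euc (n + 1)) M) :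
    ContMDiffOn (𝓡 (n + 1)) 𝓘(ℝ, ℝ) ∞ (fun x => (sigmaDensity H I).toFun x (coordFrame φ x))
      φ.source := by
  simp only [sigmaDensity, dotProduct, Matrix.mulVec]
  exact contMDiffOn_finsetSum fun A _ => (hI c.rep φ hφ A).mul
    (contMDiffOn_finsetSum fun B _ => (hH.inv_apply hsig hφ A B).mul contMDiffOn_const)

theorem contMDiffOn_lambda (hH : H.IsSmooth) {q p : ℕ} (hsig : H.HasSignature q p)
    (hφ : φ ∈ atlas (Euc (n + 1)) M) :
    ContMDiffOn (𝓡 (n + 1)) 𝓘(ℝ, ℝ) ∞ (fun x => (lambdaDensity H).toFun x (coordFrame φ x))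
      φ.source := by
  simp only [lambdaDensity, dotProduct, Matrix.mulVec]
  exact contMDiffOn_finsetSum fun A _ => contMDiffOn_const.mul
    (contMDiffOn_finsetSum fun B _ => (hH.inv_apply hsig hφ A B).mul contMDiffOn_const)

/-- The equation `∇_i σ = Φ_{AB} I^A W_i^B` in coordinates. -/
theorem partialDeriv_sigma (hH : H.IsSmooth) {q p : ℕ} (hsig : H.HasSignature q p)
    (hHpar : H.IsParallel) (hI : I.IsSmooth) (hIpar : I.IsParallel)
    (hφ : φ ∈ atlas (Euc (n + 1)) M) {x : M} (hx : x ∈ φ.source) (i : Fin (n + 1)) :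
    partialDeriv φ i (fun y => (sigmaDensity H I).toFun y (coordFrame φ y)) x =
      I.toFun c.rep x (coordFrame φ x) ⬝ᵥ
          ((H.toFun c.rep x (coordFrame φ x))⁻¹).mulVec (Pi.single (Sum.inl i) 1) -
        christoffelTrace c.rep.1 φ i x / (n + 2) *
          (sigmaDensity H I).toFun x (coordFrame φ x) := by
  have hmd : ∀ {f : M → ℝ}, ContMDiffOn (𝓡 (n + 1)) 𝓘(ℝ, ℝ) ∞ f φ.source →
      MDifferentiableAt (𝓡 (n + 1)) 𝓘(ℝ, ℝ) f x := fun hf =>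
    (hf.contMDiffAt (φ.open_source.mem_nhds hx)).mdifferentiableAt (by simp)
  have h1 := partialDeriv_pairing (i := i) hH hsig hHpar hφ hx
    (a := fun y => I.toFun c.rep y (coordFrame φ y)) (b := fun _ => tractorX n)
    (fun A => hmd (hI c.rep φ hφ A)) (fun A => mdifferentiableAt_const)
    (hmd (contMDiffOn_sigma hH hsig hI hφ))
    (fun A => rfl) (b' := 0) (fun A => partialDeriv_const _ _ _)
  have h2 : ((fun A => partialDeriv φ i (fun y => I.toFun c.rep y (coordFrame φ y) A) x) +
      (tractorConnection c.rep.1 φ i x).mulVec (I.toFun c.rep x (coordFrame φ x))) = 0 :=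
    funext fun A => hIpar c.rep φ hφ x hx i A
  refine h1.trans ?_
  simp only [h2, zero_dotProduct, zero_add, tractorConnection_mulVec_tractorX, Matrix.mulVec_sub,
    Matrix.mulVec_smul, dotProduct_sub, dotProduct_smul, smul_eq_mul]
  rfl

/-- The equation `∇_i λ = 2 Φ_{AB} X^A W_i^B` in coordinates. -/
theorem partialDeriv_lambda (hH : H.IsSmooth) {q p : ℕ} (hsig : H.HasSignature q p)
    (hHpar : H.IsParallel) (hφ : φ ∈ atlas (Euc (n + 1)) M) {x : M} (hx : x ∈ φ.source)
    (i : Fin (n + 1)) :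
    partialDeriv φ i (fun y => (lambdaDensity H).toFun y (coordFrame φ y)) x =
      2 * (tractorX n ⬝ᵥ
          ((H.toFun c.rep x (coordFrame φ x))⁻¹).mulVec (Pi.single (Sum.inl i) 1)) -
        2 * (christoffelTrace c.rep.1 φ i x / (n + 2)) *
          (lambdaDensity H).toFun x (coordFrame φ x) := by
  have h1 := partialDeriv_pairing (i := i) hH hsig hHpar hφ hx
    (a := fun _ => tractorX n) (b := fun _ => tractorX n)
    (fun A => mdifferentiableAt_const) (fun A => mdifferentiableAt_const)
    (((contMDiffOn_lambda hH hsig hφ).contMDiffAt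
      (φ.open_source.mem_nhds hx)).mdifferentiableAt (by simp))
    (a' := 0) (fun A => partialDeriv_const _ _ _) (b' := 0) (fun A => partialDeriv_const _ _ _)
  have hl : (lambdaDensity H).toFun x (coordFrame φ x) = tractorX n ⬝ᵥ
      ((H.toFun c.rep x (coordFrame φ x))⁻¹).mulVec (tractorX n) := rfl
  refine h1.trans ?_
  rw [zero_add, pairing_comm (hsig c.rep x _ (coordFrame_linearIndependent hφ hx)).1,
    tractorConnection_mulVec_tractorX, Matrix.mulVec_sub, Matrix.mulVec_smul, dotProduct_sub,
    dotProduct_smul, smul_eq_mul, hl]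
  ring

/-- The quotient rule, in the form needed for the ratios `σ / ν` and `λ / ν²`. -/
theorem partialDeriv_div_pow (hφ : φ ∈ atlas (Euc (n + 1)) M) {x : M} (hx : x ∈ φ.source)
    {r f g : M → ℝ} (k : ℕ) (hr : ∀ y ∈ φ.source, r y = f y / g y ^ k)
    (hf : ContMDiffOn (𝓡 (n + 1)) 𝓘(ℝ, ℝ) ∞ f φ.source)
    (hg : ContMDiffOn (𝓡 (n + 1)) 𝓘(ℝ, ℝ) ∞ g φ.source) (hg0 : ∀ y ∈ φ.source, g y ≠ 0)
    (i : Fin (n + 1)) :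
    partialDeriv φ i r x = partialDeriv φ i f x / g x ^ k -
      k * (f x / g x ^ (k + 1)) * partialDeriv φ i g x := by
  have hmd : ∀ {f : M → ℝ}, ContMDiffOn (𝓡 (n + 1)) 𝓘(ℝ, ℝ) ∞ f φ.source →
      MDifferentiableAt (𝓡 (n + 1)) 𝓘(ℝ, ℝ) f x := fun hf =>
    (hf.contMDiffAt (φ.open_source.mem_nhds hx)).mdifferentiableAt (by simp)
  have hr' : ContMDiffOn (𝓡 (n + 1)) 𝓘(ℝ, ℝ) ∞ r φ.source := by
    have h := hf.mul ((hg.pow k).inv₀ fun y hy => pow_ne_zero k (hg0 y hy))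
    exact h.congr fun y hy => hr y hy
  set ℓ : ℝ → M := fun t => φ.symm (φ x + t • EuclideanSpace.single i (1 : ℝ)) with hℓ
  have hℓ0 : ℓ 0 = x := by simp [hℓ, φ.left_inv hx]
  have h1 : HasDerivAt (fun t => f (ℓ t)) _ 0 := hasDerivAt_comp_coordLine hφ hx (hmd hf) i
  have h2 : HasDerivAt (fun t => g (ℓ t)) _ 0 := hasDerivAt_comp_coordLine hφ hx (hmd hg) i
  have h3 : HasDerivAt (fun t => r (ℓ t)) _ 0 := hasDerivAt_comp_coordLine hφ hx (hmd hr') i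
  have hgx := hg0 x hx
  have h4 := h1.fun_div (h2.fun_pow k) (by rw [hℓ0]; exact pow_ne_zero k hgx)
  have h5 : (fun t => r (ℓ t)) =ᶠ[𝓝 0] fun t => f (ℓ t) / g (ℓ t) ^ k := by
    filter_upwards [(tendsto_coordLine hx i).eventually (φ.open_source.mem_nhds hx)] with t ht
    exact hr _ ht
  rw [h3.unique (h4.congr_of_eventuallyEq h5), hℓ0]
  rcases k with _ | k
  · simp
  · simp only [Nat.add_sub_cancel]
    field_simp
    ring

end Parallel

/-! ### Null parallel tractors -/

section NullParallel

variable {n : ℕ} {M : Type*} [TopologicalSpace M] [ChartedSpace (Euc (n + 1)) M]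
  [IsManifold (𝓡 (n + 1)) ∞ M] {c : ProjectiveStructure n M}

/-- Smooth data: a parallel nondegenerate symmetric bitensor `H` (the inverse of a tractor metric) with
`q` minus and `p` plus signs, a parallel null tractor `I` without zeros and a density `ν` of weight
`1` without zeros. -/
structure IsNullParallel (q p : ℕ) (H : TractorBitensor c) (I : TractorField c)
    (ν : Density n M 1) : Prop where
  smooth_bitensor : H.IsSmooth
  signature : H.HasSignature q p
  parallel_bitensor : H.IsParallel
  smooth_tractor : I.IsSmooth
  nowhereZero : I.NowhereZero
  null : H.IsNull I
  parallel_tractor : I.IsParallel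
  smooth_density : ν.IsSmooth
  density_ne_zero : ∀ x, ¬ ν.ZeroAt x

namespace IsNullParallel

variable {q p : ℕ} {H : TractorBitensor c} {I : TractorField c} {ν : Density n M 1}
  {φ : OpenPartialHomeomorph M (Euc (n + 1))} {x : M}

theorem density_coordFrame_ne_zero (h : IsNullParallel q p H I ν)
    (hφ : φ ∈ atlas (Euc (n + 1)) M) : ∀ x ∈ φ.source, ν.toFun x (coordFrame φ x) ≠ 0 :=
  fun x hx => Density.toFun_ne_zero (h.density_ne_zero x) (coordFrame_linearIndependent hφ hx)

theorem contMDiff_sigmaRatio (h : IsNullParallel q p H I ν) :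
    ContMDiff (𝓡 (n + 1)) 𝓘(ℝ, ℝ) ∞ (sigmaRatio H I ν) := by
  intro x
  have hφ := chart_mem_atlas (Euc (n + 1)) x
  have h1 := (contMDiffOn_sigma h.smooth_bitensor h.signature h.smooth_tractor hφ).div₀
    (h.smooth_density _ hφ) (h.density_coordFrame_ne_zero hφ)
  exact (h1.congr fun y hy => sigmaRatio_eq H I ν (coordFrame_linearIndependent hφ hy)).contMDiffAt
    ((chartAt (Euc (n + 1)) x).open_source.mem_nhds (mem_chart_source _ x))

theorem contMDiff_lambdaRatio (h : IsNullParallel q p H I ν) :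
    ContMDiff (𝓡 (n + 1)) 𝓘(ℝ, ℝ) ∞ (lambdaRatio H ν) := by
  intro x
  have hφ := chart_mem_atlas (Euc (n + 1)) x
  have h1 := (contMDiffOn_lambda h.smooth_bitensor h.signature hφ).div₀
    ((h.smooth_density _ hφ).pow 2)
    fun y hy => pow_ne_zero 2 (h.density_coordFrame_ne_zero hφ y hy)
  exact (h1.congr fun y hy => lambdaRatio_eq H ν (coordFrame_linearIndependent hφ hy)).contMDiffAt
    ((chartAt (Euc (n + 1)) x).open_source.mem_nhds (mem_chart_source _ x))

theorem contMDiff_scaledField (h : IsNullParallel q p H I ν) :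
    ContMDiff (𝓡 (n + 1)) (𝓡 (n + 1)).tangent ∞
      (fun x => (⟨x, scaledField ν I x⟩ : TangentBundle (𝓡 (n + 1)) M)) := by
  intro x
  set φ := chartAt (Euc (n + 1)) x
  have hφ : φ ∈ atlas (Euc (n + 1)) M := chart_mem_atlas (Euc (n + 1)) x
  have h1 : ContMDiffOn (𝓡 (n + 1)) (𝓡 (n + 1)).tangent ∞ (fun y =>
      (⟨y, ∑ a, (ν.toFun y (coordFrame φ y) * I.vec y (coordFrame φ y) a) • coordField φ a y⟩ :
        TangentBundle (𝓡 (n + 1)) M)) φ.source :=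
    ContMDiffOn.sum_section fun a _ => ((h.smooth_density φ hφ).mul
      (h.smooth_tractor c.rep φ hφ (Sum.inl a))).smul_section (contMDiffOn_coordField hφ a)
  refine (h1.congr fun y hy => ?_).contMDiffAt (φ.open_source.mem_nhds (mem_chart_source _ x))
  rw [scaledField_apply ν I y _ (coordFrame_linearIndependent hφ hy)]
  rfl

theorem partialDeriv_sigmaRatio (h : IsNullParallel q p H I ν) (hφ : φ ∈ atlas (Euc (n + 1)) M)
    (hx : x ∈ φ.source) (i : Fin (n + 1)) :
    partialDeriv φ i (sigmaRatio H I ν) x =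
      (I.toFun c.rep x (coordFrame φ x) ⬝ᵥ
        ((H.toFun c.rep x (coordFrame φ x))⁻¹).mulVec (Pi.single (Sum.inl i) 1)) /
          ν.toFun x (coordFrame φ x) -
      (christoffelTrace c.rep.1 φ i x / (n + 2) +
        partialDeriv φ i (fun y => ν.toFun y (coordFrame φ y)) x / ν.toFun x (coordFrame φ x)) *
          sigmaRatio H I ν x := by
  have h0 := h.density_coordFrame_ne_zero hφ x hx
  rw [partialDeriv_div_pow hφ hx 1 (fun y hy => by
      rw [pow_one]; exact sigmaRatio_eq H I ν (coordFrame_linearIndependent hφ hy))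
    (contMDiffOn_sigma h.smooth_bitensor h.signature h.smooth_tractor hφ)
    (h.smooth_density _ hφ) (h.density_coordFrame_ne_zero hφ) i,
    partialDeriv_sigma h.smooth_bitensor h.signature h.parallel_bitensor h.smooth_tractor
      h.parallel_tractor hφ hx, sigmaRatio_eq H I ν (coordFrame_linearIndependent hφ hx)]
  field_simp
  push_cast
  ring

theorem partialDeriv_lambdaRatio (h : IsNullParallel q p H I ν) (hφ : φ ∈ atlas (Euc (n + 1)) M)
    (hx : x ∈ φ.source) (i : Fin (n + 1)) :
    partialDeriv φ i (lambdaRatio H ν) x =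
      2 * (tractorX n ⬝ᵥ
        ((H.toFun c.rep x (coordFrame φ x))⁻¹).mulVec (Pi.single (Sum.inl i) 1)) /
          ν.toFun x (coordFrame φ x) ^ 2 -
      2 * (christoffelTrace c.rep.1 φ i x / (n + 2) +
        partialDeriv φ i (fun y => ν.toFun y (coordFrame φ y)) x / ν.toFun x (coordFrame φ x)) *
          lambdaRatio H ν x := by
  have h0 := h.density_coordFrame_ne_zero hφ x hx
  rw [partialDeriv_div_pow hφ hx 2 (fun y hy =>
      lambdaRatio_eq H ν (coordFrame_linearIndependent hφ hy))
    (contMDiffOn_lambda h.smooth_bitensor h.signature hφ)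
    (h.smooth_density _ hφ) (h.density_coordFrame_ne_zero hφ) i,
    partialDeriv_lambda h.smooth_bitensor h.signature h.parallel_bitensor hφ hx,
    lambdaRatio_eq H ν (coordFrame_linearIndependent hφ hx)]
  field_simp
  push_cast
  ring

/-- The contraction of `Φ_{AB} v^A W_a^B` with `n^a`, by the splitting `I = n^a W_a + ρ X`. -/
theorem sum_vec_mul_pairing (v : TIdx n → ℝ) (x : M)
    (u : Fin (n + 1) → TangentSpace (𝓡 (n + 1)) x) :
    ∑ a, I.vec x u a * (v ⬝ᵥ ((H.toFun c.rep x u)⁻¹).mulVec (Pi.single (Sum.inl a) 1)) =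
      v ⬝ᵥ ((H.toFun c.rep x u)⁻¹).mulVec (I.toFun c.rep x u) -
        I.toFun c.rep x u (Sum.inr ()) *
          (v ⬝ᵥ ((H.toFun c.rep x u)⁻¹).mulVec (tractorX n)) := by
  conv_rhs => enter [1]; rw [tractor_eq_sum (I.toFun c.rep x u)]
  rw [Matrix.mulVec_add, dotProduct_add, Matrix.mulVec_smul, dotProduct_smul, Matrix.mulVec_sum,
    dotProduct_sum]
  simp only [Matrix.mulVec_smul, dotProduct_smul, smul_eq_mul]
  simp [TractorField.vec]

/-- The rate `g` with `N (σ / ν) = g σ / ν`, in the chart `φ`: minus the sum of `ν ρ`, with `ρ` the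
component of `I` along `X`, and the covariant derivative of `ν` in the direction `n`. -/
noncomputable def growth (I : TractorField c) (ν : Density n M 1)
    (φ : OpenPartialHomeomorph M (Euc (n + 1))) (x : M) : ℝ :=
  -(ν.toFun x (coordFrame φ x) * I.toFun c.rep x (coordFrame φ x) (Sum.inr ())) -
    ∑ a, I.vec x (coordFrame φ x) a * (ν.toFun x (coordFrame φ x) *
      (christoffelTrace c.rep.1 φ a x / (n + 2)) +
        partialDeriv φ a (fun y => ν.toFun y (coordFrame φ y)) x)

theorem mfderiv_scaledField_eq_sum (f : M → ℝ) (hφ : φ ∈ atlas (Euc (n + 1)) M)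
    (hx : x ∈ φ.source) :
    mfderiv (𝓡 (n + 1)) 𝓘(ℝ, ℝ) f x (scaledField ν I x) =
      ∑ a, ν.toFun x (coordFrame φ x) * I.vec x (coordFrame φ x) a * partialDeriv φ a f x := by
  rw [scaledField_apply ν I x _ (coordFrame_linearIndependent hφ hx)]
  exact mfderiv_coordFrame_sum f x _

theorem mfderiv_sigmaRatio_scaledField (h : IsNullParallel q p H I ν)
    (hφ : φ ∈ atlas (Euc (n + 1)) M) (hx : x ∈ φ.source) :
    mfderiv (𝓡 (n + 1)) 𝓘(ℝ, ℝ) (sigmaRatio H I ν) x (scaledField ν I x) =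
      (growth I ν φ x * sigmaRatio H I ν x : ℝ) := by
  have h0 := h.density_coordFrame_ne_zero hφ x hx
  have hu := coordFrame_linearIndependent hφ hx
  refine Eq.trans (α := ℝ) (mfderiv_scaledField_eq_sum _ hφ hx) ?_
  have h1 := sum_vec_mul_pairing (H := H) (I := I) (I.toFun c.rep x (coordFrame φ x)) x
    (coordFrame φ x)
  rw [h.null c.rep x _ hu, zero_sub] at h1
  have h2 : ∀ a, ν.toFun x (coordFrame φ x) * I.vec x (coordFrame φ x) a *
      partialDeriv φ a (sigmaRatio H I ν) x =
      I.vec x (coordFrame φ x) a * (I.toFun c.rep x (coordFrame φ x) ⬝ᵥ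
        ((H.toFun c.rep x (coordFrame φ x))⁻¹).mulVec (Pi.single (Sum.inl a) 1)) -
      I.vec x (coordFrame φ x) a * (ν.toFun x (coordFrame φ x) *
        (christoffelTrace c.rep.1 φ a x / (n + 2)) +
          partialDeriv φ a (fun y => ν.toFun y (coordFrame φ y)) x) * sigmaRatio H I ν x := by
    intro a
    rw [h.partialDeriv_sigmaRatio hφ hx]
    field_simp
  rw [Finset.sum_congr rfl fun a _ => h2 a, Finset.sum_sub_distrib, ← Finset.sum_mul, h1, growth,
    sub_mul]
  congr 1
  rw [sigmaRatio_eq H I ν hu]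
  change _ = -_ * ((I.toFun c.rep x (coordFrame φ x) ⬝ᵥ
    ((H.toFun c.rep x (coordFrame φ x))⁻¹).mulVec (tractorX n)) / _)
  field_simp

theorem mfderiv_lambdaRatio_scaledField (h : IsNullParallel q p H I ν)
    (hφ : φ ∈ atlas (Euc (n + 1)) M) (hx : x ∈ φ.source) :
    mfderiv (𝓡 (n + 1)) 𝓘(ℝ, ℝ) (lambdaRatio H ν) x (scaledField ν I x) =
      (2 * sigmaRatio H I ν x + 2 * growth I ν φ x * lambdaRatio H ν x : ℝ) := by
  have h0 := h.density_coordFrame_ne_zero hφ x hx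
  have hu := coordFrame_linearIndependent hφ hx
  refine Eq.trans (α := ℝ) (mfderiv_scaledField_eq_sum _ hφ hx) ?_
  have h1 := sum_vec_mul_pairing (H := H) (I := I) (tractorX n) x (coordFrame φ x)
  rw [pairing_comm (h.signature c.rep x _ hu).1 (tractorX n) (I.toFun c.rep x _)] at h1
  have h2 : ∀ a, ν.toFun x (coordFrame φ x) * I.vec x (coordFrame φ x) a *
      partialDeriv φ a (lambdaRatio H ν) x =
      2 / ν.toFun x (coordFrame φ x) * (I.vec x (coordFrame φ x) a * (tractorX n ⬝ᵥ
        ((H.toFun c.rep x (coordFrame φ x))⁻¹).mulVec (Pi.single (Sum.inl a) 1))) -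
      I.vec x (coordFrame φ x) a * (ν.toFun x (coordFrame φ x) *
        (christoffelTrace c.rep.1 φ a x / (n + 2)) +
          partialDeriv φ a (fun y => ν.toFun y (coordFrame φ y)) x) * (2 * lambdaRatio H ν x) := by
    intro a
    rw [h.partialDeriv_lambdaRatio hφ hx]
    field_simp
  rw [Finset.sum_congr rfl fun a _ => h2 a, Finset.sum_sub_distrib, ← Finset.sum_mul,
    ← Finset.mul_sum, h1, growth, mul_sub, mul_assoc 2, sub_mul, mul_sub]
  have h3 : sigmaRatio H I ν x = (I.toFun c.rep x (coordFrame φ x) ⬝ᵥ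
    ((H.toFun c.rep x (coordFrame φ x))⁻¹).mulVec (tractorX n)) / ν.toFun x (coordFrame φ x) :=
    sigmaRatio_eq H I ν hu
  have h4 : lambdaRatio H ν x = (tractorX n ⬝ᵥ
    ((H.toFun c.rep x (coordFrame φ x))⁻¹).mulVec (tractorX n)) /
      ν.toFun x (coordFrame φ x) ^ 2 := lambdaRatio_eq H ν hu
  rw [h3, h4]
  generalize (∑ a, I.vec x (coordFrame φ x) a * (ν.toFun x (coordFrame φ x) *
      (christoffelTrace c.rep.1 φ a x / (n + 2)) +
        partialDeriv φ a (fun y => ν.toFun y (coordFrame φ y)) x)) = S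
  field_simp
  ring

theorem continuousAt_growth [T2Space M] (h : IsNullParallel q p H I ν) (x : M) :
    ContinuousAt (growth I ν (chartAt (Euc (n + 1)) x)) x := by
  set φ := chartAt (Euc (n + 1)) x with hφd
  have hφ : φ ∈ atlas (Euc (n + 1)) M := chart_mem_atlas (Euc (n + 1)) x
  have hn : φ.source ∈ 𝓝 x := φ.open_source.mem_nhds (mem_chart_source _ x)
  have hν : ContinuousAt (fun y => ν.toFun y (coordFrame φ y)) x :=
    (h.smooth_density φ hφ).continuousOn.continuousAt hn
  have hI : ∀ A, ContinuousAt (fun y => I.toFun c.rep y (coordFrame φ y) A) x := fun A =>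
    (h.smooth_tractor c.rep φ hφ A).continuousOn.continuousAt hn
  have hτ : ∀ a, ContinuousAt (christoffelTrace c.rep.1 φ a) x := fun a =>
    tendsto_finsetSum _ fun k _ => continuousAt_christoffel c.rep.1 x k a k
  have hdν : ∀ a, ContinuousAt (partialDeriv φ a fun y => ν.toFun y (coordFrame φ y)) x :=
    fun a => (continuousOn_partialDeriv hφ (h.smooth_density φ hφ) a).continuousAt hn
  exact (hν.mul (hI _)).neg.sub (tendsto_finsetSum _ fun a _ => (hI (Sum.inl a)).mul
    ((hν.mul ((hτ a).div_const _)).add (hdν a)))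

/-- At the zeros of `n` one has `I = ρ X` with `ρ ≠ 0`, so that `Φ(I, I) = 0` gives `λ = 0`. -/
theorem ratios_eq_zero (h : IsNullParallel q p H I ν) (hx : scaledField ν I x = 0) :
    sigmaRatio H I ν x = 0 ∧ lambdaRatio H ν x = 0 := by
  have hs : LinearIndependent ℝ (stdFrame x : Fin (n + 1) → TangentSpace (𝓡 (n + 1)) x) :=
    stdFrame_linearIndependent x
  have h1 := (scaledField_eq_zero_iff h.density_ne_zero hs).1 hx
  have h2 : I.toFun c.rep x (stdFrame x) =
      I.toFun c.rep x (stdFrame x) (Sum.inr ()) • tractorX n := by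
    have h3 := tractor_eq_sum (I.toFun c.rep x (stdFrame x))
    have h4 : ∀ a, I.toFun c.rep x (stdFrame x) (Sum.inl a) = 0 := fun a => congrFun h1 a
    simpa [h4] using h3
  have h5 : I.toFun c.rep x (stdFrame x) (Sum.inr ()) ≠ 0 := by
    intro h6
    rw [h6, zero_smul] at h2
    exact h.nowhereZero c.rep x _ hs h2
  have h7 := h.null c.rep x _ hs
  rw [h2, Matrix.mulVec_smul, dotProduct_smul, smul_dotProduct] at h7
  have h8 : tractorX n ⬝ᵥ ((H.toFun c.rep x (stdFrame x))⁻¹).mulVec (tractorX n) = 0 := by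
    simpa [h5] using h7
  constructor
  · change (I.toFun c.rep x (stdFrame x) ⬝ᵥ
      ((H.toFun c.rep x (stdFrame x))⁻¹).mulVec (tractorX n)) / _ = 0
    rw [h2, smul_dotProduct, h8, smul_zero, zero_div]
  · change (tractorX n ⬝ᵥ
      ((H.toFun c.rep x (stdFrame x))⁻¹).mulVec (tractorX n)) / _ = 0
    rw [h8, zero_div]

/-- The tractors `W_a` and `X` span the fibre, and `Φ` is nondegenerate. -/
theorem eq_zero_of_pairing_eq_zero (h : IsNullParallel q p H I ν)
    {u : Fin (n + 1) → TangentSpace (𝓡 (n + 1)) x} (hu : LinearIndependent ℝ u) {v : TIdx n → ℝ}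
    (h1 : ∀ a, v ⬝ᵥ ((H.toFun c.rep x u)⁻¹).mulVec (Pi.single (Sum.inl a) 1) = 0)
    (h2 : v ⬝ᵥ ((H.toFun c.rep x u)⁻¹).mulVec (tractorX n) = 0) : v = 0 := by
  obtain ⟨hsym, hdet, -⟩ := h.signature c.rep x u hu
  have h3 : ∀ w, w ⬝ᵥ ((H.toFun c.rep x u)⁻¹).mulVec v = 0 := by
    intro w
    rw [pairing_comm hsym, tractor_eq_sum w, Matrix.mulVec_add, dotProduct_add, Matrix.mulVec_smul,
      dotProduct_smul, Matrix.mulVec_sum, dotProduct_sum, h2]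
    simp only [Matrix.mulVec_smul, dotProduct_smul, h1, smul_zero, Finset.sum_const_zero, add_zero]
  have h4 := dotProduct_eq_zero (((H.toFun c.rep x u)⁻¹).mulVec v)
    fun w => (dotProduct_comm _ _).trans (h3 w)
  have h5 := congrArg (fun z => (H.toFun c.rep x u).mulVec z) h4
  simpa [Matrix.mulVec_mulVec, Matrix.mul_nonsing_inv _ (IsUnit.mk0 _ hdet)] using h5

/-- `σ` is a defining density of its zero set: if `dσ` vanished there, `I` would be orthogonal to
the whole fibre. -/
theorem exists_partialDeriv_sigmaRatio_ne_zero (h : IsNullParallel q p H I ν)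
    (hφ : φ ∈ atlas (Euc (n + 1)) M) (hx : x ∈ φ.source) (hσ : sigmaRatio H I ν x = 0) :
    ∃ i, partialDeriv φ i (sigmaRatio H I ν) x ≠ 0 := by
  by_contra! hall
  have h0 := h.density_coordFrame_ne_zero hφ x hx
  have hu := coordFrame_linearIndependent hφ hx
  refine h.nowhereZero c.rep x _ hu (h.eq_zero_of_pairing_eq_zero hu (fun a => ?_) ?_)
  · have h1 := hall a
    rw [h.partialDeriv_sigmaRatio hφ hx, hσ, mul_zero, sub_zero, div_eq_zero_iff] at h1
    exact h1.resolve_right h0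
  · have h1 : (I.toFun c.rep x (coordFrame φ x) ⬝ᵥ
      ((H.toFun c.rep x (coordFrame φ x))⁻¹).mulVec (tractorX n)) / ν.toFun x (coordFrame φ x) = 0 :=
      (sigmaRatio_eq H I ν hu).symm.trans hσ
    exact (div_eq_zero_iff.1 h1).resolve_right h0

/-- `σ` and `λ` are transversal away from the zeros of `n`: a relation between their differentials
would make `I` a multiple of `X`. -/
theorem eq_zero_of_partialDeriv_relation (h : IsNullParallel q p H I ν)
    (hφ : φ ∈ atlas (Euc (n + 1)) M) (hx : x ∈ φ.source) (hσ : sigmaRatio H I ν x = 0)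
    (hl : lambdaRatio H ν x = 0) (hN : scaledField ν I x ≠ 0) {a b : ℝ}
    (hab : ∀ i, a * partialDeriv φ i (sigmaRatio H I ν) x +
      b * partialDeriv φ i (lambdaRatio H ν) x = 0) : a = 0 ∧ b = 0 := by
  have h0 := h.density_coordFrame_ne_zero hφ x hx
  have hu := coordFrame_linearIndependent hφ hx
  have h1 : (I.toFun c.rep x (coordFrame φ x) ⬝ᵥ
      ((H.toFun c.rep x (coordFrame φ x))⁻¹).mulVec (tractorX n)) / ν.toFun x (coordFrame φ x) = 0 :=
    (sigmaRatio_eq H I ν hu).symm.trans hσ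
  have h2 : (tractorX n ⬝ᵥ ((H.toFun c.rep x (coordFrame φ x))⁻¹).mulVec (tractorX n)) /
      ν.toFun x (coordFrame φ x) ^ 2 = 0 := (lambdaRatio_eq H ν hu).symm.trans hl
  have h1' := (div_eq_zero_iff.1 h1).resolve_right h0
  have h2' := (div_eq_zero_iff.1 h2).resolve_right (pow_ne_zero 2 h0)
  set e := ν.toFun x (coordFrame φ x) with he
  have h3 : (a * e) • I.toFun c.rep x (coordFrame φ x) + (2 * b) • tractorX n = 0 := by
    refine h.eq_zero_of_pairing_eq_zero hu (fun i => ?_) ?_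
    · have h4 := hab i
      rw [h.partialDeriv_sigmaRatio hφ hx, h.partialDeriv_lambdaRatio hφ hx, hσ, hl, mul_zero,
        sub_zero, mul_zero, sub_zero, ← he] at h4
      rw [add_dotProduct, smul_dotProduct, smul_dotProduct, smul_eq_mul, smul_eq_mul]
      field_simp at h4
      linear_combination h4
    · rw [add_dotProduct, smul_dotProduct, smul_dotProduct, h1', h2', smul_zero, smul_zero,
        add_zero]
  have ha : a = 0 := by
    by_contra ha
    refine hN ((scaledField_eq_zero_iff h.density_ne_zero hu).2 (funext fun i => ?_))
    have h4 := congrFun h3 (Sum.inl i)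
    simp only [Pi.add_apply, Pi.smul_apply, smul_eq_mul, tractorX, Sum.elim_inl, mul_zero, add_zero,
      Pi.zero_apply, mul_eq_zero] at h4
    exact h4.resolve_left (by simp [ha, h0])
  refine ⟨ha, ?_⟩
  have h4 := congrFun h3 (Sum.inr ())
  simpa [ha, tractorX] using h4

end IsNullParallel

end NullParallel

/-! ### The functions `σ / ν` and `λ / ν²` along the flow -/

section LinearODE

/-- A solution of a linear equation with locally continuous coefficient that vanishes once vanishes
identically. -/
theorem eq_zero_of_hasDerivAt_mul {f : ℝ → ℝ}
    (hf : ∀ t₀, ∃ a : ℝ → ℝ, ContinuousAt a t₀ ∧ ∀ᶠ t in 𝓝 t₀, HasDerivAt f (a t * f t) t)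
    {t₁ : ℝ} (h0 : f t₁ = 0) (t : ℝ) : f t = 0 := by
  have hcont : Continuous f := continuous_iff_continuousAt.2 fun t => by
    obtain ⟨a, -, h⟩ := hf t
    exact h.self_of_nhds.continuousAt
  have hclosed : IsClosed {t | f t = 0} := isClosed_eq hcont continuous_const
  have hopen : IsOpen {t | f t = 0} := by
    rw [isOpen_iff_mem_nhds]
    intro t₀ ht₀
    obtain ⟨a, ha, h⟩ := hf t₀
    have hb : ∀ᶠ t in 𝓝 t₀, |a t| < |a t₀| + 1 :=
      ha.abs.eventually_lt continuousAt_const (lt_add_one _)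
    refine ODE_solution_unique_of_eventually (v := fun t y => a t * y) (s := fun _ => univ)
      (K := Real.toNNReal (|a t₀| + 1)) (g := fun _ => 0) ?_
      (h.mono fun t ht => ⟨ht, mem_univ _⟩) (Filter.Eventually.of_forall fun t => ⟨?_, mem_univ _⟩)
      ht₀
    · filter_upwards [hb] with t ht
      refine LipschitzOnWith.of_dist_le_mul fun y _ z _ => ?_
      rw [Real.dist_eq, Real.dist_eq, ← mul_sub, abs_mul, Real.coe_toNNReal _ (by positivity)]
      gcongr
    · rw [mul_zero]
      exact hasDerivAt_const t 0
  have huniv := IsClopen.eq_univ ⟨hclosed, hopen⟩ ⟨t₁, h0⟩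
  exact (huniv ▸ mem_univ t : t ∈ {t | f t = 0})

/-- A continuous function on the line without zeros has constant sign. -/
theorem pos_of_forall_ne_zero {f : ℝ → ℝ} (hf : Continuous f) (h : ∀ t, f t ≠ 0) {s : ℝ}
    (hs : 0 < f s) (t : ℝ) : 0 < f t := by
  by_contra! ht
  obtain ⟨r, hr⟩ := mem_range_of_exists_le_of_exists_ge hf ⟨t, ht⟩ ⟨s, hs.le⟩
  exact h r hr

end LinearODE

section Flow

variable {m : ℕ} {M : Type*} [TopologicalSpace M] [ChartedSpace (Euc m) M] {θ : Flow ℝ M}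
  {v : (x : M) → TangentSpace (𝓡 m) x}

theorem hasDerivAt_comp_flow (hv : ∀ x, IsMIntegralCurve (fun t => θ t x) v) {f : M → ℝ}
    (hf : ContMDiff (𝓡 m) 𝓘(ℝ, ℝ) ∞ f) (x : M) (t : ℝ) :
    HasDerivAt (fun t => f (θ t x)) (mfderiv (𝓡 m) 𝓘(ℝ, ℝ) f (θ t x) (v (θ t x)) : ℝ) t := by
  have h1 : HasMFDerivAt 𝓘(ℝ, ℝ) (𝓡 m) (fun t : ℝ => θ t x) t
    ((1 : ℝ →L[ℝ] ℝ).smulRight (v (θ t x))) := hv x t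
  have h2 := HasMFDerivAt.comp t ((hf (θ t x)).mdifferentiableAt (by simp)).hasMFDerivAt h1
  have h3 : ∀ (A : Euc m →L[ℝ] ℝ) (V : Euc m),
      HasFDerivAt (fun t => f (θ t x)) (A.comp ((1 : ℝ →L[ℝ] ℝ).smulRight V)) t →
      HasDerivAt (fun t => f (θ t x)) (A V) t := by
    intro A V h
    simpa using h.hasDerivAt
  exact h3 _ _ (hasMFDerivAt_iff_hasFDerivAt.1 h2)

/-- Equilibria are fixed, by uniqueness of integral curves. -/
theorem flow_eq_of_eq_zero [T2Space M] [IsManifold (𝓡 m) ∞ M]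
    (hv : ∀ x, IsMIntegralCurve (fun t => θ t x) v)
    (hvs : ContMDiff (𝓡 m) (𝓡 m).tangent ∞ (fun x => (⟨x, v x⟩ : TangentBundle (𝓡 m) M)))
    {x : M} (hx : v x = 0) (t : ℝ) : θ t x = x := by
  have : IsManifold (𝓡 m) 1 M := IsManifold.of_le (n := ∞) (by simp)
  have h1 : ContMDiff (𝓡 m) (𝓡 m).tangent 1 (fun x => (⟨x, v x⟩ : TangentBundle (𝓡 m) M)) :=
    hvs.of_le (by simp)
  exact congrFun (isMIntegralCurve_Ioo_eq_of_contMDiff_boundaryless (t₀ := 0) h1 (hv x)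
    (isMIntegralCurve_const hx) (θ.map_zero_apply x)) t

omit [ChartedSpace (Euc m) M] in
theorem flow_image_eq {S : Set M} (hS : ∀ t : ℝ, ∀ x ∈ S, θ t x ∈ S) (t : ℝ) : θ t '' S = S := by
  refine Subset.antisymm (by rintro _ ⟨x, hx, rfl⟩; exact hS t x hx) fun x hx => ?_
  exact ⟨θ (-t) x, hS _ x hx, by rw [← θ.map_add]; simp⟩

end Flow

section LocalEquations

variable {m r : ℕ} {M : Type*} [TopologicalSpace M] [ChartedSpace (Euc m) M]

/-- A linear map to `ℝ^r` without relations between its components is onto. -/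
theorem surjective_of_forall_relation {E : Type*} [AddCommGroup E] [Module ℝ E]
    (L : E →ₗ[ℝ] Euc r)
    (h : ∀ b : Fin r → ℝ, (∀ e, ∑ k, b k * L e k = 0) → b = 0) : Function.Surjective L := by
  rw [← LinearMap.range_eq_top, ← Submodule.orthogonal_eq_bot_iff, Submodule.eq_bot_iff]
  intro b hb
  have h1 := h b fun e => by
    have h2 := (Submodule.mem_orthogonal _ _).1 hb (L e) ⟨e, rfl⟩
    rw [PiLp.inner_apply] at h2
    rw [← h2]
    exact Finset.sum_congr rfl fun k _ => by simp
  ext k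
  exact congrFun h1 k

/-- The map to `ℝ^r` with given components. -/
noncomputable def toEuc (f : Fin r → M → ℝ) (x : M) : Euc r := WithLp.toLp 2 fun k => f k x

omit [TopologicalSpace M] [ChartedSpace (Euc m) M] in
theorem toEuc_eq_zero_iff {f : Fin r → M → ℝ} {x : M} : toEuc f x = 0 ↔ ∀ k, f k x = 0 := by
  constructor
  · exact fun h k => congrArg (fun y : Euc r => y k) h
  · intro h
    ext k
    exact h k

theorem contMDiff_toEuc {f : Fin r → M → ℝ} (hf : ∀ k, ContMDiff (𝓡 m) 𝓘(ℝ, ℝ) ∞ (f k)) :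
    ContMDiff (𝓡 m) (𝓡 r) ∞ (toEuc f) := by
  have h1 : ContMDiff (𝓡 m) 𝓘(ℝ, Fin r → ℝ) ∞ fun x k => f k x := contMDiff_pi_space.2 hf
  have h2 : ContMDiff 𝓘(ℝ, Fin r → ℝ) (𝓡 r) ∞ (EuclideanSpace.equiv (Fin r) ℝ).symm :=
    (EuclideanSpace.equiv (Fin r) ℝ).symm.contDiff.contMDiff
  exact h2.comp h1

theorem mfderiv_toEuc {f : Fin r → M → ℝ} {x : M} {B : Fin r → Euc m →L[ℝ] ℝ}
    (hB : ∀ k, HasMFDerivAt (𝓡 m) 𝓘(ℝ, ℝ) (f k) x (B k)) :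
    mfderiv (𝓡 m) (𝓡 r) (toEuc f) x =
      ((EuclideanSpace.equiv (Fin r) ℝ).symm : (Fin r → ℝ) →L[ℝ] Euc r).comp
        (ContinuousLinearMap.pi B) := by
  have h1 : HasMFDerivAt (𝓡 m) 𝓘(ℝ, Fin r → ℝ) (fun y k => f k y) x
      (ContinuousLinearMap.pi B) :=
    ⟨continuousAt_pi.2 fun k => (hB k).1, hasFDerivWithinAt_pi.2 fun k => (hB k).2⟩
  have h2 : HasMFDerivAt 𝓘(ℝ, Fin r → ℝ) (𝓡 r) (EuclideanSpace.equiv (Fin r) ℝ).symm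
      (fun k => f k x) ((EuclideanSpace.equiv (Fin r) ℝ).symm : (Fin r → ℝ) →L[ℝ] Euc r) :=
    (EuclideanSpace.equiv (Fin r) ℝ).symm.hasFDerivAt.hasMFDerivAt
  exact (HasMFDerivAt.comp x h2 h1).mfderiv

theorem mfderiv_toEuc_eq_zero {f : Fin r → M → ℝ} {x : M} {B : Fin r → Euc m →L[ℝ] ℝ}
    (hB : ∀ k, HasMFDerivAt (𝓡 m) 𝓘(ℝ, ℝ) (f k) x (B k)) {w : Euc m} (hw : ∀ k, B k w = 0) :
    mfderiv (𝓡 m) (𝓡 r) (toEuc f) x w = 0 := by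
  rw [mfderiv_toEuc hB]
  have h1 : ContinuousLinearMap.pi B w = 0 := funext hw
  exact (congrArg (EuclideanSpace.equiv (Fin r) ℝ).symm h1).trans (map_zero _)

theorem surjective_mfderiv_toEuc {f : Fin r → M → ℝ} {x : M} {B : Fin r → Euc m →L[ℝ] ℝ}
    (hB : ∀ k, HasMFDerivAt (𝓡 m) 𝓘(ℝ, ℝ) (f k) x (B k))
    (h : ∀ b : Fin r → ℝ, (∀ w : Euc m, ∑ k, b k * B k w = 0) → b = 0) :
    Function.Surjective (mfderiv (𝓡 m) (𝓡 r) (toEuc f) x) := by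
  rw [mfderiv_toEuc hB]
  exact surjective_of_forall_relation
    ((((EuclideanSpace.equiv (Fin r) ℝ).symm : (Fin r → ℝ) →L[ℝ] Euc r).comp
      (ContinuousLinearMap.pi B) : Euc m →L[ℝ] Euc r) : Euc m →ₗ[ℝ] Euc r) h

end LocalEquations

section Dynamics

variable {n : ℕ} {M : Type*} [TopologicalSpace M] [ChartedSpace (Euc (n + 1)) M]
  [IsManifold (𝓡 (n + 1)) ∞ M] {c : ProjectiveStructure n M} {q p : ℕ}
  {H : TractorBitensor c} {I : TractorField c} {ν : Density n M 1} {θ : Flow ℝ M}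

namespace IsNullParallel

theorem continuous_lambdaRatio_flow (h : IsNullParallel q p H I ν) (x : M) :
    Continuous fun t : ℝ => lambdaRatio H ν (θ t x) :=
  h.contMDiff_lambdaRatio.continuous.comp (θ.continuous continuous_id continuous_const)

variable [T2Space M]

/-- The derivatives of `σ / ν` and `λ / ν²` along an orbit.  The coefficient `a` is `growth` in the
preferred chart at the point reached at the time `t₀`, so it is only available near `t₀`. -/
theorem exists_eventually_hasDerivAt (h : IsNullParallel q p H I ν)
    (hv : ∀ x, IsMIntegralCurve (fun t => θ t x) (scaledField ν I)) (x : M) (t₀ : ℝ) :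
    ∃ a : ℝ → ℝ, ContinuousAt a t₀ ∧ ∀ᶠ t in 𝓝 t₀,
      HasDerivAt (fun t => sigmaRatio H I ν (θ t x)) (a t * sigmaRatio H I ν (θ t x)) t ∧
      HasDerivAt (fun t => lambdaRatio H ν (θ t x))
        (2 * sigmaRatio H I ν (θ t x) + 2 * a t * lambdaRatio H ν (θ t x)) t := by
  set φ := chartAt (Euc (n + 1)) (θ t₀ x) with hφd
  have hφ : φ ∈ atlas (Euc (n + 1)) M := chart_mem_atlas (Euc (n + 1)) _
  have hc : Continuous fun t : ℝ => θ t x := θ.continuous continuous_id continuous_const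
  refine ⟨fun t => growth I ν φ (θ t x),
    ContinuousAt.comp (g := growth I ν φ) (f := fun t : ℝ => θ t x) (x := t₀)
      (h.continuousAt_growth (θ t₀ x)) hc.continuousAt, ?_⟩
  filter_upwards [hc.continuousAt.eventually_mem
    (φ.open_source.mem_nhds (mem_chart_source (Euc (n + 1)) (θ t₀ x)))] with t ht
  exact ⟨(hasDerivAt_comp_flow hv h.contMDiff_sigmaRatio x t).congr_deriv
      (h.mfderiv_sigmaRatio_scaledField hφ ht),
    (hasDerivAt_comp_flow hv h.contMDiff_lambdaRatio x t).congr_deriv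
      (h.mfderiv_lambdaRatio_scaledField hφ ht)⟩

theorem sigmaRatio_flow_eq_zero (h : IsNullParallel q p H I ν)
    (hv : ∀ x, IsMIntegralCurve (fun t => θ t x) (scaledField ν I)) {x : M}
    (hx : sigmaRatio H I ν x = 0) (t : ℝ) : sigmaRatio H I ν (θ t x) = 0 := by
  refine eq_zero_of_hasDerivAt_mul (f := fun t => sigmaRatio H I ν (θ t x)) (t₁ := 0)
    (fun t₀ => ?_) (by rwa [θ.map_zero_apply]) t
  obtain ⟨a, ha, hd⟩ := h.exists_eventually_hasDerivAt hv x t₀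
  exact ⟨a, ha, hd.mono fun t ht => ht.1⟩

theorem lambdaRatio_flow_eq_zero (h : IsNullParallel q p H I ν)
    (hv : ∀ x, IsMIntegralCurve (fun t => θ t x) (scaledField ν I)) {x : M}
    (hx : sigmaRatio H I ν x = 0) {t₁ : ℝ} (hl : lambdaRatio H ν (θ t₁ x) = 0) (t : ℝ) :
    lambdaRatio H ν (θ t x) = 0 := by
  refine eq_zero_of_hasDerivAt_mul (f := fun t => lambdaRatio H ν (θ t x)) (t₁ := t₁)
    (fun t₀ => ?_) hl t
  obtain ⟨a, ha, hd⟩ := h.exists_eventually_hasDerivAt hv x t₀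
  refine ⟨fun t => 2 * a t, ha.const_mul 2, hd.mono fun t ht => ht.2.congr_deriv ?_⟩
  rw [h.sigmaRatio_flow_eq_zero hv hx, mul_zero, zero_add]

theorem sigmaRatio_flow_ne_zero (h : IsNullParallel q p H I ν)
    (hv : ∀ x, IsMIntegralCurve (fun t => θ t x) (scaledField ν I)) {x : M}
    (hx : sigmaRatio H I ν x ≠ 0) (t : ℝ) : sigmaRatio H I ν (θ t x) ≠ 0 := by
  intro h0
  have h1 := h.sigmaRatio_flow_eq_zero hv h0 (-t)
  rw [← θ.map_add, neg_add_cancel, θ.map_zero_apply] at h1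
  exact hx h1

theorem lambdaRatio_flow_pos (h : IsNullParallel q p H I ν)
    (hv : ∀ x, IsMIntegralCurve (fun t => θ t x) (scaledField ν I)) {x : M}
    (hx : sigmaRatio H I ν x = 0) (hl : 0 < lambdaRatio H ν x) (t : ℝ) :
    0 < lambdaRatio H ν (θ t x) := by
  refine pos_of_forall_ne_zero (h.continuous_lambdaRatio_flow x) (fun s hs => ?_) (s := 0)
    (by rwa [θ.map_zero_apply]) t
  have h1 := h.lambdaRatio_flow_eq_zero hv hx hs 0
  rw [θ.map_zero_apply] at h1
  exact hl.ne' h1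

theorem lambdaRatio_flow_neg (h : IsNullParallel q p H I ν)
    (hv : ∀ x, IsMIntegralCurve (fun t => θ t x) (scaledField ν I)) {x : M}
    (hx : sigmaRatio H I ν x = 0) (hl : lambdaRatio H ν x < 0) (t : ℝ) :
    lambdaRatio H ν (θ t x) < 0 := by
  refine neg_pos.1 (pos_of_forall_ne_zero (f := fun t => -lambdaRatio H ν (θ t x))
    (h.continuous_lambdaRatio_flow x).neg (fun s hs => ?_) (s := 0)
    (by rw [θ.map_zero_apply]; exact neg_pos.2 hl) t)
  have h1 := h.lambdaRatio_flow_eq_zero hv hx (neg_eq_zero.1 hs) 0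
  rw [θ.map_zero_apply] at h1
  exact hl.ne h1

theorem scaledField_flow_eq_zero_iff (h : IsNullParallel q p H I ν)
    (hv : ∀ x, IsMIntegralCurve (fun t => θ t x) (scaledField ν I)) (x : M) (t : ℝ) :
    scaledField ν I (θ t x) = 0 ↔ scaledField ν I x = 0 := by
  constructor
  · intro h0
    have h1 := flow_eq_of_eq_zero hv h.contMDiff_scaledField h0 (-t)
    rw [← θ.map_add, neg_add_cancel, θ.map_zero_apply] at h1
    rwa [← h1] at h0
  · intro h0
    rwa [flow_eq_of_eq_zero hv h.contMDiff_scaledField h0 t]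

/-- On `{σ ≠ 0}` the function `λ / σ²` has derivative `2 ν / σ` along the flow, which is bounded
away from zero by compactness. -/
theorem exists_isClock [CompactSpace M] (h : IsNullParallel q p H I ν)
    (hv : ∀ x, IsMIntegralCurve (fun t => θ t x) (scaledField ν I)) (U : Opens M)
    (hU : ∀ x, x ∈ U ↔ sigmaRatio H I ν x ≠ 0) :
    ∃ k : ℝ, IsClock θ U (fun x => lambdaRatio H ν x / sigmaRatio H I ν x ^ 2) k := by
  obtain ⟨C, hC⟩ := (isCompact_range h.contMDiff_sigmaRatio.continuous.abs).bddAbove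
  have hC0 : ∀ x, |sigmaRatio H I ν x| ≤ |C| + 1 := fun x => by
    have h1 : |sigmaRatio H I ν x| ≤ C := hC ⟨x, rfl⟩
    linarith [le_abs_self C]
  have hCpos : 0 < |C| + 1 := by positivity
  refine ⟨2 / (|C| + 1), by positivity, ?_, ?_, ?_⟩
  · exact h.contMDiff_lambdaRatio.continuous.continuousOn.div
      (h.contMDiff_sigmaRatio.continuous.continuousOn.pow 2)
      fun x hx => pow_ne_zero 2 ((hU x).1 hx)
  · exact fun t x hx => (hU _).2 (h.sigmaRatio_flow_ne_zero hv ((hU x).1 hx) t)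
  · intro t x hx
    have hne := h.sigmaRatio_flow_ne_zero hv ((hU x).1 hx)
    have hd : ∀ s, HasDerivAt
        (fun s => lambdaRatio H ν (θ s x) / sigmaRatio H I ν (θ s x) ^ 2)
        (2 / sigmaRatio H I ν (θ s x)) s := by
      intro s
      obtain ⟨a, -, hd⟩ := h.exists_eventually_hasDerivAt hv x s
      obtain ⟨h1, h2⟩ := hd.self_of_nhds
      have h0 := hne s
      refine (h2.fun_div (h1.fun_pow 2) (pow_ne_zero 2 h0)).congr_deriv ?_
      field_simp
      ring
    have hlow : ∀ s, 2 / (|C| + 1) ≤ |2 / sigmaRatio H I ν (θ s x)| := by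
      intro s
      rw [abs_div, abs_two]
      exact div_le_div_of_nonneg_left zero_le_two (abs_pos.2 (hne s)) (hC0 _)
    have hmvt : ∃ s, lambdaRatio H ν (θ t x) / sigmaRatio H I ν (θ t x) ^ 2 -
        lambdaRatio H ν x / sigmaRatio H I ν x ^ 2 = 2 / sigmaRatio H I ν (θ s x) * t := by
      have hc : Continuous fun s =>
          lambdaRatio H ν (θ s x) / sigmaRatio H I ν (θ s x) ^ 2 :=
        continuous_iff_continuousAt.2 fun s => (hd s).continuousAt
      rcases lt_trichotomy t 0 with ht | rfl | ht
      · obtain ⟨s, -, hs⟩ := exists_hasDerivAt_eq_slope _ _ ht hc.continuousOn fun s _ => hd s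
        refine ⟨s, ?_⟩
        have hne := ht.ne
        rw [hs, θ.map_zero_apply, zero_sub]
        field_simp
        ring
      · exact ⟨0, by rw [θ.map_zero_apply, sub_self, mul_zero]⟩
      · obtain ⟨s, -, hs⟩ := exists_hasDerivAt_eq_slope _ _ ht hc.continuousOn fun s _ => hd s
        refine ⟨s, ?_⟩
        rw [hs, θ.map_zero_apply, sub_zero, div_mul_cancel₀ _ ht.ne']
    obtain ⟨s, hs⟩ := hmvt
    change _ ≤ |lambdaRatio H ν (θ t x) / sigmaRatio H I ν (θ t x) ^ 2 -
      lambdaRatio H ν x / sigmaRatio H I ν x ^ 2|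
    rw [hs, abs_mul]
    gcongr
    exact hlow s

end IsNullParallel

end Dynamics

/-! ### The decomposition of the manifold and of the orbit space -/

section Orbits

variable {n : ℕ} {M : Type*} [TopologicalSpace M] [ChartedSpace (Euc (n + 1)) M]
  [IsManifold (𝓡 (n + 1)) ∞ M] {c : ProjectiveStructure n M} {q p : ℕ}
  {H : TractorBitensor c} {I : TractorField c} {ν : Density n M 1} {x : M}

namespace IsNullParallel

theorem mem_openOrbit_iff (h : IsNullParallel q p H I ν) :
    x ∈ openOrbit H I ↔ sigmaRatio H I ν x ≠ 0 :=
  not_congr (sigma_zeroAt_iff h.density_ne_zero)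

theorem mem_sigmaMinus_iff (h : IsNullParallel q p H I ν) :
    x ∈ sigmaMinus H I ↔ sigmaRatio H I ν x = 0 ∧ lambdaRatio H ν x < 0 :=
  and_congr (sigma_zeroAt_iff h.density_ne_zero) (lambda_negAt_iff h.density_ne_zero)

theorem mem_sigmaPlus_iff (h : IsNullParallel q p H I ν) :
    x ∈ sigmaPlus H I ↔ sigmaRatio H I ν x = 0 ∧ 0 < lambdaRatio H ν x :=
  and_congr (sigma_zeroAt_iff h.density_ne_zero) (lambda_posAt_iff h.density_ne_zero)

theorem mem_sigmaZero_iff (h : IsNullParallel q p H I ν) :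
    x ∈ sigmaZero H I ↔
      (sigmaRatio H I ν x = 0 ∧ lambdaRatio H ν x = 0) ∧ scaledField ν I x ≠ 0 :=
  and_congr (and_congr (sigma_zeroAt_iff h.density_ne_zero) (lambda_zeroAt_iff h.density_ne_zero))
    (not_congr (mem_zeroLocus_iff h.density_ne_zero))

theorem compl_zeroLocus_eq (h : IsNullParallel q p H I ν) :
    (zeroLocus I)ᶜ = openOrbit H I ∪ sigmaMinus H I ∪ sigmaZero H I ∪ sigmaPlus H I := by
  ext x
  simp only [mem_union, mem_compl_iff, h.mem_openOrbit_iff, h.mem_sigmaMinus_iff,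
    h.mem_sigmaPlus_iff, h.mem_sigmaZero_iff, mem_zeroLocus_iff h.density_ne_zero]
  have h1 := fun h0 : scaledField ν I x = 0 => h.ratios_eq_zero h0
  by_cases hN : scaledField ν I x = 0
  · obtain ⟨h2, h3⟩ := h1 hN
    simp [hN, h2, h3]
  · by_cases hσ : sigmaRatio H I ν x = 0
    · rcases lt_trichotomy (lambdaRatio H ν x) 0 with hl | hl | hl
      · simp [hN, hσ, hl]
      · simp [hN, hσ, hl]
      · simp [hN, hσ, hl]
    · simp [hN, hσ]

theorem isOpen_compl_zeroLocus (h : IsNullParallel q p H I ν) : IsOpen (zeroLocus I)ᶜ := by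
  rw [isOpen_iff_mem_nhds]
  intro x hx
  set φ := chartAt (Euc (n + 1)) x with hφd
  have hφ : φ ∈ atlas (Euc (n + 1)) M := chart_mem_atlas (Euc (n + 1)) x
  have hiff : ∀ y ∈ φ.source, y ∈ zeroLocus I ↔ I.vec y (coordFrame φ y) = 0 := fun y hy => by
    rw [mem_zeroLocus_iff h.density_ne_zero, scaledField_eq_zero_iff h.density_ne_zero (coordFrame_linearIndependent hφ hy)]
  have hx' : I.vec x (coordFrame φ x) ≠ 0 := fun h0 => hx ((hiff x (mem_chart_source _ x)).2 h0)
  obtain ⟨a, ha⟩ := Function.ne_iff.1 hx'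
  have hc : ContinuousAt (fun y => I.vec y (coordFrame φ y) a) x :=
    (h.smooth_tractor c.rep φ hφ (Sum.inl a)).continuousOn.continuousAt
      (φ.open_source.mem_nhds (mem_chart_source _ x))
  filter_upwards [hc.eventually_ne ha, φ.open_source.mem_nhds (mem_chart_source _ x)] with y hy hys
  exact fun h0 => hy (congrFun ((hiff y hys).1 h0) a)

theorem pairwise_disjoint (h : IsNullParallel q p H I ν) :
    [openOrbit H I, sigmaMinus H I, sigmaZero H I, sigmaPlus H I].Pairwise Disjoint := by
  simp only [List.pairwise_cons, List.mem_cons, List.not_mem_nil, or_false, forall_eq_or_imp,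
    forall_eq, IsEmpty.forall_iff, implies_true, List.Pairwise.nil, and_true]
  simp only [Set.disjoint_left, h.mem_openOrbit_iff, h.mem_sigmaMinus_iff,
    h.mem_sigmaPlus_iff, h.mem_sigmaZero_iff]
  refine ⟨⟨fun x h1 h2 => h1 h2.1, fun x h1 h2 => h1 h2.1.1, fun x h1 h2 => h1 h2.1⟩,
    ⟨fun x h1 h2 => h1.2.ne h2.1.2, fun x h1 h2 => h1.2.not_gt h2.2⟩,
    fun x h1 h2 => h2.2.ne' h1.1.2⟩

end IsNullParallel

/-- Disjoint invariant sets have disjoint images in the orbit space. -/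
theorem disjoint_orbitImage {X : Type*} [TopologicalSpace X] {θ : Flow ℝ X} {U : Opens X}
    {S T : Set X} (hS : ∀ t : ℝ, ∀ x ∈ S, θ t x ∈ S) (h : Disjoint S T) :
    Disjoint (orbitImage θ U S) (orbitImage θ U T) := by
  rw [Set.disjoint_left] at h ⊢
  rintro _ ⟨x, hx, rfl⟩ ⟨y, hy, hyx⟩
  obtain ⟨t, ht⟩ := orbitProj_eq_iff.1 hyx.symm
  exact h (hS t x hx) (by rw [ht]; exact hy)

theorem compl_orbitImage {X : Type*} [TopologicalSpace X] {θ : Flow ℝ X} {U : Opens X}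
    {S : Set X} (hS : ∀ t : ℝ, ∀ x ∈ S, θ t x ∈ S) :
    (orbitImage θ U S)ᶜ = orbitImage θ U Sᶜ := by
  ext p
  obtain ⟨x, rfl⟩ := Quotient.mk_surjective p
  constructor
  · exact fun h => ⟨x, fun hx => h ⟨x, hx, rfl⟩, rfl⟩
  · exact fun h h' => (disjoint_orbitImage (U := U) hS disjoint_compl_right).le_bot ⟨h', h⟩

end Orbits

theorem theorem3p2 {n : ℕ} (hn : 1 ≤ n) {M : Type*} [TopologicalSpace M]
    [ChartedSpace (Euc (n + 1)) M] [IsManifold (𝓡 (n + 1)) ∞ M] [CompactSpace M] [T2Space M]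
    (c : ProjectiveStructure n M)
    (H : TractorBitensor c) (hHsmooth : H.IsSmooth) (hHsig : H.HasSignature 2 n)
    (hHpar : H.IsParallel)
    (I : TractorField c) (hIsmooth : I.IsSmooth) (hIne : I.NowhereZero) (hInull : H.IsNull I)
    (hIpar : I.IsParallel)
    (ν : Density n M 1) (hνsmooth : ν.IsSmooth) (hνne : ∀ x, ¬ ν.ZeroAt x) :
    ∃ θ : Flow ℝ M,
      -- `θ` is the (global, smooth) flow of `N = ν n`
      ContMDiff (𝓘(ℝ, ℝ).prod (𝓡 (n + 1))) (𝓡 (n + 1)) ∞ (fun p : ℝ × M => θ p.1 p.2) ∧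
      (∀ x : M, IsMIntegralCurve (fun t => θ t x) (scaledField ν I)) ∧
      -- the decomposition of the manifold
      (zeroLocus I)ᶜ = openOrbit H I ∪ sigmaMinus H I ∪ sigmaZero H I ∪ sigmaPlus H I ∧
      [openOrbit H I, sigmaMinus H I, sigmaZero H I, sigmaPlus H I].Pairwise Disjoint ∧
      -- it is preserved by the flow
      (∀ t : ℝ, θ t '' openOrbit H I = openOrbit H I ∧ θ t '' sigmaMinus H I = sigmaMinus H I ∧
        θ t '' sigmaZero H I = sigmaZero H I ∧ θ t '' sigmaPlus H I = sigmaPlus H I ∧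
        θ t '' zeroLocus I = zeroLocus I) ∧
      ∃ (O M₀ : Opens M) (hO : O ≤ M₀),
        (O : Set M) = openOrbit H I ∧ (M₀ : Set M) = (zeroLocus I)ᶜ ∧
        -- the quotient of the open orbit is an `n`-dimensional manifold
        ∃ _ : ChartedSpace (Euc n) (OrbitSpace θ O),
          IsManifoldSubmersion (n + 1) n (orbitProj θ O) ∧
          -- if the full quotient is a manifold, it decomposes accordingly
          ∀ _ : ChartedSpace (Euc n) (OrbitSpace θ M₀),
            IsManifoldSubmersion (n + 1) n (orbitProj θ M₀) →
            univ = orbitImage θ M₀ (openOrbit H I) ∪ orbitImage θ M₀ (sigmaMinus H I) ∪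
              orbitImage θ M₀ (sigmaZero H I) ∪ orbitImage θ M₀ (sigmaPlus H I) ∧
            [orbitImage θ M₀ (openOrbit H I), orbitImage θ M₀ (sigmaMinus H I),
              orbitImage θ M₀ (sigmaZero H I), orbitImage θ M₀ (sigmaPlus H I)].Pairwise
                Disjoint ∧
            -- `Q_O` is an open submanifold
            IsOpen (orbitImage θ M₀ (openOrbit H I)) ∧
            Function.Injective (orbitInclusion θ hO) ∧
            range (orbitInclusion θ hO) = orbitImage θ M₀ (openOrbit H I) ∧
            IsLocalDiffeomorph (𝓡 n) (𝓡 n) ∞ (orbitInclusion θ hO) ∧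
            -- `H⁻`, `H⁰`, `H⁺` are submanifolds, and so is their union
            IsEmbeddedSubmanifold n 1 (orbitImage θ M₀ (sigmaMinus H I)) ∧
            IsEmbeddedSubmanifold n 2 (orbitImage θ M₀ (sigmaZero H I)) ∧
            IsEmbeddedSubmanifold n 1 (orbitImage θ M₀ (sigmaPlus H I)) ∧
            IsEmbeddedSubmanifold n 1 (orbitImage θ M₀ (openOrbit H I))ᶜ := by
  have h : IsNullParallel 2 n H I ν :=
    ⟨hHsmooth, hHsig, hHpar, hIsmooth, hIne, hInull, hIpar, hνsmooth, hνne⟩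
  have : SecondCountableTopology M := ChartedSpace.secondCountable_of_sigmaCompact (Euc (n + 1)) M
  obtain ⟨θ, hθ, hv⟩ := exists_smooth_flow h.contMDiff_scaledField
  have hiO : ∀ t : ℝ, ∀ x ∈ openOrbit H I, θ t x ∈ openOrbit H I := fun t x hx =>
    h.mem_openOrbit_iff.2 (h.sigmaRatio_flow_ne_zero hv (h.mem_openOrbit_iff.1 hx) t)
  have hiM : ∀ t : ℝ, ∀ x ∈ sigmaMinus H I, θ t x ∈ sigmaMinus H I := by
    intro t x hx
    obtain ⟨h1, h2⟩ := h.mem_sigmaMinus_iff.1 hx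
    exact h.mem_sigmaMinus_iff.2 ⟨h.sigmaRatio_flow_eq_zero hv h1 t, h.lambdaRatio_flow_neg hv h1 h2 t⟩
  have hiP : ∀ t : ℝ, ∀ x ∈ sigmaPlus H I, θ t x ∈ sigmaPlus H I := by
    intro t x hx
    obtain ⟨h1, h2⟩ := h.mem_sigmaPlus_iff.1 hx
    exact h.mem_sigmaPlus_iff.2 ⟨h.sigmaRatio_flow_eq_zero hv h1 t, h.lambdaRatio_flow_pos hv h1 h2 t⟩
  have hiZ : ∀ t : ℝ, ∀ x ∈ sigmaZero H I, θ t x ∈ sigmaZero H I := by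
    intro t x hx
    obtain ⟨⟨h1, h2⟩, h3⟩ := h.mem_sigmaZero_iff.1 hx
    exact h.mem_sigmaZero_iff.2 ⟨⟨h.sigmaRatio_flow_eq_zero hv h1 t,
      h.lambdaRatio_flow_eq_zero hv h1 (t₁ := 0) (by rwa [θ.map_zero_apply]) t⟩,
      fun h4 => h3 ((h.scaledField_flow_eq_zero_iff hv x t).1 h4)⟩
  have hiN : ∀ t : ℝ, ∀ x ∈ zeroLocus I, θ t x ∈ zeroLocus I := fun t x hx =>
    (mem_zeroLocus_iff hνne).2 ((h.scaledField_flow_eq_zero_iff hv x t).2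
      ((mem_zeroLocus_iff hνne).1 hx))
  refine ⟨θ, hθ, hv, h.compl_zeroLocus_eq, h.pairwise_disjoint, fun t => ⟨flow_image_eq hiO t,
    flow_image_eq hiM t, flow_image_eq hiZ t, flow_image_eq hiP t, flow_image_eq hiN t⟩, ?_⟩
  have hσc := h.contMDiff_sigmaRatio
  have hlc := h.contMDiff_lambdaRatio
  have hoO : IsOpen (openOrbit H I) := by
    have h1 : openOrbit H I = sigmaRatio H I ν ⁻¹' {0}ᶜ := ext fun x => h.mem_openOrbit_iff
    rw [h1]
    exact isOpen_compl_singleton.preimage hσc.continuous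
  have hoM : IsOpen (zeroLocus I)ᶜ := h.isOpen_compl_zeroLocus
  let O : Opens M := ⟨openOrbit H I, hoO⟩
  let M₀ : Opens M := ⟨(zeroLocus I)ᶜ, hoM⟩
  have hO : O ≤ M₀ := fun x hx => by
    change x ∈ (zeroLocus I)ᶜ
    rw [h.compl_zeroLocus_eq]
    exact Or.inl (Or.inl (Or.inl hx))
  have hN0 : ∀ x ∈ M₀, scaledField ν I x ≠ 0 := fun x hx h0 =>
    hx ((mem_zeroLocus_iff hνne).2 h0)
  have hiM₀ : ∀ t : ℝ, ∀ x ∈ M₀, θ t x ∈ M₀ := fun t x hx hx' =>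
    hN0 x hx ((h.scaledField_flow_eq_zero_iff hv x t).1 ((mem_zeroLocus_iff hνne).1 hx'))
  obtain ⟨k, hk⟩ := h.exists_isClock hv O fun x => h.mem_openOrbit_iff
  obtain ⟨C, hC⟩ := hk.exists_chartedSpace_orbitSpace hθ hv fun x hx => hN0 x (hO hx)
  refine ⟨O, M₀, hO, rfl, rfl, C, hC, fun C₀ hC₀ => ?_⟩
  have hdu : ∀ x, sigmaRatio H I ν x = 0 →
      (mfderiv (𝓡 (n + 1)) 𝓘(ℝ, ℝ) (sigmaRatio H I ν) x (scaledField ν I x) : ℝ) = 0 := by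
    intro x hx
    have h1 := h.mfderiv_sigmaRatio_scaledField (chart_mem_atlas (Euc (n + 1)) x)
      (mem_chart_source _ x)
    rw [hx, mul_zero] at h1
    exact h1
  have hdl : ∀ x, sigmaRatio H I ν x = 0 → lambdaRatio H ν x = 0 →
      (mfderiv (𝓡 (n + 1)) 𝓘(ℝ, ℝ) (lambdaRatio H ν) x (scaledField ν I x) : ℝ) = 0 := by
    intro x hx hx'
    have h1 := h.mfderiv_lambdaRatio_scaledField (chart_mem_atlas (Euc (n + 1)) x)
      (mem_chart_source _ x)
    rw [hx, hx', mul_zero, mul_zero, add_zero] at h1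
    exact h1
  -- invariant sets with the local equation `σ = 0`, which is regular, give hypersurfaces
  have hyper : ∀ S : Set M, (∀ t : ℝ, ∀ x ∈ S, θ t x ∈ S) →
      (∀ x ∈ S, sigmaRatio H I ν x = 0 ∧ ∃ V : Set M, IsOpen V ∧ x ∈ V ∧
        ∀ y ∈ V, y ∈ S ↔ sigmaRatio H I ν y = 0) →
      IsEmbeddedSubmanifold n 1 (orbitImage θ M₀ S) := by
    intro S hS hloc
    refine isEmbeddedSubmanifold_orbitImage hθ hv hN0 hiM₀ hC₀ hS fun x hxS _ => ?_
    obtain ⟨hx0, V, hVo, hxV, hV⟩ := hloc x hxS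
    have hf : ∀ k : Fin 1, ContMDiff (𝓡 (n + 1)) 𝓘(ℝ, ℝ) ∞ (![sigmaRatio H I ν] k) := by
      intro k
      fin_cases k
      exact hσc
    have hB : ∀ k : Fin 1, HasMFDerivAt (𝓡 (n + 1)) 𝓘(ℝ, ℝ) (![sigmaRatio H I ν] k) x
        (mfderiv (𝓡 (n + 1)) 𝓘(ℝ, ℝ) (![sigmaRatio H I ν] k) x) := fun k =>
      ((hf k x).mdifferentiableAt (by simp)).hasMFDerivAt
    refine ⟨V, toEuc ![sigmaRatio H I ν], hVo, hxV, (contMDiff_toEuc hf).contMDiffOn, ?_, ?_, ?_⟩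
    · ext y
      have h1 : toEuc ![sigmaRatio H I ν] y = 0 ↔ sigmaRatio H I ν y = 0 := by
        rw [toEuc_eq_zero_iff]
        simp
      constructor
      · exact fun hy => ⟨hy.2, h1.2 ((hV y hy.2).1 hy.1)⟩
      · exact fun hy => ⟨(hV y hy.1).2 (h1.1 hy.2), hy.1⟩
    · refine surjective_mfderiv_toEuc hB fun b hb => ?_
      obtain ⟨i, hi⟩ := h.exists_partialDeriv_sigmaRatio_ne_zero
        (chart_mem_atlas (Euc (n + 1)) x) (mem_chart_source _ x) hx0
      have h1 := hb (coordField (chartAt (Euc (n + 1)) x) i x)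
      rw [Fin.sum_univ_one] at h1
      have h2 : b 0 = 0 := (mul_eq_zero.1 h1).resolve_right hi
      funext k
      fin_cases k
      exact h2
    · refine mfderiv_toEuc_eq_zero hB (w := scaledField ν I x) fun k => ?_
      fin_cases k
      exact hdu x hx0
  have hun : univ = orbitImage θ M₀ (openOrbit H I) ∪ orbitImage θ M₀ (sigmaMinus H I) ∪
      orbitImage θ M₀ (sigmaZero H I) ∪ orbitImage θ M₀ (sigmaPlus H I) := by
    simp only [orbitImage, ← image_union, ← preimage_union, ← h.compl_zeroLocus_eq]
    refine (eq_univ_of_forall fun p => ?_).symm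
    obtain ⟨x, rfl⟩ := Quotient.mk_surjective p
    exact ⟨x, x.2, rfl⟩
  have hdisj := h.pairwise_disjoint
  refine ⟨hun, ?_, isOpen_orbitImage hiM₀ hoO, orbitInclusion_injective hO, range_orbitInclusion hO,
    isLocalDiffeomorph_orbitInclusion hO hiM₀ hC hC₀, hyper _ hiM fun x hx => ?_, ?_,
    hyper _ hiP fun x hx => ?_, ?_⟩
  · simp only [List.pairwise_cons, List.mem_cons, List.not_mem_nil, or_false, forall_eq_or_imp,
      forall_eq, IsEmpty.forall_iff, implies_true, List.Pairwise.nil, and_true] at hdisj ⊢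
    obtain ⟨⟨h1, h2, h3⟩, ⟨h4, h5⟩, h6⟩ := hdisj
    exact ⟨⟨disjoint_orbitImage hiO h1, disjoint_orbitImage hiO h2, disjoint_orbitImage hiO h3⟩,
      ⟨disjoint_orbitImage hiM h4, disjoint_orbitImage hiM h5⟩, disjoint_orbitImage hiZ h6⟩
  · have hx' := h.mem_sigmaMinus_iff.1 hx
    exact ⟨hx'.1, {y | lambdaRatio H ν y < 0}, isOpen_lt hlc.continuous continuous_const, hx'.2,
      fun y hy => ⟨fun hyS => (h.mem_sigmaMinus_iff.1 hyS).1, fun h0 =>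
        h.mem_sigmaMinus_iff.2 ⟨h0, hy⟩⟩⟩
  · refine isEmbeddedSubmanifold_orbitImage hθ hv hN0 hiM₀ hC₀ hiZ fun x hxS hxM => ?_
    obtain ⟨⟨hx1, hx2⟩, hx3⟩ := h.mem_sigmaZero_iff.1 hxS
    have hf : ∀ k : Fin 2, ContMDiff (𝓡 (n + 1)) 𝓘(ℝ, ℝ) ∞
        (![sigmaRatio H I ν, lambdaRatio H ν] k) := by
      intro k
      fin_cases k
      · exact hσc
      · exact hlc
    have hB : ∀ k : Fin 2, HasMFDerivAt (𝓡 (n + 1)) 𝓘(ℝ, ℝ) (![sigmaRatio H I ν, lambdaRatio H ν] k) x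
        (mfderiv (𝓡 (n + 1)) 𝓘(ℝ, ℝ) (![sigmaRatio H I ν, lambdaRatio H ν] k) x) := fun k =>
      ((hf k x).mdifferentiableAt (by simp)).hasMFDerivAt
    refine ⟨M₀, toEuc ![sigmaRatio H I ν, lambdaRatio H ν], hoM, hxM,
      (contMDiff_toEuc hf).contMDiffOn, ?_, ?_, ?_⟩
    · ext y
      have h1 : toEuc ![sigmaRatio H I ν, lambdaRatio H ν] y = 0 ↔
          sigmaRatio H I ν y = 0 ∧ lambdaRatio H ν y = 0 := by
        rw [toEuc_eq_zero_iff, Fin.forall_fin_two]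
        rfl
      constructor
      · exact fun hy => ⟨hy.2, h1.2 (h.mem_sigmaZero_iff.1 hy.1).1⟩
      · exact fun hy => ⟨h.mem_sigmaZero_iff.2 ⟨h1.1 hy.2, hN0 y hy.1⟩, hy.1⟩
    · refine surjective_mfderiv_toEuc hB fun b hb => ?_
      have h1 := h.eq_zero_of_partialDeriv_relation (chart_mem_atlas (Euc (n + 1)) x)
        (mem_chart_source _ x) hx1 hx2 hx3 (a := b 0) (b := b 1) fun i => by
          have h2 := hb (coordField (chartAt (Euc (n + 1)) x) i x)
          rw [Fin.sum_univ_two] at h2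
          exact h2
      funext k
      fin_cases k
      · exact h1.1
      · exact h1.2
    · refine mfderiv_toEuc_eq_zero hB (w := scaledField ν I x) fun k => ?_
      fin_cases k
      · exact hdu x hx1
      · exact hdl x hx1 hx2
  · have hx' := h.mem_sigmaPlus_iff.1 hx
    exact ⟨hx'.1, {y | 0 < lambdaRatio H ν y}, isOpen_lt continuous_const hlc.continuous, hx'.2,
      fun y hy => ⟨fun hyS => (h.mem_sigmaPlus_iff.1 hyS).1, fun h0 =>
        h.mem_sigmaPlus_iff.2 ⟨h0, hy⟩⟩⟩
  · rw [compl_orbitImage hiO]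
    have hmem : ∀ y, y ∈ (openOrbit H I)ᶜ ↔ sigmaRatio H I ν y = 0 := fun y => by
      rw [mem_compl_iff, h.mem_openOrbit_iff, not_not]
    refine hyper _ (fun t x hx => (hmem _).2 (h.sigmaRatio_flow_eq_zero hv ((hmem x).1 hx) t))
      fun x hx => ⟨(hmem x).1 hx, univ, isOpen_univ, mem_univ x, fun y _ => hmem y⟩
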